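/- For $n\in\mathbb{Z}_{\ge1}$ let $\tau(n)$ be the number of positive divisors of $n$, let $\zeta$ be the Riemann zeta function with derivative $\zeta'$, and let $\gamma$ be the Euler–Mascheroni constant. The function $\log(t_1t_2+t_2t_3+t_1t_3)$ is Lebesgue integrable on $[0,1]^3$, and for every $\varepsilon>0$ and all real $X\ge 3$, $$\sum_{1\le x,y,z\le X}\tau(xy+yz+xz)=c_m\,X^3\log X+c_s\,X^3+O_\varepsilon\!\left(X^{3-\frac15+\varepsilon}\right),$$ where the sum runs over integers $x,y,z$, the implied constant depends only on $\varepsilon$, and $$c_m=\frac{2\zeta(3)}{\zeta(4)},\qquad c_s=\frac{4\zeta(3)}{\zeta(4)}\left(\frac{\gamma}{2}+\frac14\int_{[0,1]^3}\log(t_1t_2+t_2t_3+t_1t_3)\,d\mathbf t+\frac{\zeta'(3)}{\zeta(3)}-\frac{\zeta'(4)}{\zeta(4)}\right).$$ -/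

import Mathlib

open MeasureTheory

/-- The ternary quadratic form `xy + yz + xz` over an arbitrary commutative semiring. -/
def symForm {R : Type*} [CommSemiring R] (x y z : R) : R := x * y + y * z + x * z

/-- The sum of `τ(xy + yz + xz)` over all integers `1 ≤ x, y, z ≤ X`, for real `X`;
`τ(n)` is the number of positive divisors of `n`. -/
noncomputable def symDivisorSum (X : ℝ) : ℕ :=
  ∑ x ∈ Finset.Icc 1 ⌊X⌋₊, ∑ y ∈ Finset.Icc 1 ⌊X⌋₊, ∑ z ∈ Finset.Icc 1 ⌊X⌋₊,
    (symForm x y z).divisors.card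

/-- The function `log (t₁t₂ + t₂t₃ + t₁t₃)` of `t ∈ ℝ³`. -/
noncomputable def logSymForm (t : Fin 3 → ℝ) : ℝ := Real.log (symForm (t 0) (t 1) (t 2))

/-- The value `ζ(s)` of the Riemann zeta function at a real point `s > 1`, where it is real. -/
noncomputable def realZeta (s : ℝ) : ℝ := (riemannZeta (s : ℂ)).re

/-- The derivative `ζ'(s)` of the Riemann zeta function at a real point `s > 1`,
where it is real. -/
noncomputable def realZetaDeriv (s : ℝ) : ℝ := (deriv riemannZeta (s : ℂ)).re

/-- The coefficient of `X³ log X`. -/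
noncomputable def cSymMain : ℝ := 2 * realZeta 3 / realZeta 4

/-- The coefficient of `X³`. -/
noncomputable def cSymSecond : ℝ :=
  4 * realZeta 3 / realZeta 4 *
    (Real.eulerMascheroniConstant / 2
      + 1 / 4 * (∫ t in Set.Icc (0 : Fin 3 → ℝ) 1, logSymForm t)
      + realZetaDeriv 3 / realZeta 3 - realZetaDeriv 4 / realZeta 4)

/-! Write `Q = xy + yz + xz` and let `N` be the integer part of `X`. Divisors of `Q` run up to
`3N²`, too far for equidistribution modulo `d`, so large divisors are traded for small ones
smoothly: `τ(n) = 2 ∑_{d ∣ n} n / (n + d²)`, and dropping `d > D` costs at most `2 τ(n) n / D²`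
(`abs_card_divisors_sub_le`). Summed over the box this is `N⁵ / D²` up to `N^ε`.

For `d ≤ D` the points with `d ∣ Q` are counted by completing exponential sums. As `Q` is linear in
each variable, one summation collapses the ternary Gauss sum to a quadratic one in a single
variable, which gives square-root cancellation for every modulus, even or with square factors. This
yields `abs_boxCount_sub_le`, with error `N²/√d + N√d + d^{3/2}` up to divisor and logarithmic
factors. The mixed differences of the weight `Q / (Q + d²)` are `O(1/(xyz))`, so summation by parts
(`abs_sum_symWeight_mul_le`) inserts it at the cost of logarithms.

For the main term, `u = x + y`, `v = x + z` turn `Q = 0` into `uv = x²`, and the solution density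
modulo `d` is `∑_{m² ∣ d} φ(m) / (m² d)` (`boxCount_self_div_cube`). With `d = m² e`, the weighted
sum of densities becomes `∑ φ(m)/m⁴` times a smoothed harmonic sum equal to `½ log Q + γ - 2 log m`
up to a small error (`sum_boxCount_mul_asymp`). The value and derivative at `s = 4` of `∑ φ(m)
m^{-s} = ζ(s-1)/ζ(s)` supply the zeta constants. Summing `log Q` over the box is a Riemann sum
(`sum_log_symForm_asymp`), the source of `log N` and of the integral.

With `D ≈ N^{11/10}` the tail `N⁵/D²` is `N^{3-1/5}`, while the equidistribution error, dominated by
`D^{5/2}`, is only `N^{11/4}`, both up to `N^ε`. -/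

/-! ### The divisor bound and smoothed divisor switching -/

/-- Compare Euler factors `k + 1` and `p^{kε}`. Once `p^ε ≥ 2` the second dominates because `k + 1 ≤
2^k`; each of the fewer than `P` smaller primes loses at most the factor `K`. -/
theorem card_divisors_le_rpow (ε : ℝ) (hε : 0 < ε) :
    ∃ C : ℝ, 1 ≤ C ∧ ∀ n : ℕ, n ≠ 0 → (n.divisors.card : ℝ) ≤ C * (n : ℝ) ^ ε := by
  -- Chosen so that `K (1 + k ε log 2) ≥ 1 + k`, where `1 + k ε log 2 ≤ 2^{kε}`.
  set K : ℝ := 1 + 1 / (ε * Real.log 2) with hK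
  have hl2 : 0 < Real.log 2 := Real.log_pos (by norm_num)
  have hK1 : 1 ≤ K := by rw [hK]; have : 0 < 1 / (ε * Real.log 2) := by positivity
                         linarith
  obtain ⟨P, hP⟩ := exists_nat_gt ((2 : ℝ) ^ (1 / ε))
  refine ⟨K ^ P, one_le_pow₀ hK1, fun n hn => ?_⟩
  have factor (p : ℕ) (hp : p.Prime) (k : ℕ) :
      ((k + 1 : ℕ) : ℝ) ≤ (if p < P then K else 1) * ((p : ℝ) ^ k) ^ ε := by
    have hp2 : (2 : ℝ) ≤ p := by exact_mod_cast hp.two_le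
    have hswap : ((p : ℝ) ^ k) ^ ε = ((p : ℝ) ^ ε) ^ k := by
      rw [← Real.rpow_natCast, ← Real.rpow_mul (by linarith), mul_comm, Real.rpow_mul (by linarith),
        Real.rpow_natCast]
    split_ifs with h
    · have h1 : 1 + (k : ℝ) * (ε * Real.log 2) ≤ ((p : ℝ) ^ k) ^ ε := by
        have h2 : ((2 : ℝ) ^ k) ^ ε ≤ ((p : ℝ) ^ k) ^ ε := by gcongr
        have h3 : ((2 : ℝ) ^ k) ^ ε = Real.exp ((k : ℝ) * (ε * Real.log 2)) := by
          rw [Real.rpow_def_of_pos (by positivity), Real.log_pow]; ring_nf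
        have h4 := Real.add_one_le_exp ((k : ℝ) * (ε * Real.log 2))
        linarith
      calc ((k + 1 : ℕ) : ℝ) ≤ K * (1 + (k : ℝ) * (ε * Real.log 2)) := by
            push_cast
            have e : K * (1 + (k : ℝ) * (ε * Real.log 2))
              = 1 + k + (k * (ε * Real.log 2) + 1 / (ε * Real.log 2)) := by
              rw [hK]; field_simp; ring
            rw [e]
            have : 0 ≤ (k * (ε * Real.log 2) + 1 / (ε * Real.log 2)) := by positivity
            linarith
        _ ≤ _ := by gcongr
    · have h2 : (2 : ℝ) ≤ (p : ℝ) ^ ε := by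
        have hPp : (2 : ℝ) ^ (1 / ε) ≤ p := by
          have : (P : ℝ) ≤ p := by exact_mod_cast not_lt.mp h
          linarith
        calc (2 : ℝ) = ((2 : ℝ) ^ (1 / ε)) ^ ε := by
              rw [← Real.rpow_mul (by norm_num)]; field_simp; simp
          _ ≤ _ := by gcongr
      rw [one_mul, hswap]
      calc ((k + 1 : ℕ) : ℝ) ≤ ((2 ^ k : ℕ) : ℝ) := by exact_mod_cast Nat.lt_two_pow_self
        _ ≤ _ := by push_cast; gcongr
  have hnR : (n : ℝ) ^ ε = ∏ p ∈ n.primeFactors, ((p : ℝ) ^ n.factorization p) ^ ε := by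
    conv_lhs => rw [← Nat.prod_factorization_pow_eq_self hn]
    rw [Finsupp.prod, Nat.support_factorization]
    push_cast
    rw [Real.finsetProd_rpow]
    intro i _; positivity
  rw [Nat.card_divisors hn, hnR]
  push_cast
  calc ∏ p ∈ n.primeFactors, ((n.factorization p : ℝ) + 1)
      ≤ ∏ p ∈ n.primeFactors, ((if p < P then K else 1) * ((p : ℝ) ^ n.factorization p) ^ ε) := by
        refine Finset.prod_le_prod (fun _ _ => by positivity) fun p hp => ?_
        have := factor p (Nat.prime_of_mem_primeFactors hp) (n.factorization p)
        push_cast at this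
        exact this
    _ = (∏ p ∈ n.primeFactors, if p < P then K else 1) *
          ∏ p ∈ n.primeFactors, ((p : ℝ) ^ n.factorization p) ^ ε := Finset.prod_mul_distrib
    _ ≤ _ := by
        gcongr
        rw [Finset.prod_ite]
        simp only [Finset.prod_const, one_pow, mul_one]
        refine pow_le_pow_right₀ hK1 ?_
        calc _ ≤ (Finset.range P).card := Finset.card_le_card (by
              intro p hp; simp at hp ⊢; exact hp.2)
          _ = P := Finset.card_range P

/-- Smoothed divisor switching: the weights `n / (n + d²)` and `n / (n + (n / d)²)` add up to `1`. -/
theorem card_divisors_eq_two_mul_sum (n : ℕ) :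
    (n.divisors.card : ℝ) = 2 * ∑ d ∈ n.divisors, (n : ℝ) / (n + (d : ℝ) ^ 2) := by
  have h1 : ∑ d ∈ n.divisors, (n : ℝ) / (n + (d : ℝ) ^ 2)
      = ∑ d ∈ n.divisors, (n : ℝ) / (n + ((n / d : ℕ) : ℝ) ^ 2) :=
    (Nat.sum_div_divisors n fun d => (n : ℝ) / (n + (d : ℝ) ^ 2)).symm
  rw [two_mul]
  nth_rewrite 2 [h1]
  rw [← Finset.sum_add_distrib, Finset.card_eq_sum_ones]
  push_cast
  refine Finset.sum_congr rfl fun d hd => ?_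
  obtain ⟨⟨e, rfl⟩, hn⟩ := Nat.mem_divisors.mp hd
  have hd0 : d ≠ 0 := fun h => hn (by simp [h])
  have he0 : e ≠ 0 := fun h => hn (by simp [h])
  rw [Nat.mul_div_cancel_left _ (Nat.pos_of_ne_zero hd0)]
  have : (0 : ℝ) < d := by positivity
  have : (0 : ℝ) < e := by positivity
  push_cast
  field_simp
  ring

/-- Truncation of the smoothed divisor sum at `D`. -/
theorem abs_card_divisors_sub_le (n D : ℕ) (hD : 0 < D) :
    |(n.divisors.card : ℝ) - 2 * ∑ d ∈ Finset.Icc 1 D,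
        if d ∣ n then (n : ℝ) / (n + (d : ℝ) ^ 2) else 0|
      ≤ 2 * n.divisors.card * n / (D : ℝ) ^ 2 := by
  rcases Nat.eq_zero_or_pos n with rfl | hn
  · simp
  have hsplit : ∑ d ∈ n.divisors, (n : ℝ) / (n + (d : ℝ) ^ 2)
      = (∑ d ∈ Finset.Icc 1 D, if d ∣ n then (n : ℝ) / (n + (d : ℝ) ^ 2) else 0)
        + ∑ d ∈ n.divisors with D < d, (n : ℝ) / (n + (d : ℝ) ^ 2) := by
    rw [← Finset.sum_filter_not_add_sum_filter _ (fun d => D < d), ← Finset.sum_filter]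
    congr 1
    refine Finset.sum_congr ?_ fun _ _ => rfl
    ext d
    simp only [Finset.mem_filter, Nat.mem_divisors, Finset.mem_Icc, not_lt]
    constructor
    · rintro ⟨⟨h1, h2⟩, h3⟩; exact ⟨⟨Nat.pos_of_dvd_of_pos h1 hn, h3⟩, h1⟩
    · rintro ⟨⟨h1, h2⟩, h3⟩; exact ⟨⟨h3, hn.ne'⟩, h2⟩
  have hcard := card_divisors_eq_two_mul_sum n
  rw [hsplit, mul_add] at hcard
  rw [hcard, add_sub_cancel_left, abs_of_nonneg (by positivity), ← hcard, mul_assoc 2, mul_div_assoc]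
  gcongr
  calc ∑ d ∈ n.divisors with D < d, (n : ℝ) / (n + (d : ℝ) ^ 2)
      -- The weight decays like `n/d²`; this is what the smooth switch gains over a sharp cut at
      -- `√n`.
      ≤ ∑ d ∈ n.divisors with D < d, (n : ℝ) / (D : ℝ) ^ 2 := by
        refine Finset.sum_le_sum fun d hd => ?_
        have hDd : (D : ℝ) ≤ d := by exact_mod_cast (Finset.mem_filter.mp hd).2.le
        have : (0 : ℝ) < D := by exact_mod_cast hD
        gcongr
        nlinarith [(Nat.cast_nonneg n : (0 : ℝ) ≤ n)]
    _ ≤ n.divisors.card * ((n : ℝ) / (D : ℝ) ^ 2) := by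
        rw [Finset.sum_const, nsmul_eq_mul]
        gcongr
        exact Finset.filter_subset _ _
    _ = _ := by ring

/-! ### Gauss sums and completion of exponential sums over boxes -/

section ExponentialSums

open ZMod

variable {q : ℕ} [NeZero q]

theorem stdAddChar_norm (x : ZMod q) : ‖(stdAddChar x : ℂ)‖ = 1 := by
  rw [stdAddChar_apply]; exact Circle.norm_coe _

theorem stdAddChar_conj (x : ZMod q) :
    (starRingEnd ℂ) (stdAddChar x : ℂ) = stdAddChar (-x) := by
  rw [stdAddChar_apply, stdAddChar_apply, AddChar.map_neg_eq_inv, Circle.coe_inv_eq_conj]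

theorem sum_stdAddChar_mul (b : ZMod q) :
    ∑ x : ZMod q, (stdAddChar (x * b) : ℂ) = if b = 0 then (q : ℂ) else 0 := by
  rw [AddChar.sum_mulShift b (isPrimitive_stdAddChar q), ZMod.card]
  split_ifs <;> simp

/-- For a representative `0 ≤ h < q`, the integer `2h` is a multiple of `q` below `2q`, hence `0` or
`q`. -/
theorem card_two_mul_eq_zero_le : (Finset.univ.filter fun h : ZMod q => 2 * h = 0).card ≤ 2 := by
  have : (Finset.univ.filter fun h : ZMod q => 2 * h = 0).image (fun h => 2 * h.val)
      ⊆ {0, q} := by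
    intro m hm
    obtain ⟨h, hh, rfl⟩ := Finset.mem_image.mp hm
    have h2 : ((2 * h.val : ℕ) : ZMod q) = 0 := by
      push_cast; rw [ZMod.natCast_zmod_val]; exact (Finset.mem_filter.mp hh).2
    obtain ⟨c, hc⟩ := (ZMod.natCast_eq_zero_iff _ _).mp h2
    have hlt := ZMod.val_lt h
    have hc2 : c < 2 := by
      by_contra hcon
      have : q * 2 ≤ q * c := Nat.mul_le_mul_left q (by omega)
      omega
    interval_cases c
    · simp at hc; simp [hc]
    · simp [hc]
  have h1 := Finset.card_le_card this
  rw [Finset.card_image_of_injective] at h1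
  · exact h1.trans Finset.card_le_two
  · intro a b hab
    exact ZMod.val_injective q (by simpa using hab)

/-- The one-variable quadratic Gauss sum to an arbitrary modulus. -/
theorem norm_quadratic_gauss_sum_sq_le (k m : ZMod q) (hk : IsUnit k) :
    ‖∑ x : ZMod q, (stdAddChar (k * x ^ 2 + m * x) : ℂ)‖ ^ 2 ≤ 2 * q := by
  set S := ∑ x : ZMod q, (stdAddChar (k * x ^ 2 + m * x) : ℂ) with hS
  -- Differencing: after squaring and putting `y = h + x`, the variable `x` occurs only linearly,
  -- and orthogonality forces `2h = 0`.
  have h1 : ((‖S‖ ^ 2 : ℝ) : ℂ) =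
      ∑ h : ZMod q, stdAddChar (k * h ^ 2 + m * h) * (if 2 * h = 0 then (q : ℂ) else 0) := by
    calc ((‖S‖ ^ 2 : ℝ) : ℂ) = (starRingEnd ℂ) S * S := by
          rw [Complex.conj_mul']; push_cast; rfl
      _ = ∑ x : ZMod q, ∑ y : ZMod q,
          stdAddChar (-(k * x ^ 2 + m * x)) * stdAddChar (k * y ^ 2 + m * y) := by
          rw [hS, map_sum, Finset.sum_mul_sum]
          simp_rw [stdAddChar_conj]
      _ = ∑ x : ZMod q, ∑ h : ZMod q,
          stdAddChar (-(k * x ^ 2 + m * x)) * stdAddChar (k * (h + x) ^ 2 + m * (h + x)) := by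
          refine Finset.sum_congr rfl fun x _ => ?_
          exact (Equiv.sum_comp (Equiv.addRight x) fun y : ZMod q =>
            stdAddChar (-(k * x ^ 2 + m * x)) * (stdAddChar (k * y ^ 2 + m * y) : ℂ)).symm
      _ = ∑ h : ZMod q, ∑ x : ZMod q,
          stdAddChar (k * h ^ 2 + m * h) * stdAddChar (x * (2 * k * h)) := by
          rw [Finset.sum_comm]
          refine Finset.sum_congr rfl fun h _ => Finset.sum_congr rfl fun x _ => ?_
          rw [← AddChar.map_add_eq_mul, ← AddChar.map_add_eq_mul]
          congr 1; ring
      _ = _ := by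
          refine Finset.sum_congr rfl fun h _ => ?_
          rw [← Finset.mul_sum, sum_stdAddChar_mul]
          have : 2 * k * h = 0 ↔ 2 * h = 0 := by
            rw [mul_comm 2 k, mul_assoc]; exact hk.mul_right_eq_zero
          simp only [this]
  have h2 : ‖S‖ ^ 2 = ‖((‖S‖ ^ 2 : ℝ) : ℂ)‖ := by
    rw [Complex.norm_real, Real.norm_of_nonneg (by positivity)]
  rw [h2, h1]
  calc _ ≤ ∑ h : ZMod q, ‖(stdAddChar (k * h ^ 2 + m * h) : ℂ) *
        (if 2 * h = 0 then (q : ℂ) else 0)‖ := norm_sum_le _ _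
    _ = ∑ h : ZMod q, if 2 * h = 0 then (q : ℝ) else 0 := by
        refine Finset.sum_congr rfl fun h _ => ?_
        rw [norm_mul, stdAddChar_norm, one_mul]
        split_ifs <;> simp
    _ = (Finset.univ.filter fun h : ZMod q => 2 * h = 0).card * (q : ℝ) := by
        rw [← Finset.sum_filter, Finset.sum_const, nsmul_eq_mul]
    _ ≤ 2 * q := by
        gcongr; exact_mod_cast card_two_mul_eq_zero_le

/-- The Fourier transform of `ψ(k (uv + vw + uw))` on `(ℤ/q)³`. -/
noncomputable def symGaussSum (k ξ η ζ : ZMod q) : ℂ :=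
  ∑ u : ZMod q, (∑ v : ZMod q, (∑ w : ZMod q, (stdAddChar (k * symForm u v w) : ℂ) *
    stdAddChar (-(ζ * w))) * stdAddChar (-(η * v))) * stdAddChar (-(ξ * u))

/-- The phase is linear in `w`, with coefficient `k(u + v) - ζ`. Summing over `w` gives `q` and
fixes `v = ζ/k - u`; then `k u v = ζ u - k u²`, and a quadratic Gauss sum in `u` remains. -/
theorem norm_symGaussSum_sq_le (k ξ η ζ : ZMod q) (hk : IsUnit k) :
    ‖symGaussSum k ξ η ζ‖ ^ 2 ≤ 2 * (q : ℝ) ^ 3 := by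
  obtain ⟨k, rfl⟩ := hk
  set κ : ZMod q := ((k⁻¹ : (ZMod q)ˣ) : ZMod q) with hκ
  have hkk : (k : ZMod q) * κ = 1 := by simp [hκ]
  have hinner (u v : ZMod q) : ∑ w : ZMod q, (stdAddChar ((k : ZMod q) * symForm u v w) : ℂ) *
      stdAddChar (-(ζ * w)) = if v = κ * ζ - u then stdAddChar ((k : ZMod q) * (u * v)) * q else 0 := by
    have : ∑ w : ZMod q, (stdAddChar ((k : ZMod q) * symForm u v w) : ℂ) * stdAddChar (-(ζ * w))
        = stdAddChar ((k : ZMod q) * (u * v)) *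
          ∑ w : ZMod q, stdAddChar (w * ((k : ZMod q) * (u + v) - ζ)) := by
      rw [Finset.mul_sum]
      refine Finset.sum_congr rfl fun w _ => ?_
      rw [← AddChar.map_add_eq_mul, ← AddChar.map_add_eq_mul]
      congr 1; unfold symForm; ring
    rw [this, sum_stdAddChar_mul]
    have hiff : (k : ZMod q) * (u + v) - ζ = 0 ↔ v = κ * ζ - u := by
      constructor
      · intro h
        have : κ * ((k : ZMod q) * (u + v) - ζ) = 0 := by rw [h, mul_zero]
        linear_combination this - (u + v) * hkk
      · rintro rfl; linear_combination ζ * hkk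
    simp only [hiff]
    split_ifs <;> simp
  have hval : symGaussSum (k : ZMod q) ξ η ζ = (q : ℂ) * stdAddChar (-(η * (κ * ζ))) *
      ∑ u : ZMod q, stdAddChar ((-k : ZMod q) * u ^ 2 + (ζ + η - ξ) * u) := by
    unfold symGaussSum
    rw [Finset.mul_sum]
    refine Finset.sum_congr rfl fun u _ => ?_
    simp only [hinner, ite_mul, zero_mul, Finset.sum_ite_eq', Finset.mem_univ, if_true]
    rw [mul_comm (_ : ℂ) (q : ℂ), mul_assoc, mul_assoc, mul_assoc, ← AddChar.map_add_eq_mul,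
      ← AddChar.map_add_eq_mul, ← AddChar.map_add_eq_mul]
    congr 2
    linear_combination u * ζ * hkk
  rw [hval, norm_mul, norm_mul, stdAddChar_norm, mul_one, mul_pow, Complex.norm_natCast]
  have := norm_quadratic_gauss_sum_sq_le (-k : ZMod q) (ζ + η - ξ) k.isUnit.neg
  calc _ ≤ (q : ℝ) ^ 2 * (2 * q) := by gcongr
    _ = _ := by ring

/-- The Fourier coefficients of an initial interval. -/
noncomputable def intervalCharSum (a : ℕ) (ξ : ZMod q) : ℂ :=
  ∑ n ∈ Finset.Icc 1 a, (stdAddChar (ξ * (n : ZMod q)) : ℂ)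

@[simp] theorem intervalCharSum_zero (a : ℕ) : intervalCharSum a (0 : ZMod q) = a := by
  simp [intervalCharSum]

/-- Fourier inversion in one coordinate; `box_sum_eq` applies it three times. -/
theorem sum_Icc_eq_sum_fourier (a : ℕ) (g : ZMod q → ℂ) :
    ∑ n ∈ Finset.Icc 1 a, g (n : ZMod q)
      = ∑ ξ : ZMod q, (q : ℂ)⁻¹ * intervalCharSum a ξ * ∑ u : ZMod q, g u * stdAddChar (-(ξ * u)) := by
  have hq : (q : ℂ) ≠ 0 := NeZero.ne _
  have hpt (v : ZMod q) : g v =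
      ∑ ξ : ZMod q, (q : ℂ)⁻¹ * stdAddChar (ξ * v) * ∑ u : ZMod q, g u * stdAddChar (-(ξ * u)) := by
    simp_rw [Finset.mul_sum]
    rw [Finset.sum_comm]
    have (u : ZMod q) : ∑ ξ : ZMod q, (q : ℂ)⁻¹ * stdAddChar (ξ * v) * (g u * stdAddChar (-(ξ * u)))
        = if u = v then g u else 0 := by
      have : ∑ ξ : ZMod q, (q : ℂ)⁻¹ * stdAddChar (ξ * v) * (g u * stdAddChar (-(ξ * u)))
          = (q : ℂ)⁻¹ * g u * ∑ ξ : ZMod q, stdAddChar (ξ * (v - u)) := by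
        rw [Finset.mul_sum]
        refine Finset.sum_congr rfl fun ξ _ => ?_
        rw [mul_sub, sub_eq_add_neg, AddChar.map_add_eq_mul]; ring
      rw [this, sum_stdAddChar_mul]
      simp only [sub_eq_zero, eq_comm (a := v)]
      split_ifs
      · field_simp
      · simp
    simp [this]
  simp_rw [intervalCharSum, Finset.mul_sum (s := Finset.Icc 1 a), Finset.sum_mul]
  rw [Finset.sum_comm]
  exact Finset.sum_congr rfl fun n _ => hpt n

/-- Completion of the exponential sum over a box. -/
theorem box_sum_eq (k : ZMod q) (a b c : ℕ) :
    ∑ x ∈ Finset.Icc 1 a, ∑ y ∈ Finset.Icc 1 b, ∑ z ∈ Finset.Icc 1 c,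
        (stdAddChar (k * ((symForm x y z : ℕ) : ZMod q)) : ℂ)
      = ∑ ν : ZMod q × ZMod q × ZMod q, ((q : ℂ)⁻¹) ^ 3 * symGaussSum k ν.1 ν.2.1 ν.2.2 *
          (intervalCharSum a ν.1 * (intervalCharSum b ν.2.1 * intervalCharSum c ν.2.2)) := by
  have hcast (x y z : ℕ) : ((symForm x y z : ℕ) : ZMod q) = symForm (x : ZMod q) y z := by
    simp [symForm]
  simp_rw [hcast]
  set A : ℕ → ZMod q → ℂ := fun a ξ => (q : ℂ)⁻¹ * intervalCharSum a ξ with hA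
  set F : ZMod q → ZMod q → ZMod q → ℂ := fun u v w => stdAddChar (k * symForm u v w) with hF
  set F3 : ZMod q → ZMod q → ZMod q → ℂ := fun u v ζ =>
    ∑ w : ZMod q, F u v w * stdAddChar (-(ζ * w)) with hF3
  set F2 : ZMod q → ZMod q → ZMod q → ℂ := fun u η ζ =>
    ∑ v : ZMod q, F3 u v ζ * stdAddChar (-(η * v)) with hF2
  calc _ = ∑ x ∈ Finset.Icc 1 a, ∑ y ∈ Finset.Icc 1 b, ∑ ζ, A c ζ * F3 x y ζ :=
        Finset.sum_congr rfl fun x _ => Finset.sum_congr rfl fun y _ =>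
          sum_Icc_eq_sum_fourier c (F x y)
    _ = ∑ x ∈ Finset.Icc 1 a, ∑ ζ, A c ζ * ∑ η, A b η * F2 x η ζ := by
        refine Finset.sum_congr rfl fun x _ => ?_
        rw [Finset.sum_comm]
        refine Finset.sum_congr rfl fun ζ _ => ?_
        rw [← Finset.mul_sum]
        congr 1
        exact sum_Icc_eq_sum_fourier b (fun v => F3 x v ζ)
    _ = ∑ ζ, A c ζ * ∑ η, A b η * ∑ ξ, A a ξ * symGaussSum k ξ η ζ := by
        rw [Finset.sum_comm]
        refine Finset.sum_congr rfl fun ζ _ => ?_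
        rw [← Finset.mul_sum, Finset.sum_comm]
        congr 1
        refine Finset.sum_congr rfl fun η _ => ?_
        rw [← Finset.mul_sum]
        congr 1
        exact sum_Icc_eq_sum_fourier a (fun u => F2 u η ζ)
    _ = _ := by
        rw [Fintype.sum_prod_type, Finset.sum_comm' (t' := Finset.univ) (s' := fun _ => Finset.univ)
          (by simp), Fintype.sum_prod_type, Finset.sum_comm]
        refine Finset.sum_congr rfl fun ζ _ => ?_
        rw [Finset.mul_sum]
        refine Finset.sum_congr rfl fun η _ => ?_
        rw [Finset.mul_sum, Finset.mul_sum]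
        refine Finset.sum_congr rfl fun ξ _ => ?_
        simp only [hA]; ring

theorem intervalCharSum_eq_geom_sum (a : ℕ) (ξ : ZMod q) :
    intervalCharSum a ξ = stdAddChar ξ * ∑ n ∈ Finset.range a, (stdAddChar ξ : ℂ) ^ n := by
  unfold intervalCharSum
  rw [Finset.mul_sum, Finset.range_eq_Ico]
  simp_rw [← pow_succ']
  rw [Finset.sum_Ico_add' (fun n => (stdAddChar ξ : ℂ) ^ n) 0 a 1]
  refine Finset.sum_congr (by ext; simp) fun n _ => ?_
  rw [← AddChar.map_nsmul_eq_pow]; simp [mul_comm]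

/-- A geometric sum with ratio `z` is at most `2 / ‖z - 1‖`. The distance from `ξ` to the nearest
multiple of `q` is a minimum of two terms; its inverse is relaxed to the sum of the two inverses, so
that summing over `ξ` gives harmonic sums. -/
theorem norm_intervalCharSum_le (a : ℕ) (ξ : ZMod q) (hξ : ξ ≠ 0) :
    ‖intervalCharSum a ξ‖ ≤ q / 2 * ((ξ.val : ℝ)⁻¹ + ((q - ξ.val : ℕ) : ℝ)⁻¹) := by
  set j := ξ.val with hj
  have hjq : j < q := ZMod.val_lt ξ
  have hj0 : 0 < j := Nat.pos_of_ne_zero fun h => hξ ((ZMod.val_eq_zero ξ).mp h)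
  have hjR : (0 : ℝ) < j := by exact_mod_cast hj0
  have hcR : ((q - j : ℕ) : ℝ) = q - j := by push_cast [hjq.le]; ring
  have hcpos : (0 : ℝ) < q - j := by
    have : (j : ℝ) < q := by exact_mod_cast hjq
    linarith
  have hqR : (0 : ℝ) < q := by linarith
  set z : ℂ := stdAddChar ξ with hz
  have hz_exp : z = Complex.exp (Complex.I * ((2 * Real.pi * j / q : ℝ) : ℂ)) := by
    have : ξ = ((j : ℤ) : ZMod q) := by simp [hj]
    rw [hz, this, stdAddChar_coe]; congr 1; push_cast; ring
  have hnorm : ‖z - 1‖ = 2 * Real.sin (Real.pi * j / q) := by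
    rw [hz_exp, Complex.norm_exp_I_mul_ofReal_sub_one, Real.norm_eq_abs, abs_of_nonneg]
    · congr 2; ring
    · apply mul_nonneg (by norm_num)
      apply Real.sin_nonneg_of_nonneg_of_le_pi (by positivity)
      rw [div_div, div_le_iff₀ (by positivity)]
      nlinarith [Real.pi_pos]
  -- Jordan's inequality `sin t ≥ 2t/π` on `[0, π/2]`, applied to `π j / q` or to its reflection.
  have hlow : 4 / q * min (j : ℝ) (q - j) ≤ ‖z - 1‖ := by
    rw [hnorm]
    rcases le_total (j : ℝ) (q - j) with h | h
    · rw [min_eq_left h]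
      have := Real.mul_le_sin (x := Real.pi * j / q) (by positivity) (by
        rw [div_le_iff₀ hqR]; nlinarith [Real.pi_pos])
      have e : 2 / Real.pi * (Real.pi * j / q) = 2 / q * j := by
        field_simp
      rw [e] at this
      have e2 : 4 / (q : ℝ) * j = 2 * (2 / q * j) := by ring
      linarith
    · rw [min_eq_right h]
      have := Real.mul_le_sin (x := Real.pi * (q - j) / q) (by positivity) (by
        rw [div_le_iff₀ hqR]; nlinarith [Real.pi_pos])
      have e : 2 / Real.pi * (Real.pi * (q - j) / q) = 2 / q * (q - j) := by
        field_simp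
      have e3 : Real.pi * (q - j) / q = Real.pi - Real.pi * j / q := by field_simp
      rw [e, e3, Real.sin_pi_sub] at this
      have e2 : 4 / (q : ℝ) * (q - j) = 2 * (2 / q * (q - j)) := by ring
      linarith
  have hmin : 0 < min (j : ℝ) (q - j) := lt_min hjR hcpos
  have hgeom : ‖intervalCharSum a ξ‖ * ‖z - 1‖ ≤ 2 := by
    have : intervalCharSum a ξ * (z - 1) = z * (z ^ a - 1) := by
      rw [intervalCharSum_eq_geom_sum, mul_assoc, geom_sum_mul]
    rw [← norm_mul, this, norm_mul, hz, stdAddChar_norm, one_mul]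
    calc _ ≤ ‖(stdAddChar ξ : ℂ) ^ a‖ + ‖(1 : ℂ)‖ := norm_sub_le _ _
      _ = 2 := by rw [norm_pow, stdAddChar_norm]; norm_num
  have h1 : ‖intervalCharSum a ξ‖ * (4 / q * min (j : ℝ) (q - j)) ≤ 2 :=
    (mul_le_mul_of_nonneg_left hlow (norm_nonneg _)).trans hgeom
  have h2 : ‖intervalCharSum a ξ‖ ≤ q / 2 * (min (j : ℝ) (q - j))⁻¹ := by
    rw [← div_eq_mul_inv, le_div_iff₀ hmin]
    have : ‖intervalCharSum a ξ‖ * (4 / q * min (j : ℝ) (q - j))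
      = ‖intervalCharSum a ξ‖ * min (j : ℝ) (q - j) * (4 / q) := by ring
    rw [this, ← le_div_iff₀ (by positivity)] at h1
    refine h1.trans (le_of_eq ?_); field_simp; norm_num
  refine h2.trans ?_
  rw [hcR]
  gcongr
  rcases le_total (j : ℝ) (q - j) with h | h
  · rw [min_eq_left h]; have := inv_pos.mpr hcpos; linarith
  · rw [min_eq_right h]; have := inv_pos.mpr hjR; linarith

theorem sum_norm_intervalCharSum_le (a : ℕ) :
    ∑ ξ : ZMod q, ‖intervalCharSum a ξ‖ ≤ a + q * (1 + Real.log q) := by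
  rw [← Finset.add_sum_erase _ _ (Finset.mem_univ (0 : ZMod q)), intervalCharSum_zero,
    Complex.norm_natCast]
  gcongr
  calc ∑ ξ ∈ Finset.univ.erase (0 : ZMod q), ‖intervalCharSum a ξ‖
      ≤ ∑ ξ ∈ Finset.univ.erase (0 : ZMod q),
          (q / 2 * ((ξ.val : ℝ)⁻¹ + ((q - ξ.val : ℕ) : ℝ)⁻¹)) :=
        Finset.sum_le_sum fun ξ hξ => norm_intervalCharSum_le a ξ (Finset.ne_of_mem_erase hξ)
    _ = ∑ j ∈ Finset.Ico 1 q, (q / 2 * ((j : ℝ)⁻¹ + ((q - j : ℕ) : ℝ)⁻¹)) := by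
        refine Finset.sum_nbij ZMod.val ?_ ?_ ?_ fun _ _ => rfl
        · intro ξ hξ
          have h0 := Finset.ne_of_mem_erase hξ
          rw [Finset.mem_Ico]
          exact ⟨Nat.pos_of_ne_zero fun h => h0 ((ZMod.val_eq_zero ξ).mp h), ZMod.val_lt ξ⟩
        · exact (ZMod.val_injective q).injOn
        · intro j hj
          simp only [Finset.coe_Ico, Set.mem_Ico] at hj
          refine ⟨(j : ZMod q), ?_, ZMod.val_natCast_of_lt hj.2⟩
          simp only [Finset.coe_erase, Finset.coe_univ, Set.mem_sdiff, Set.mem_univ, true_and,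
            Set.mem_singleton_iff]
          intro h
          have := ZMod.val_natCast_of_lt hj.2
          rw [h, ZMod.val_zero] at this
          omega
    _ = q * ∑ j ∈ Finset.Ico 1 q, (j : ℝ)⁻¹ := by
        rw [← Finset.mul_sum, Finset.sum_add_distrib]
        have : ∑ j ∈ Finset.Ico 1 q, ((q - j : ℕ) : ℝ)⁻¹ = ∑ j ∈ Finset.Ico 1 q, (j : ℝ)⁻¹ := by
          refine Finset.sum_nbij' (fun j => q - j) (fun j => q - j) ?_ ?_ ?_ ?_ fun _ _ => rfl
          all_goals intro j hj; simp only [Finset.mem_Ico] at *; omega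
        rw [this]; ring
    _ ≤ q * (1 + Real.log q) := by
        gcongr
        have h := harmonic_le_one_add_log q
        simp_rw [harmonic_eq_sum_Icc, Rat.cast_sum, Rat.cast_inv, Rat.cast_natCast] at h
        refine le_trans (Finset.sum_le_sum_of_subset_of_nonneg ?_ fun _ _ _ => by positivity) h
        intro j hj; simp only [Finset.mem_Ico, Finset.mem_Icc] at *; omega

/-- The subtracted term is the zero frequency. The others carry Gauss sums of size at most `2
q^{3/2}`, against `q⁻³` from inversion, and products of interval sums whose total factors over the
coordinates. -/
theorem norm_box_sum_sub_le (k : ZMod q) (hk : IsUnit k) (a b c N : ℕ) (ha : a ≤ N) (hb : b ≤ N)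
    (hc : c ≤ N) :
    ‖∑ x ∈ Finset.Icc 1 a, ∑ y ∈ Finset.Icc 1 b, ∑ z ∈ Finset.Icc 1 c,
        (stdAddChar (k * ((symForm x y z : ℕ) : ZMod q)) : ℂ)
      - ((q : ℂ)⁻¹) ^ 3 * symGaussSum k 0 0 0 * (a * (b * c))‖
      ≤ 2 / √q ^ 3 * ((N + q * (1 + Real.log q)) ^ 3 - N ^ 3) := by
  have hq0 : (0 : ℝ) < q := by exact_mod_cast NeZero.pos q
  set T : ℝ := q * (1 + Real.log q) with hT
  have hT0 : 0 ≤ T := by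
    have : 0 ≤ Real.log q := Real.log_natCast_nonneg q
    positivity
  have hG (ξ η ζ : ZMod q) : ‖symGaussSum k ξ η ζ‖ ≤ 2 * √q ^ 3 := by
    refine abs_le_of_sq_le_sq' ?_ (by positivity) |>.2
    refine (norm_symGaussSum_sq_le k ξ η ζ hk).trans ?_
    have : (2 * √(q : ℝ) ^ 3) ^ 2 = 4 * (√(q : ℝ) ^ 2) ^ 3 := by ring
    rw [this, Real.sq_sqrt hq0.le]
    have : (0 : ℝ) < (q : ℝ) ^ 3 := by positivity
    linarith
  rw [box_sum_eq, ← Finset.add_sum_erase _ _ (Finset.mem_univ ((0, 0, 0) : ZMod q × ZMod q × ZMod q))]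
  simp only [intervalCharSum_zero]
  rw [add_sub_cancel_left]
  set P : ZMod q × ZMod q × ZMod q → ℝ := fun ν =>
    ‖intervalCharSum a ν.1‖ * (‖intervalCharSum b ν.2.1‖ * ‖intervalCharSum c ν.2.2‖) with hP
  have hsumP : ∑ ν ∈ Finset.univ.erase ((0, 0, 0) : ZMod q × ZMod q × ZMod q), P ν
      ≤ (N + T) ^ 3 - N ^ 3 := by
    have h1 : ∑ ν, P ν ≤ (a + T) * ((b + T) * (c + T)) := by
      have : ∑ ν, P ν = (∑ ξ : ZMod q, ‖intervalCharSum a ξ‖) *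
          ((∑ ξ : ZMod q, ‖intervalCharSum b ξ‖) * ∑ ξ : ZMod q, ‖intervalCharSum c ξ‖) := by
        simp only [hP, Fintype.sum_prod_type, Finset.sum_mul_sum]
        simp only [Finset.mul_sum]
      rw [this]
      gcongr <;> exact sum_norm_intervalCharSum_le _
    rw [← Finset.add_sum_erase _ _ (Finset.mem_univ ((0, 0, 0) : ZMod q × ZMod q × ZMod q))] at h1
    have h0 : P (0, 0, 0) = a * (b * c) := by simp [hP]
    rw [h0] at h1
    have haR : (a : ℝ) ≤ N := by exact_mod_cast ha
    have hbR : (b : ℝ) ≤ N := by exact_mod_cast hb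
    have hcR : (c : ℝ) ≤ N := by exact_mod_cast hc
    -- Once `abc` is removed, the expansion has nonnegative coefficients, so each side may be
    -- enlarged to `N`.
    have e : (a + T) * ((b + T) * (c + T)) - a * (b * c)
      = T * (a * b + b * c + a * c) + T ^ 2 * (a + b + c) + T ^ 3 := by ring
    have e2 : ((N : ℝ) + T) ^ 3 - N ^ 3 = T * (N * N + N * N + N * N) + T ^ 2 * (N + N + N) + T ^ 3 := by
      ring
    rw [e2]
    refine (le_sub_iff_add_le'.mpr h1).trans ?_
    rw [e]
    gcongr
  calc _ ≤ ∑ ν ∈ Finset.univ.erase ((0, 0, 0) : ZMod q × ZMod q × ZMod q),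
        ‖((q : ℂ)⁻¹) ^ 3 * symGaussSum k ν.1 ν.2.1 ν.2.2 *
          (intervalCharSum a ν.1 * (intervalCharSum b ν.2.1 * intervalCharSum c ν.2.2))‖ :=
        norm_sum_le _ _
    _ ≤ ∑ ν ∈ Finset.univ.erase ((0, 0, 0) : ZMod q × ZMod q × ZMod q), 2 / √q ^ 3 * P ν := by
        refine Finset.sum_le_sum fun ν _ => ?_
        rw [norm_mul, norm_mul, norm_mul, norm_mul, norm_pow, norm_inv, Complex.norm_natCast]
        refine mul_le_mul_of_nonneg_right ?_ (by positivity)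
        calc ((q : ℝ)⁻¹) ^ 3 * ‖symGaussSum k ν.1 ν.2.1 ν.2.2‖
            ≤ ((q : ℝ)⁻¹) ^ 3 * (2 * √q ^ 3) := by gcongr; exact hG _ _ _
          _ = 2 / √q ^ 3 := by
            have hs : (q : ℝ) = √q ^ 2 := (Real.sq_sqrt hq0.le).symm
            have : 0 < √(q : ℝ) := Real.sqrt_pos.mpr hq0
            rw [show ((q : ℝ)⁻¹) = (√q ^ 2)⁻¹ by rw [← hs]]
            field_simp
    _ = 2 / √q ^ 3 * ∑ ν ∈ Finset.univ.erase ((0, 0, 0) : ZMod q × ZMod q × ZMod q), P ν := by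
        rw [Finset.mul_sum]
    _ ≤ _ := by gcongr

/-- Over a box whose sides are multiples of the modulus the completed sum is exact. -/
theorem box_sum_eq_of_dvd (k : ZMod q) (d : ℕ) (hd : q ∣ d) :
    ∑ x ∈ Finset.Icc 1 d, ∑ y ∈ Finset.Icc 1 d, ∑ z ∈ Finset.Icc 1 d,
        (stdAddChar (k * ((symForm x y z : ℕ) : ZMod q)) : ℂ)
      = ((q : ℂ)⁻¹) ^ 3 * symGaussSum k 0 0 0 * (d * (d * d)) := by
  have hvan (ξ : ZMod q) (hξ : ξ ≠ 0) : intervalCharSum d ξ = 0 := by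
    set z : ℂ := stdAddChar ξ with hz
    have hz1 : z ≠ 1 := by
      intro h
      apply hξ
      apply injective_stdAddChar
      rw [← hz, h, AddChar.map_zero_eq_one]
    have hzd : z ^ d = 1 := by
      rw [hz, ← AddChar.map_nsmul_eq_pow, nsmul_eq_mul, (ZMod.natCast_eq_zero_iff d q).mpr hd,
        zero_mul, AddChar.map_zero_eq_one]
    rw [intervalCharSum_eq_geom_sum, geom_sum_eq hz1, hzd]; simp
  rw [box_sum_eq, Finset.sum_eq_single ((0, 0, 0) : ZMod q × ZMod q × ZMod q)]
  · simp
  · rintro ⟨ξ, η, ζ⟩ _ hne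
    by_cases h1 : ξ = 0
    · by_cases h2 : η = 0
      · by_cases h3 : ζ = 0
        · exact absurd (by rw [h1, h2, h3]) hne
        · simp [hvan ζ h3]
      · simp [hvan η h2]
    · simp [hvan ξ h1]
  · simp

end ExponentialSums

/-! ### Equidistribution of solutions modulo `d` in boxes -/

/-- The number of points of a box with `d ∣ xy + yz + xz`. -/
def boxCount (d a b c : ℕ) : ℕ :=
  ∑ x ∈ Finset.Icc 1 a, ∑ y ∈ Finset.Icc 1 b, ∑ z ∈ Finset.Icc 1 c,
    if d ∣ symForm x y z then 1 else 0

/-- The fraction `t/d` is reduced to lowest terms `k/q`, so that the Gauss sum bound applies. One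
constant `M` serves both for general boxes and, exactly, for the full period; the main term thus
becomes the solution density without evaluating any Gauss sum. -/
theorem box_sum_phase_approx (d t N : ℕ) [NeZero d] :
    ∃ M : ℂ, (∀ a b c : ℕ, a ≤ N → b ≤ N → c ≤ N →
      ‖∑ x ∈ Finset.Icc 1 a, ∑ y ∈ Finset.Icc 1 b, ∑ z ∈ Finset.Icc 1 c,
        (ZMod.stdAddChar ((t : ZMod d) * ((symForm x y z : ℕ) : ZMod d)) : ℂ) - M * (a * (b * c))‖
      ≤ 2 / √((d / d.gcd t : ℕ) : ℝ) ^ 3 *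
        ((N + (d / d.gcd t : ℕ) * (1 + Real.log (d / d.gcd t : ℕ))) ^ 3 - N ^ 3)) ∧
    ∑ x ∈ Finset.Icc 1 d, ∑ y ∈ Finset.Icc 1 d, ∑ z ∈ Finset.Icc 1 d,
        (ZMod.stdAddChar ((t : ZMod d) * ((symForm x y z : ℕ) : ZMod d)) : ℂ)
      = M * (d * (d * d)) := by
  have hd : 0 < d := NeZero.pos d
  have hg : 0 < d.gcd t := Nat.gcd_pos_of_pos_left t hd
  set q := d / d.gcd t with hq
  set k := t / d.gcd t with hk
  have hdq : d = d.gcd t * q := (Nat.mul_div_cancel' (Nat.gcd_dvd_left d t)).symm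
  have htk : t = d.gcd t * k := (Nat.mul_div_cancel' (Nat.gcd_dvd_right d t)).symm
  have hq0 : q ≠ 0 := by rintro h; rw [h, mul_zero] at hdq; omega
  have : NeZero q := ⟨hq0⟩
  have hunit : IsUnit (k : ZMod q) := by
    rw [ZMod.isUnit_iff_coprime]
    exact (Nat.coprime_div_gcd_div_gcd hg).symm
  have hphase (n : ℕ) : (ZMod.stdAddChar ((t : ZMod d) * (n : ZMod d)) : ℂ)
      = ZMod.stdAddChar ((k : ZMod q) * (n : ZMod q)) := by
    have h1 : (t : ZMod d) * (n : ZMod d) = ((t * n : ℤ) : ZMod d) := by push_cast; rfl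
    have h2 : (k : ZMod q) * (n : ZMod q) = ((k * n : ℤ) : ZMod q) := by push_cast; rfl
    rw [h1, h2, ZMod.stdAddChar_coe, ZMod.stdAddChar_coe]
    congr 1
    have hgC : ((d.gcd t : ℕ) : ℂ) ≠ 0 := by exact_mod_cast hg.ne'
    have hqC : (q : ℂ) ≠ 0 := by exact_mod_cast hq0
    have hdC : (d : ℂ) = (d.gcd t : ℕ) * q := by exact_mod_cast hdq
    have htC : (t : ℂ) = (d.gcd t : ℕ) * k := by exact_mod_cast htk
    push_cast
    rw [hdC, htC]
    field_simp
  simp_rw [hphase]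
  refine ⟨((q : ℂ)⁻¹) ^ 3 * symGaussSum (k : ZMod q) 0 0 0, fun a b c ha hb hc => ?_, ?_⟩
  · exact norm_box_sum_sub_le _ hunit a b c N ha hb hc
  · exact box_sum_eq_of_dvd _ d (Nat.div_dvd_of_dvd (Nat.gcd_dvd_left d t))

theorem boxCount_eq_sum_phase (d a b c : ℕ) [NeZero d] :
    (boxCount d a b c : ℂ) = (d : ℂ)⁻¹ * ∑ t ∈ Finset.range d,
      ∑ x ∈ Finset.Icc 1 a, ∑ y ∈ Finset.Icc 1 b, ∑ z ∈ Finset.Icc 1 c,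
        (ZMod.stdAddChar ((t : ZMod d) * ((symForm x y z : ℕ) : ZMod d)) : ℂ) := by
  have hdC : (d : ℂ) ≠ 0 := NeZero.ne _
  have hdet (n : ℕ) : ∑ t ∈ Finset.range d, (ZMod.stdAddChar ((t : ZMod d) * (n : ZMod d)) : ℂ)
      = if d ∣ n then (d : ℂ) else 0 := by
    have h1 : ∑ t ∈ Finset.range d, (ZMod.stdAddChar ((t : ZMod d) * (n : ZMod d)) : ℂ)
        = ∑ t : ZMod d, (ZMod.stdAddChar (t * (n : ZMod d)) : ℂ) := by
      refine Finset.sum_nbij' (fun t => (t : ZMod d)) ZMod.val (by simp) ?_ ?_ ?_ (by simp)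
      · intro t _; exact Finset.mem_range.mpr (ZMod.val_lt t)
      · intro t ht; exact ZMod.val_natCast_of_lt (Finset.mem_range.mp ht)
      · intro t _; simp
    rw [h1, sum_stdAddChar_mul]
    simp only [ZMod.natCast_eq_zero_iff]
  rw [Finset.sum_comm]
  simp_rw [Finset.sum_comm (s := Finset.range d), hdet]
  unfold boxCount
  push_cast
  simp_rw [Finset.mul_sum]
  refine Finset.sum_congr rfl fun x _ => Finset.sum_congr rfl fun y _ =>
    Finset.sum_congr rfl fun z _ => ?_
  split_ifs
  · field_simp
  · simp

theorem abs_boxCount_sub_le_sum (d N a b c : ℕ) (hd : 0 < d) (ha : a ≤ N) (hb : b ≤ N)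
    (hc : c ≤ N) :
    |(boxCount d a b c : ℝ) - boxCount d d d d / (d : ℝ) ^ 3 * (a * (b * c))| ≤
      (d : ℝ)⁻¹ * ∑ t ∈ Finset.range d, 2 / √((d / d.gcd t : ℕ) : ℝ) ^ 3 *
        ((N + (d / d.gcd t : ℕ) * (1 + Real.log (d / d.gcd t : ℕ))) ^ 3 - N ^ 3) := by
  have : NeZero d := ⟨hd.ne'⟩
  have hdC : (d : ℂ) ≠ 0 := NeZero.ne _
  choose M hM1 hM2 using fun t : ℕ => box_sum_phase_approx d t N
  have key : (((boxCount d a b c : ℝ) - boxCount d d d d / (d : ℝ) ^ 3 * (a * (b * c)) : ℝ) : ℂ)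
      = (d : ℂ)⁻¹ * ∑ t ∈ Finset.range d,
        (∑ x ∈ Finset.Icc 1 a, ∑ y ∈ Finset.Icc 1 b, ∑ z ∈ Finset.Icc 1 c,
          (ZMod.stdAddChar ((t : ZMod d) * ((symForm x y z : ℕ) : ZMod d)) : ℂ)
          - M t * (a * (b * c))) := by
    push_cast
    rw [boxCount_eq_sum_phase d a b c, boxCount_eq_sum_phase d d d d]
    simp_rw [hM2, Finset.sum_sub_distrib, ← Finset.sum_mul]
    field_simp
  have hnorm : |(boxCount d a b c : ℝ) - boxCount d d d d / (d : ℝ) ^ 3 * (a * (b * c))|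
      = ‖(((boxCount d a b c : ℝ) - boxCount d d d d / (d : ℝ) ^ 3 * (a * (b * c)) : ℝ) : ℂ)‖ := by
    rw [Complex.norm_real, Real.norm_eq_abs]
  rw [hnorm, key, norm_mul, norm_inv, Complex.norm_natCast]
  gcongr
  exact (norm_sum_le _ _).trans (Finset.sum_le_sum fun t _ => hM1 t a b c ha hb hc)

/-- Equidistribution of the solutions of `d ∣ xy + yz + xz` in boxes. -/
theorem abs_boxCount_sub_le (d N a b c : ℕ) (hd : 0 < d) (ha : a ≤ N) (hb : b ≤ N) (hc : c ≤ N) :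
    |(boxCount d a b c : ℝ) - boxCount d d d d / (d : ℝ) ^ 3 * (a * (b * c))| ≤
      6 * d.divisors.card * (1 + Real.log d) ^ 3 *
        ((N : ℝ) ^ 2 / √d + N * √d + √d ^ 3) := by
  refine (abs_boxCount_sub_le_sum d N a b c hd ha hb hc).trans ?_
  have hdR : (0 : ℝ) < d := by exact_mod_cast hd
  set r := √(d : ℝ) with hr
  have hr0 : 0 < r := Real.sqrt_pos.mpr hdR
  have hdr : (d : ℝ) = r ^ 2 := (Real.sq_sqrt hdR.le).symm
  set ℓ := 1 + Real.log d with hℓ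
  have hlog : 0 ≤ Real.log d := Real.log_natCast_nonneg d
  have hℓ1 : 1 ≤ ℓ := by rw [hℓ]; linarith
  set β : ℕ → ℝ := fun q => 2 / √(q : ℝ) ^ 3 * ((N + q * (1 + Real.log q)) ^ 3 - N ^ 3) with hβ
  -- After multiplication by `q`, which bounds the number of `t` with a given denominator, every
  -- term grows with `q`, so `q = d` is the worst case.
  have hbound (q : ℕ) (hq : 0 < q) (hqd : q ∣ d) :
      q * β q ≤ 6 * ℓ ^ 3 * ((N : ℝ) ^ 2 * r + N * r ^ 3 + r ^ 5) := by
    have hqR : (0 : ℝ) < q := by exact_mod_cast hq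
    set s := √(q : ℝ) with hs
    have hs0 : 0 < s := Real.sqrt_pos.mpr hqR
    have hqs : (q : ℝ) = s ^ 2 := (Real.sq_sqrt hqR.le).symm
    have hqd' : (q : ℝ) ≤ d := by exact_mod_cast Nat.le_of_dvd hd hqd
    have hsr : s ≤ r := Real.sqrt_le_sqrt hqd'
    set l := 1 + Real.log q with hl
    have hl1 : 1 ≤ l := by
      have : 0 ≤ Real.log q := Real.log_natCast_nonneg q
      rw [hl]; linarith
    have hll : l ≤ ℓ := by rw [hl, hℓ]; gcongr
    have hN : (0 : ℝ) ≤ N := Nat.cast_nonneg N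
    have e : q * β q = 2 * (3 * N ^ 2 * (l * s) + 3 * N * (l ^ 2 * s ^ 3) + l ^ 3 * s ^ 5) := by
      simp only [hβ]
      rw [← hs, ← hl, hqs]
      field_simp
      ring
    rw [e]
    have h1 : l * s ≤ ℓ ^ 3 * r := by
      have : l ≤ ℓ ^ 3 := hll.trans (le_self_pow₀ hℓ1 (by norm_num))
      gcongr
    have h2 : l ^ 2 * s ^ 3 ≤ ℓ ^ 3 * r ^ 3 := by
      have : l ^ 2 ≤ ℓ ^ 3 := (pow_le_pow_left₀ (by linarith) hll 2).trans
        (pow_le_pow_right₀ hℓ1 (by norm_num))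
      gcongr
    have h3 : l ^ 3 * s ^ 5 ≤ ℓ ^ 3 * r ^ 5 := by gcongr
    have h3' : 0 ≤ ℓ ^ 3 * r ^ 5 := by positivity
    calc _ ≤ 2 * (3 * N ^ 2 * (ℓ ^ 3 * r) + 3 * N * (ℓ ^ 3 * r ^ 3) + ℓ ^ 3 * r ^ 5) := by gcongr
      _ ≤ _ := by linarith
  have hsum : ∑ t ∈ Finset.range d, β (d / d.gcd t)
      ≤ d.divisors.card * (6 * ℓ ^ 3 * ((N : ℝ) ^ 2 * r + N * r ^ 3 + r ^ 5)) := by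
    -- Sort `t` by `g = gcd(d, t)`; each class has `φ(d/g) ≤ d/g` elements.
    rw [← Finset.sum_fiberwise_of_maps_to (t := d.divisors) (g := fun t => d.gcd t)
      (fun t _ => Nat.mem_divisors.mpr ⟨Nat.gcd_dvd_left d t, hd.ne'⟩)]
    rw [← nsmul_eq_mul, ← Finset.sum_const]
    refine Finset.sum_le_sum fun g hg => ?_
    have hgd := (Nat.mem_divisors.mp hg).1
    have hq : 0 < d / g := Nat.div_pos (Nat.le_of_dvd hd hgd) (Nat.pos_of_dvd_of_pos hgd hd)
    have hqd : d / g ∣ d := Nat.div_dvd_of_dvd hgd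
    refine le_trans ?_ (hbound (d / g) hq hqd)
    rw [Finset.sum_congr rfl (g := fun _ => β (d / g))
      (fun t ht => by rw [(Finset.mem_filter.mp ht).2]), Finset.sum_const,
      ← Nat.totient_div_of_dvd hgd, nsmul_eq_mul]
    have hβ0 : 0 ≤ β (d / g) := by
      have : 0 ≤ Real.log (d / g : ℕ) := Real.log_natCast_nonneg _
      simp only [hβ]
      have h2 : (N : ℝ) ^ 3 ≤ (N + (d / g : ℕ) * (1 + Real.log (d / g : ℕ))) ^ 3 := by
        gcongr
        have : 0 ≤ ((d / g : ℕ) : ℝ) * (1 + Real.log (d / g : ℕ)) := by positivity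
        linarith
      have := sub_nonneg.mpr h2
      positivity
    gcongr
    exact Nat.totient_le _
  calc _ ≤ (d : ℝ)⁻¹ * (d.divisors.card * (6 * ℓ ^ 3 * ((N : ℝ) ^ 2 * r + N * r ^ 3 + r ^ 5))) := by
        gcongr
    _ = _ := by
        have e1 : (N : ℝ) ^ 2 / r = (r ^ 2)⁻¹ * ((N : ℝ) ^ 2 * r) := by field_simp
        have e2 : (r ^ 2)⁻¹ * r ^ 2 = 1 := inv_mul_cancel₀ (by positivity)
        rw [hdr, e1]
        linear_combination 6 * (d.divisors.card : ℝ) * ℓ ^ 3 * (N * r + r ^ 3) * e2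

/-! ### The local density of `xy + yz + xz = 0` -/

theorem sum_Icc_natCast_zmod {M : Type*} [AddCommMonoid M] (d : ℕ) [NeZero d] (F : ZMod d → M) :
    ∑ n ∈ Finset.Icc 1 d, F (n : ZMod d) = ∑ u : ZMod d, F u := by
  have hd : 0 < d := NeZero.pos d
  have h1 : ∑ n ∈ Finset.Icc 1 d, F (n : ZMod d) = ∑ n ∈ Finset.range d, F (n : ZMod d) := by
    have e : Finset.Icc 1 d = Finset.Ico (0 + 1) (d + 1) := by ext; simp
    rw [Finset.range_eq_Ico, e, ← Finset.sum_Ico_add' (fun n : ℕ => F (n : ZMod d)),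
      ← Finset.range_eq_Ico]
    obtain ⟨k, rfl⟩ : ∃ k, d = k + 1 := ⟨d - 1, by omega⟩
    rw [Finset.sum_range_succ, Finset.sum_range_succ']
    congr 1
    rw [ZMod.natCast_self, Nat.cast_zero]
  rw [h1]
  refine Finset.sum_nbij' (fun t => (t : ZMod d)) ZMod.val (by simp) ?_ ?_ ?_ (by simp)
  · intro t _; exact Finset.mem_range.mpr (ZMod.val_lt t)
  · intro t ht; exact ZMod.val_natCast_of_lt (Finset.mem_range.mp ht)
  · intro t _; simp

theorem card_Icc_filter_dvd (n k : ℕ) : ((Finset.Icc 1 n).filter (k ∣ ·)).card = n / k := by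
  rw [← Nat.Ioc_filter_dvd_card_eq_div]; congr 1

/-- Every `g > 0` is `M² s` with `s` squarefree, which makes the solutions of `g ∣ x²` explicit. -/
theorem exists_sq_part (g : ℕ) (hg : 0 < g) :
    ∃ M s : ℕ, g = M ^ 2 * s ∧ (∀ x : ℕ, g ∣ x ^ 2 ↔ M * s ∣ x) ∧
      ∀ D, g ≤ D → ∑ m ∈ Finset.Icc 1 D with m ^ 2 ∣ g, m.totient = M := by
  obtain ⟨s, M, hs0, hM0, rfl, hs⟩ := Nat.sq_mul_squarefree_of_pos hg
  refine ⟨M, s, rfl, fun x => ⟨fun h => ?_, fun ⟨k, hk⟩ => ?_⟩, fun D hD => ?_⟩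
  · obtain ⟨y, rfl⟩ : M ∣ x := by
      rw [← Nat.pow_dvd_pow_iff two_ne_zero]; exact (Dvd.intro _ rfl).trans h
    rw [mul_pow] at h
    have h2 := Nat.dvd_of_mul_dvd_mul_left (by positivity) h
    exact mul_dvd_mul_left M ((hs.dvd_pow_iff_dvd two_ne_zero).mp h2)
  · rw [hk]; exact ⟨s * k ^ 2, by ring⟩
  · conv_rhs => rw [← Nat.sum_totient M]
    refine Finset.sum_congr ?_ fun _ _ => rfl
    ext m
    simp only [Finset.mem_filter, Finset.mem_Icc, Nat.mem_divisors]
    constructor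
    -- If `m² ∣ M² s`, dividing by `gcd(m, M)²` leaves a square dividing the squarefree `s`; hence
    -- `m ∣ M`, and `∑_{m ∣ M} φ(m) = M`.
    · rintro ⟨⟨hm1, _⟩, hm⟩
      refine ⟨?_, hM0.ne'⟩
      set h := m.gcd M with hh
      have hh0 : 0 < h := Nat.gcd_pos_of_pos_left M hm1
      obtain ⟨a, ha⟩ := Nat.gcd_dvd_left m M
      obtain ⟨b, hb⟩ := Nat.gcd_dvd_right m M
      have hab : Nat.Coprime a b := by
        have := Nat.coprime_div_gcd_div_gcd (m := m) (n := M) hh0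
        rwa [Nat.div_eq_of_eq_mul_right hh0 ha, Nat.div_eq_of_eq_mul_right hh0 hb] at this
      rw [← hh] at ha hb
      have h1 : a ^ 2 ∣ b ^ 2 * s := by
        rw [ha, hb, mul_pow, mul_pow, mul_assoc] at hm
        exact Nat.dvd_of_mul_dvd_mul_left (by positivity) hm
      have h2 : a ^ 2 ∣ s := (Nat.Coprime.pow 2 2 hab).dvd_of_dvd_mul_left h1
      have h3 : a = 1 := Nat.isUnit_iff.mp (hs a (by rwa [← sq]))
      rw [ha, h3, mul_one]
      exact Nat.gcd_dvd_right m M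
    · rintro ⟨hm, _⟩
      have hm0 : 0 < m := Nat.pos_of_dvd_of_pos hm hM0
      have hd : m ^ 2 ∣ M ^ 2 * s := (pow_dvd_pow_of_dvd hm 2).mul_right s
      refine ⟨⟨hm0, ?_⟩, hd⟩
      calc m ≤ m ^ 2 := Nat.le_self_pow two_ne_zero m
        _ ≤ M ^ 2 * s := Nat.le_of_dvd hg hd
        _ ≤ D := hD

theorem card_mul_eq_zero (d u : ℕ) [NeZero d] :
    (Finset.univ.filter fun v : ZMod d => v * (u : ZMod d) = 0).card = d.gcd u := by
  have hd : 0 < d := NeZero.pos d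
  have hg : 0 < d.gcd u := Nat.gcd_pos_of_pos_left u hd
  rw [Finset.card_filter, ← sum_Icc_natCast_zmod d (fun v => if v * (u : ZMod d) = 0 then 1 else 0)]
  have hiff (v : ℕ) : (v : ZMod d) * (u : ZMod d) = 0 ↔ d / d.gcd u ∣ v := by
    rw [← Nat.cast_mul, ZMod.natCast_eq_zero_iff]
    have hco := Nat.coprime_div_gcd_div_gcd hg
    have hd' : d = d.gcd u * (d / d.gcd u) := (Nat.mul_div_cancel' (Nat.gcd_dvd_left d u)).symm
    have hu' : u = d.gcd u * (u / d.gcd u) := (Nat.mul_div_cancel' (Nat.gcd_dvd_right d u)).symm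
    constructor
    · intro h
      have h' : d.gcd u * (d / d.gcd u) ∣ d.gcd u * (v * (u / d.gcd u)) := by
        have e : d.gcd u * (v * (u / d.gcd u)) = v * u := by
          conv_rhs => rw [hu']
          ring
        rw [e, ← hd']; exact h
      exact hco.dvd_of_dvd_mul_right (Nat.dvd_of_mul_dvd_mul_left hg h')
    · intro h
      have : d.gcd u * (d / d.gcd u) ∣ u * v := mul_dvd_mul (Nat.gcd_dvd_right d u) h
      rwa [← hd', mul_comm] at this
  simp_rw [hiff]
  rw [← Finset.card_filter, card_Icc_filter_dvd]
  exact Nat.div_div_self (Nat.gcd_dvd_left d u) hd.ne'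

/-- When the congruence `v u ≡ w` is solvable, its solutions form a coset of the kernel of
multiplication by `u`; Bézout produces one. -/
theorem card_mul_eq (d u w : ℕ) [NeZero d] :
    (Finset.univ.filter fun v : ZMod d => v * (u : ZMod d) = (w : ZMod d)).card
      = if d.gcd u ∣ w then d.gcd u else 0 := by
  split_ifs with h
  · obtain ⟨v₀, hv₀⟩ : ∃ v₀ : ZMod d, v₀ * (u : ZMod d) = (w : ZMod d) := by
      obtain ⟨k, rfl⟩ := h
      have := congrArg (fun z : ℤ => (z : ZMod d)) (Nat.gcd_eq_gcd_ab d u)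
      push_cast at this
      rw [ZMod.natCast_self, zero_mul, zero_add] at this
      refine ⟨(d.gcdB u : ZMod d) * k, ?_⟩
      push_cast
      rw [this]; ring
    rw [← card_mul_eq_zero d u]
    refine Finset.card_bij (fun v _ => v - v₀) ?_ ?_ ?_
    · intro v hv
      simp only [Finset.mem_filter, Finset.mem_univ, true_and] at hv ⊢
      rw [sub_mul, hv, hv₀, sub_self]
    · intro a _ b _ hab; exact sub_left_injective hab
    · intro b hb
      simp only [Finset.mem_filter, Finset.mem_univ, true_and] at hb ⊢
      exact ⟨b + v₀, by rw [add_mul, hb, hv₀, zero_add], by ring⟩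
  · rw [Finset.card_eq_zero, Finset.filter_eq_empty_iff]
    intro v _ hv
    apply h
    have h1 : ((v.val * u : ℕ) : ZMod d) = (w : ZMod d) := by
      push_cast; rw [ZMod.natCast_zmod_val]; exact hv
    rw [ZMod.natCast_eq_natCast_iff] at h1
    have h2 := h1.of_dvd (Nat.gcd_dvd_left d u)
    exact (h2.dvd_iff dvd_rfl).mp ((Nat.gcd_dvd_right d u).mul_left _)

/-- The number of solutions of `xy + yz + xz = 0` modulo `d`. -/
theorem boxCount_self (d : ℕ) (hd : 0 < d) :
    boxCount d d d d = d * ∑ m ∈ Finset.Icc 1 d with m ^ 2 ∣ d, m.totient * (d / m ^ 2) := by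
  have : NeZero d := ⟨hd.ne'⟩
  have step1 : boxCount d d d d = ∑ x : ZMod d, ∑ y : ZMod d, ∑ z : ZMod d,
      if symForm x y z = 0 then 1 else 0 := by
    unfold boxCount
    have hiff (x y z : ℕ) : d ∣ symForm x y z ↔ symForm (x : ZMod d) y z = 0 := by
      rw [← ZMod.natCast_eq_zero_iff]; simp [symForm]
    simp_rw [hiff]
    simp_rw [fun x y : ℕ => sum_Icc_natCast_zmod d
      (fun z => if symForm (x : ZMod d) (y : ZMod d) z = 0 then 1 else 0)]
    simp_rw [fun x : ℕ => sum_Icc_natCast_zmod d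
      (fun y => ∑ z : ZMod d, if symForm (x : ZMod d) y z = 0 then 1 else 0)]
    exact sum_Icc_natCast_zmod d
      (fun x => ∑ y : ZMod d, ∑ z : ZMod d, if symForm x y z = 0 then 1 else 0)
  -- Completing the product: `(x + y)(x + z) = x² + xy + yz + xz`.
  have step2 : ∑ x : ZMod d, ∑ y : ZMod d, ∑ z : ZMod d, (if symForm x y z = 0 then 1 else 0)
      = ∑ x : ZMod d, ∑ u : ZMod d, ∑ v : ZMod d, if v * u = x ^ 2 then 1 else 0 := by
    refine Finset.sum_congr rfl fun x _ => ?_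
    rw [← Equiv.sum_comp (Equiv.addLeft x)
      (fun u : ZMod d => ∑ v : ZMod d, if v * u = x ^ 2 then 1 else 0)]
    refine Finset.sum_congr rfl fun y _ => ?_
    rw [← Equiv.sum_comp (Equiv.addLeft x)
      (fun v : ZMod d => if v * (Equiv.addLeft x) y = x ^ 2 then 1 else 0)]
    refine Finset.sum_congr rfl fun z _ => ?_
    have : symForm x y z = 0 ↔ (Equiv.addLeft x) z * (Equiv.addLeft x) y = x ^ 2 := by
      simp only [Equiv.coe_addLeft, symForm]
      constructor
      · intro h; linear_combination h
      · intro h; linear_combination h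
    simp only [this]
  have step3 : ∑ x : ZMod d, ∑ u : ZMod d, ∑ v : ZMod d, (if v * u = x ^ 2 then 1 else 0)
      = ∑ u ∈ Finset.Icc 1 d, ∑ x ∈ Finset.Icc 1 d, if d.gcd u ∣ x ^ 2 then d.gcd u else 0 := by
    rw [Finset.sum_comm, ← sum_Icc_natCast_zmod d
      (fun u => ∑ x : ZMod d, ∑ v : ZMod d, if v * u = x ^ 2 then 1 else 0)]
    refine Finset.sum_congr rfl fun u _ => ?_
    rw [← sum_Icc_natCast_zmod d
      (fun x => ∑ v : ZMod d, if v * (u : ZMod d) = x ^ 2 then 1 else 0)]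
    refine Finset.sum_congr rfl fun x _ => ?_
    rw [← card_mul_eq d u (x ^ 2), Finset.card_filter]
    push_cast; rfl
  -- With `gcd(d, u) = M² s`, the admissible `x` are the multiples of `M s`, so the sum is `M² s · d
  -- / (M s) = d M`; the totient sum replaces `M` by divisibility conditions that can be summed over
  -- `u`.
  have step4 (u : ℕ) : ∑ x ∈ Finset.Icc 1 d, (if d.gcd u ∣ x ^ 2 then d.gcd u else 0)
      = d * ∑ m ∈ Finset.Icc 1 d with m ^ 2 ∣ d.gcd u, m.totient := by
    have hg : 0 < d.gcd u := Nat.gcd_pos_of_pos_left u hd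
    obtain ⟨M, s, hMs, hdvd, htot⟩ := exists_sq_part _ hg
    rw [htot d (Nat.gcd_le_left u hd)]
    simp_rw [hdvd]
    rw [← Finset.sum_filter, Finset.sum_const, card_Icc_filter_dvd, smul_eq_mul]
    have h0 : 0 < M * s := by
      rw [hMs] at hg
      rcases Nat.eq_zero_or_pos (M * s) with h | h
      · rw [sq, mul_assoc, h, mul_zero] at hg; omega
      · exact h
    obtain ⟨k, hk⟩ : M * s ∣ d := by
      refine Dvd.dvd.trans ?_ (Nat.gcd_dvd_left d u)
      rw [hMs]; exact ⟨M, by ring⟩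
    rw [hMs, hk, Nat.mul_div_cancel_left _ h0]; ring
  rw [step1, step2, step3]
  simp_rw [step4]
  rw [← Finset.mul_sum]
  congr 1
  simp_rw [Finset.sum_filter, Nat.dvd_gcd_iff]
  rw [Finset.sum_comm]
  refine Finset.sum_congr rfl fun m _ => ?_
  split_ifs with h
  · simp only [h, true_and]
    rw [← Finset.sum_filter, Finset.sum_const, card_Icc_filter_dvd, smul_eq_mul, mul_comm]
  · simp [h]

theorem boxCount_self_div_cube (d : ℕ) (hd : 0 < d) :
    (boxCount d d d d : ℝ) / (d : ℝ) ^ 3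
      = ∑ m ∈ Finset.Icc 1 d with m ^ 2 ∣ d, (m.totient : ℝ) / ((m : ℝ) ^ 2 * d) := by
  have hdR : (d : ℝ) ≠ 0 := by exact_mod_cast hd.ne'
  rw [boxCount_self d hd]
  push_cast
  rw [Finset.mul_sum, Finset.sum_div]
  refine Finset.sum_congr rfl fun m hm => ?_
  obtain ⟨hm1, k, hk⟩ := Finset.mem_filter.mp hm
  have hm0 : 0 < m := (Finset.mem_Icc.mp hm1).1
  have hmR : (m : ℝ) ≠ 0 := by exact_mod_cast hm0.ne'
  have hdk : ((d / m ^ 2 : ℕ) : ℝ) = d / (m : ℝ) ^ 2 := by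
    rw [Nat.cast_div ⟨k, hk⟩ (by positivity)]; push_cast; rfl
  rw [hdk]
  field_simp

/-! ### Three-dimensional summation by parts against the smooth weight -/

section SummationByParts

theorem sum_mul_eq_sum_sub_mul (w α : ℕ → ℝ) (N : ℕ) (hw : w (N + 1) = 0) :
    ∑ x ∈ Finset.Icc 1 N, w x * α x
      = ∑ k ∈ Finset.Icc 1 N, (w k - w (k + 1)) * ∑ x ∈ Finset.Icc 1 k, α x := by
  have key (n : ℕ) : ∑ x ∈ Finset.Icc 1 n, w x * α x
      = ∑ k ∈ Finset.Icc 1 n, (w k - w (k + 1)) * ∑ x ∈ Finset.Icc 1 k, α x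
        + w (n + 1) * ∑ x ∈ Finset.Icc 1 n, α x := by
    induction n with
    | zero => simp
    | succ n ih =>
      rw [Finset.sum_Icc_succ_top (by omega), Finset.sum_Icc_succ_top (by omega), ih,
        Finset.sum_Icc_succ_top (by omega)]
      ring
  rw [key, hw]; ring

/-- The triple mixed difference of a function of three variables. -/
def mixedDiff (w : ℕ → ℕ → ℕ → ℝ) (x y z : ℕ) : ℝ :=
  w x y z - w (x + 1) y z - w x (y + 1) z - w x y (z + 1) + w (x + 1) (y + 1) z
    + w (x + 1) y (z + 1) + w x (y + 1) (z + 1) - w (x + 1) (y + 1) (z + 1)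

theorem sum_mul_eq_sum_mixedDiff_mul (w α : ℕ → ℕ → ℕ → ℝ) (N : ℕ)
    (hx : ∀ y z, w (N + 1) y z = 0) (hy : ∀ x z, w x (N + 1) z = 0)
    (hz : ∀ x y, w x y (N + 1) = 0) :
    ∑ x ∈ Finset.Icc 1 N, ∑ y ∈ Finset.Icc 1 N, ∑ z ∈ Finset.Icc 1 N, w x y z * α x y z
      = ∑ a ∈ Finset.Icc 1 N, ∑ b ∈ Finset.Icc 1 N, ∑ c ∈ Finset.Icc 1 N, mixedDiff w a b c *
          ∑ x ∈ Finset.Icc 1 a, ∑ y ∈ Finset.Icc 1 b, ∑ z ∈ Finset.Icc 1 c, α x y z := by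
  set w3 : ℕ → ℕ → ℕ → ℝ := fun x y z => w x y z - w x y (z + 1) with hw3
  set w2 : ℕ → ℕ → ℕ → ℝ := fun x y z => w3 x y z - w3 x (y + 1) z with hw2
  calc _ = ∑ x ∈ Finset.Icc 1 N, ∑ y ∈ Finset.Icc 1 N, ∑ c ∈ Finset.Icc 1 N,
        w3 x y c * ∑ z ∈ Finset.Icc 1 c, α x y z :=
        Finset.sum_congr rfl fun x _ => Finset.sum_congr rfl fun y _ =>
          sum_mul_eq_sum_sub_mul (w x y) (α x y) N (hz x y)
    _ = ∑ x ∈ Finset.Icc 1 N, ∑ b ∈ Finset.Icc 1 N, ∑ c ∈ Finset.Icc 1 N,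
        w2 x b c * ∑ y ∈ Finset.Icc 1 b, ∑ z ∈ Finset.Icc 1 c, α x y z := by
        refine Finset.sum_congr rfl fun x _ => ?_
        rw [Finset.sum_comm]
        conv_rhs => rw [Finset.sum_comm]
        exact Finset.sum_congr rfl fun c _ =>
          sum_mul_eq_sum_sub_mul (fun y => w3 x y c) (fun y => ∑ z ∈ Finset.Icc 1 c, α x y z) N
            (by simp [hw3, hy])
    _ = ∑ b ∈ Finset.Icc 1 N, ∑ c ∈ Finset.Icc 1 N, ∑ a ∈ Finset.Icc 1 N, mixedDiff w a b c *
          ∑ x ∈ Finset.Icc 1 a, ∑ y ∈ Finset.Icc 1 b, ∑ z ∈ Finset.Icc 1 c, α x y z := by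
        rw [Finset.sum_comm]
        refine Finset.sum_congr rfl fun b _ => ?_
        rw [Finset.sum_comm]
        refine Finset.sum_congr rfl fun c _ => ?_
        rw [sum_mul_eq_sum_sub_mul (fun x => w2 x b c)
          (fun x => ∑ y ∈ Finset.Icc 1 b, ∑ z ∈ Finset.Icc 1 c, α x y z) N
            (by simp [hw2, hw3, hx])]
        refine Finset.sum_congr rfl fun a _ => ?_
        congr 1
        simp only [hw2, hw3, mixedDiff]; ring
    _ = _ := by
        conv_rhs => rw [Finset.sum_comm]
        refine Finset.sum_congr rfl fun b _ => ?_
        rw [Finset.sum_comm]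

/-- The mean value inequality on a unit step. Iterated one variable at a time, it bounds mixed
differences by mixed partial derivatives. -/
theorem abs_step_sub_le {h h' : ℝ → ℝ} {x B : ℝ} (hd : ∀ t, x ≤ t → HasDerivAt h (h' t) t)
    (hB : ∀ t, x ≤ t → |h' t| ≤ B) : |h (x + 1) - h x| ≤ B := by
  have := (convex_Icc x (x + 1)).norm_image_sub_le_of_norm_hasDerivWithin_le (f := h) (f' := h')
    (C := B) (fun t ht => (hd t ht.1).hasDerivWithinAt) (fun t ht => hB t ht.1)
    (Set.left_mem_Icc.mpr (by linarith)) (Set.right_mem_Icc.mpr (by linarith))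
  simpa using this

/-- The smooth weight `Q / (Q + D)` with `Q = xy + yz + xz`. -/
noncomputable def symWeight (D x y z : ℝ) : ℝ := symForm x y z / (symForm x y z + D)

noncomputable def symWeightX (D x y z : ℝ) : ℝ := D * (y + z) / (symForm x y z + D) ^ 2

noncomputable def symWeightXY (D x y z : ℝ) : ℝ :=
  D / (symForm x y z + D) ^ 2 - 2 * D * (x + z) * (y + z) / (symForm x y z + D) ^ 3

noncomputable def symWeightXYZ (D x y z : ℝ) : ℝ :=
  6 * D * (x + y) * (x + z) * (y + z) / (symForm x y z + D) ^ 4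
    - 4 * D * (x + y + z) / (symForm x y z + D) ^ 3

variable {D x y z : ℝ}

theorem symForm_pos (hx : 0 < x) (hy : 0 < y) (hz : 0 < z) : 0 < symForm x y z := by
  unfold symForm; positivity

theorem symWeight_swap (D x y z : ℝ) : symWeight D x y z = symWeight D y x z := by
  have : symForm x y z = symForm y x z := by unfold symForm; ring
  rw [symWeight, symWeight, this]

theorem symWeight_rotate (D x y z : ℝ) : symWeight D x y z = symWeight D y z x := by
  have : symForm x y z = symForm y z x := by unfold symForm; ring
  rw [symWeight, symWeight, this]

theorem hasDerivAt_symWeight (hD : 0 < D) (hx : 0 < x) (hy : 0 < y) (hz : 0 < z) :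
    HasDerivAt (fun t => symWeight D t y z) (symWeightX D x y z) x := by
  have hR : symForm x y z + D ≠ 0 := (add_pos (symForm_pos hx hy hz) hD).ne'
  have h1 : HasDerivAt (fun t => symForm t y z) (y + z) x := by
    unfold symForm
    have := (((hasDerivAt_id x).mul_const y).add_const (y * z)).add ((hasDerivAt_id x).mul_const z)
    refine this.congr_deriv (by ring)
  refine (h1.div (h1.add_const D) hR).congr_deriv ?_
  unfold symWeightX
  congr 1; ring

theorem hasDerivAt_symWeightX (hD : 0 < D) (hx : 0 < x) (hy : 0 < y) (hz : 0 < z) :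
    HasDerivAt (fun t => symWeightX D x t z) (symWeightXY D x y z) y := by
  have hR : symForm x y z + D ≠ 0 := (add_pos (symForm_pos hx hy hz) hD).ne'
  have h1 : HasDerivAt (fun t => symForm x t z) (x + z) y := by
    unfold symForm
    have := (((hasDerivAt_id y).const_mul x).add ((hasDerivAt_id y).mul_const z)).add_const (x * z)
    refine this.congr_deriv (by ring)
  have h2 : HasDerivAt (fun t => D * (t + z)) D y := by
    simpa using ((hasDerivAt_id y).add_const z).const_mul D
  refine (h2.div ((h1.add_const D).pow 2) (pow_ne_zero 2 hR)).congr_deriv ?_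
  unfold symWeightXY
  simp only [Pi.pow_apply]
  field_simp
  ring

theorem hasDerivAt_symWeightXY (hD : 0 < D) (hx : 0 < x) (hy : 0 < y) (hz : 0 < z) :
    HasDerivAt (fun t => symWeightXY D x y t) (symWeightXYZ D x y z) z := by
  have hR : symForm x y z + D ≠ 0 := (add_pos (symForm_pos hx hy hz) hD).ne'
  have h1 : HasDerivAt (fun t => symForm x y t) (x + y) z := by
    unfold symForm
    have := (((hasDerivAt_id z).const_mul y).const_add (x * y)).add ((hasDerivAt_id z).const_mul x)
    refine this.congr_deriv (by ring)
  have h2 : HasDerivAt (fun t => 2 * D * (x + t) * (y + t)) (2 * D * (x + z + (y + z))) z := by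
    have := (((hasDerivAt_id z).const_add x).const_mul (2 * D)).mul ((hasDerivAt_id z).const_add y)
    refine this.congr_deriv (by simp; ring)
  refine (((hasDerivAt_const z D).div ((h1.add_const D).pow 2) (pow_ne_zero 2 hR)).sub
    (h2.div ((h1.add_const D).pow 3) (pow_ne_zero 3 hR))).congr_deriv ?_
  unfold symWeightXYZ
  simp only [Pi.pow_apply]
  field_simp
  ring

/-- Each derivative gains the inverse of its variable. With `R = Q + D`, the quantities `D`, `xy`,
`x(y+z)`, `y(x+z)`, `z(x+y)` are all at most `R`, and `(x+y+z)xyz ≤ R²`; all bounds are uniform in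
`D`. -/
theorem symWeight_bounds (hD : 0 < D) (hx : 0 < x) (hy : 0 < y) (hz : 0 < z) :
    |symWeight D x y z| ≤ 1 ∧ |symWeightX D x y z| ≤ 1 / x ∧ |symWeightXY D x y z| ≤ 3 / (x * y) ∧
      |symWeightXYZ D x y z| ≤ 10 / (x * y * z) := by
  have hQ := symForm_pos hx hy hz
  have hxp : x * (y + z) ≤ symForm x y z + D := by unfold symForm; nlinarith [mul_pos hy hz]
  have hyp : y * (x + z) ≤ symForm x y z + D := by unfold symForm; nlinarith [mul_pos hx hz]
  have hzp : z * (x + y) ≤ symForm x y z + D := by unfold symForm; nlinarith [mul_pos hx hy]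
  have hxy : x * y ≤ symForm x y z + D := by
    unfold symForm; nlinarith [mul_pos hx hz, mul_pos hy hz]
  have hS : (x + y + z) * (x * y * z) ≤ (symForm x y z + D) ^ 2 := by
    have : (x + y + z) * (x * y * z) ≤ symForm x y z ^ 2 := by
      unfold symForm; nlinarith [mul_pos hx hy, mul_pos hy hz, mul_pos hx hz,
        mul_pos (mul_pos hx hy) (mul_pos hy hz), sq_nonneg (x*y), sq_nonneg (y*z), sq_nonneg (x*z),
        mul_pos (mul_pos hx hz) (mul_pos hy hz), mul_pos (mul_pos hx hz) (mul_pos hx hy)]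
    refine this.trans ?_
    gcongr; linarith
  have hDR : D ≤ symForm x y z + D := by linarith
  unfold symWeight symWeightX symWeightXY symWeightXYZ
  have hQR : symForm x y z ≤ symForm x y z + D := by linarith
  set R := symForm x y z + D with hR
  have hR0 : 0 < R := by positivity
  have a1 : D * (y + z) / R ^ 2 ≤ 1 / x := by
    rw [div_le_div_iff₀ (by positivity) hx]
    calc D * (y + z) * x = D * (x * (y + z)) := by ring
      _ ≤ R * R := by gcongr
      _ = _ := by ring
  have a2 : D / R ^ 2 ≤ 1 / (x * y) := by
    rw [div_le_div_iff₀ (by positivity) (by positivity)]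
    calc D * (x * y) ≤ R * R := by gcongr
      _ = _ := by ring
  have a3 : 2 * D * (x + z) * (y + z) / R ^ 3 ≤ 2 / (x * y) := by
    rw [div_le_div_iff₀ (by positivity) (by positivity)]
    calc 2 * D * (x + z) * (y + z) * (x * y) = 2 * (D * (y * (x + z)) * (x * (y + z))) := by ring
      _ ≤ 2 * (R * R * R) := by gcongr
      _ = _ := by ring
  have a4 : 6 * D * (x + y) * (x + z) * (y + z) / R ^ 4 ≤ 6 / (x * y * z) := by
    rw [div_le_div_iff₀ (by positivity) (by positivity)]
    calc 6 * D * (x + y) * (x + z) * (y + z) * (x * y * z)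
        = 6 * (D * (z * (x + y)) * (y * (x + z)) * (x * (y + z))) := by ring
      _ ≤ 6 * (R * R * R * R) := by gcongr
      _ = _ := by ring
  have a5 : 4 * D * (x + y + z) / R ^ 3 ≤ 4 / (x * y * z) := by
    rw [div_le_div_iff₀ (by positivity) (by positivity)]
    calc 4 * D * (x + y + z) * (x * y * z) = 4 * (D * ((x + y + z) * (x * y * z))) := by ring
      _ ≤ 4 * (R * R ^ 2) := by gcongr
      _ = _ := by ring
  refine ⟨?_, ?_, ?_, ?_⟩
  · rw [abs_of_nonneg (by positivity), div_le_one hR0]; exact hQR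
  · rw [abs_of_nonneg (by positivity)]; exact a1
  · have b1 : 0 ≤ D / R ^ 2 := by positivity
    have b2 : 0 ≤ 2 * D * (x + z) * (y + z) / R ^ 3 := by positivity
    have e : 3 / (x * y) = 1 / (x * y) + 2 / (x * y) := by ring
    rw [abs_le]; constructor <;> linarith
  · have b1 : 0 ≤ 6 * D * (x + y) * (x + z) * (y + z) / R ^ 4 := by positivity
    have b2 : 0 ≤ 4 * D * (x + y + z) / R ^ 3 := by positivity
    have e : 10 / (x * y * z) = 6 / (x * y * z) + 4 / (x * y * z) := by ring
    rw [abs_le]; constructor <;> linarith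

theorem abs_symWeight_diff_le (hD : 0 < D) (hx : 0 < x) (hy : 0 < y) (hz : 0 < z) :
    |symWeight D (x + 1) y z - symWeight D x y z| ≤ 1 / x := by
  refine abs_step_sub_le (h := fun t => symWeight D t y z)
    (fun t ht => hasDerivAt_symWeight hD (hx.trans_le ht) hy hz) fun t ht => ?_
  have ht0 := hx.trans_le ht
  refine (symWeight_bounds hD ht0 hy hz).2.1.trans ?_
  gcongr

theorem abs_symWeight_diff_diff_le (hD : 0 < D) (hx : 0 < x) (hy : 0 < y) (hz : 0 < z) :
    |(symWeight D (x + 1) (y + 1) z - symWeight D (x + 1) y z) -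
      (symWeight D x (y + 1) z - symWeight D x y z)| ≤ 3 / (x * y) := by
  refine abs_step_sub_le (h := fun t => symWeight D t (y + 1) z - symWeight D t y z)
    (fun t ht => (hasDerivAt_symWeight hD (hx.trans_le ht) (by linarith) hz).sub
      (hasDerivAt_symWeight hD (hx.trans_le ht) hy hz)) fun t ht => ?_
  have ht0 := hx.trans_le ht
  refine abs_step_sub_le (h := fun s => symWeightX D t s z)
    (fun s hs => hasDerivAt_symWeightX hD ht0 (hy.trans_le hs) hz) fun s hs => ?_
  have hs0 := hy.trans_le hs
  refine (symWeight_bounds hD ht0 hs0 hz).2.2.1.trans ?_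
  gcongr

theorem abs_symWeight_diff_diff_diff_le (hD : 0 < D) (hx : 0 < x) (hy : 0 < y) (hz : 0 < z) :
    |((symWeight D (x + 1) (y + 1) (z + 1) - symWeight D (x + 1) (y + 1) z) -
        (symWeight D (x + 1) y (z + 1) - symWeight D (x + 1) y z)) -
      ((symWeight D x (y + 1) (z + 1) - symWeight D x (y + 1) z) -
        (symWeight D x y (z + 1) - symWeight D x y z))| ≤ 10 / (x * y * z) := by
  have hy1 : 0 < y + 1 := by linarith
  have hz1 : 0 < z + 1 := by linarith
  refine abs_step_sub_le (h := fun t => (symWeight D t (y + 1) (z + 1) - symWeight D t (y + 1) z) -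
        (symWeight D t y (z + 1) - symWeight D t y z))
    (fun t ht => ((hasDerivAt_symWeight hD (hx.trans_le ht) hy1 hz1).sub
      (hasDerivAt_symWeight hD (hx.trans_le ht) hy1 hz)).sub
      ((hasDerivAt_symWeight hD (hx.trans_le ht) hy hz1).sub
      (hasDerivAt_symWeight hD (hx.trans_le ht) hy hz))) fun t ht => ?_
  have ht0 := hx.trans_le ht
  refine abs_step_sub_le (h := fun s => symWeightX D t s (z + 1) - symWeightX D t s z)
    (fun s hs => (hasDerivAt_symWeightX hD ht0 (hy.trans_le hs) hz1).sub
      (hasDerivAt_symWeightX hD ht0 (hy.trans_le hs) hz)) fun s hs => ?_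
  have hs0 := hy.trans_le hs
  refine abs_step_sub_le (h := fun r => symWeightXY D t s r)
    (fun r hr => hasDerivAt_symWeightXY hD ht0 hs0 (hz.trans_le hr)) fun r hr => ?_
  have hr0 := hz.trans_le hr
  refine (symWeight_bounds hD ht0 hs0 hr0).2.2.2.trans ?_
  gcongr

/-- Summation by parts in three variables against the weight `Q / (Q + D)`. -/
theorem abs_sum_symWeight_mul_le (hD : 0 < D) (N : ℕ) (hN : 0 < N) (α : ℕ → ℕ → ℕ → ℝ) (B : ℝ)
    (hB : ∀ a b c : ℕ, a ≤ N → b ≤ N → c ≤ N →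
      |∑ x ∈ Finset.Icc 1 a, ∑ y ∈ Finset.Icc 1 b, ∑ z ∈ Finset.Icc 1 c, α x y z| ≤ B) :
    |∑ x ∈ Finset.Icc 1 N, ∑ y ∈ Finset.Icc 1 N, ∑ z ∈ Finset.Icc 1 N,
      symWeight D x y z * α x y z| ≤ 10 * (2 + Real.log N) ^ 3 * B := by
  -- The weight is cut to zero beyond `N` so that no boundary terms arise. At a coordinate equal to
  -- `N` the difference degenerates to the value itself, hence `κ N = 1` and the eight cases of
  -- `hdiff`.
  set w : ℕ → ℕ → ℕ → ℝ := fun x y z =>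
    if x ≤ N ∧ y ≤ N ∧ z ≤ N then symWeight D x y z else 0 with hw
  set κ : ℕ → ℝ := fun k => if k < N then 1 / (k : ℝ) else 1 with hκ
  have hκ0 (k : ℕ) : 0 ≤ κ k := by simp only [hκ]; split_ifs <;> positivity
  have hB0 : 0 ≤ B := (abs_nonneg _).trans (hB 0 0 0 (by simp) (by simp) (by simp))
  have hκsum : ∑ k ∈ Finset.Icc 1 N, κ k ≤ 2 + Real.log N := by
    have hsub : ∑ k ∈ Finset.Icc 1 N, κ k ≤ ∑ k ∈ Finset.Icc 1 N, ((k : ℝ)⁻¹ + if k = N then 1 else 0) := by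
      refine Finset.sum_le_sum fun k hk => ?_
      have := (Finset.mem_Icc.mp hk).2
      simp only [hκ]
      rcases this.lt_or_eq with h | h
      · simp [h, h.ne]
      · simp [h]
    have h := harmonic_le_one_add_log N
    simp_rw [harmonic_eq_sum_Icc, Rat.cast_sum, Rat.cast_inv, Rat.cast_natCast] at h
    rw [Finset.sum_add_distrib, Finset.sum_ite_eq', if_pos (Finset.mem_Icc.mpr ⟨hN, le_rfl⟩)] at hsub
    linarith
  have hdiff (x y z : ℕ) (hx : x ∈ Finset.Icc 1 N) (hy : y ∈ Finset.Icc 1 N)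
      (hz : z ∈ Finset.Icc 1 N) : |mixedDiff w x y z| ≤ 10 * (κ x * (κ y * κ z)) := by
    obtain ⟨hx1, hxN⟩ := Finset.mem_Icc.mp hx
    obtain ⟨hy1, hyN⟩ := Finset.mem_Icc.mp hy
    obtain ⟨hz1, hzN⟩ := Finset.mem_Icc.mp hz
    have hx0 : (0 : ℝ) < x := by exact_mod_cast hx1
    have hy0 : (0 : ℝ) < y := by exact_mod_cast hy1
    have hz0 : (0 : ℝ) < z := by exact_mod_cast hz1
    have hvxy : 0 ≤ 1 / (x : ℝ) * (1 / y) := by positivity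
    have hvxz : 0 ≤ 1 / (x : ℝ) * (1 / z) := by positivity
    have hvyz : 0 ≤ 1 / (y : ℝ) * (1 / z) := by positivity
    have hvx : 0 ≤ 1 / (x : ℝ) := by positivity
    have hvy : 0 ≤ 1 / (y : ℝ) := by positivity
    have hvz : 0 ≤ 1 / (z : ℝ) := by positivity
    unfold mixedDiff
    simp only [hw, hκ]
    rcases hxN.lt_or_eq with hx' | hx' <;> rcases hyN.lt_or_eq with hy' | hy' <;>
      rcases hzN.lt_or_eq with hz' | hz'
    · have h := abs_symWeight_diff_diff_diff_le hD hx0 hy0 hz0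
      rw [abs_sub_comm] at h
      simp only [hxN, hyN, hzN, hx', hy', hz', Nat.succ_le_of_lt, and_self, if_true]
      push_cast
      refine le_trans (le_of_eq (congrArg _ (by ring))) (h.trans (le_of_eq (by field_simp)))
    · have h := abs_symWeight_diff_diff_le hD hx0 hy0 hz0
      have hz'' : ¬ z + 1 ≤ N := by omega
      simp only [hxN, hyN, hzN, hx', hy', hz'', (not_lt.mpr hz'.ge), Nat.succ_le_of_lt, and_self,
        and_false, if_true, if_false]
      push_cast
      refine le_trans (le_of_eq (congrArg _ (by ring))) (h.trans ?_)
      have : 3 / ((x : ℝ) * y) = 3 * (1 / (x : ℝ) * (1 / y)) := by field_simp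
      rw [this]; linarith
    · have h := abs_symWeight_diff_diff_le hD hx0 hz0 hy0
      have hy'' : ¬ y + 1 ≤ N := by omega
      have hs (p q r : ℝ) : symWeight D p q r = symWeight D p r q := by
        rw [symWeight_rotate, symWeight_rotate, symWeight_swap]
      simp only [hxN, hyN, hzN, hx', hz', hy'', (not_lt.mpr hy'.ge), Nat.succ_le_of_lt, and_self,
        and_false, false_and, if_true, if_false]
      push_cast
      rw [hs _ _ (y : ℝ), hs _ _ (y : ℝ), hs _ _ (y : ℝ), hs _ _ (y : ℝ)] at h
      refine le_trans (le_of_eq (congrArg _ (by ring))) (h.trans ?_)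
      have : 3 / ((x : ℝ) * z) = 3 * (1 / (x : ℝ) * (1 / z)) := by field_simp
      rw [this]; linarith
    · have h := abs_symWeight_diff_le hD hx0 hy0 hz0
      have hy'' : ¬ y + 1 ≤ N := by omega
      have hz'' : ¬ z + 1 ≤ N := by omega
      rw [abs_sub_comm] at h
      simp only [hxN, hyN, hzN, hx', hy'', hz'', (not_lt.mpr hy'.ge), (not_lt.mpr hz'.ge),
        Nat.succ_le_of_lt, and_self, and_false, false_and, if_true, if_false]
      push_cast
      refine le_trans (le_of_eq (congrArg _ (by ring))) (h.trans (by linarith))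
    · have h := abs_symWeight_diff_diff_le hD hy0 hz0 hx0
      have hx'' : ¬ x + 1 ≤ N := by omega
      simp only [hxN, hyN, hzN, hy', hz', hx'', (not_lt.mpr hx'.ge), Nat.succ_le_of_lt, and_self,
        false_and, if_true, if_false]
      push_cast
      simp only [← symWeight_rotate D (x : ℝ)] at h
      refine le_trans (le_of_eq (congrArg _ (by ring))) (h.trans ?_)
      have : 3 / ((y : ℝ) * z) = 3 * (1 / (y : ℝ) * (1 / z)) := by field_simp
      rw [this]; linarith
    · have h := abs_symWeight_diff_le hD hy0 hx0 hz0
      have hx'' : ¬ x + 1 ≤ N := by omega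
      have hz'' : ¬ z + 1 ≤ N := by omega
      rw [abs_sub_comm, symWeight_swap, symWeight_swap D ((y : ℝ) + 1)] at h
      simp only [hxN, hyN, hzN, hy', hx'', hz'', (not_lt.mpr hx'.ge), (not_lt.mpr hz'.ge),
        Nat.succ_le_of_lt, and_self, and_false, false_and, if_true, if_false]
      push_cast
      refine le_trans (le_of_eq (congrArg _ (by ring))) (h.trans (by linarith))
    · have h := abs_symWeight_diff_le hD hz0 hx0 hy0
      have hx'' : ¬ x + 1 ≤ N := by omega
      have hy'' : ¬ y + 1 ≤ N := by omega
      rw [abs_sub_comm, symWeight_rotate, symWeight_rotate D ((z : ℝ) + 1)] at h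
      simp only [hxN, hyN, hzN, hz', hx'', hy'', (not_lt.mpr hx'.ge), (not_lt.mpr hy'.ge),
        Nat.succ_le_of_lt, and_self, and_false, false_and, if_true, if_false]
      push_cast
      refine le_trans (le_of_eq (congrArg _ (by ring))) (h.trans (by linarith))
    · have h := (symWeight_bounds hD hx0 hy0 hz0).1
      have hx'' : ¬ x + 1 ≤ N := by omega
      have hy'' : ¬ y + 1 ≤ N := by omega
      have hz'' : ¬ z + 1 ≤ N := by omega
      simp only [hxN, hyN, hzN, hx'', hy'', hz'', (not_lt.mpr hx'.ge), (not_lt.mpr hy'.ge),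
        (not_lt.mpr hz'.ge), and_self, and_false, false_and, if_true, if_false]
      refine le_trans (le_of_eq (congrArg _ (by ring))) (h.trans (by norm_num))
  have hsum : ∑ x ∈ Finset.Icc 1 N, ∑ y ∈ Finset.Icc 1 N, ∑ z ∈ Finset.Icc 1 N,
      symWeight D x y z * α x y z
      = ∑ x ∈ Finset.Icc 1 N, ∑ y ∈ Finset.Icc 1 N, ∑ z ∈ Finset.Icc 1 N, w x y z * α x y z := by
    refine Finset.sum_congr rfl fun x hx => Finset.sum_congr rfl fun y hy =>
      Finset.sum_congr rfl fun z hz => ?_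
    simp only [hw, (Finset.mem_Icc.mp hx).2, (Finset.mem_Icc.mp hy).2, (Finset.mem_Icc.mp hz).2,
      and_self, if_true]
  rw [hsum, sum_mul_eq_sum_mixedDiff_mul w α N (by simp [hw]) (by simp [hw]) (by simp [hw])]
  calc _ ≤ ∑ a ∈ Finset.Icc 1 N, ∑ b ∈ Finset.Icc 1 N, ∑ c ∈ Finset.Icc 1 N,
        10 * (κ a * (κ b * κ c)) * B := by
        refine (Finset.abs_sum_le_sum_abs _ _).trans (Finset.sum_le_sum fun a ha => ?_)
        refine (Finset.abs_sum_le_sum_abs _ _).trans (Finset.sum_le_sum fun b hb => ?_)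
        refine (Finset.abs_sum_le_sum_abs _ _).trans (Finset.sum_le_sum fun c hc => ?_)
        rw [abs_mul]
        have h1 := hdiff a b c ha hb hc
        have h2 := hB a b c (Finset.mem_Icc.mp ha).2 (Finset.mem_Icc.mp hb).2 (Finset.mem_Icc.mp hc).2
        gcongr
    _ = 10 * (∑ k ∈ Finset.Icc 1 N, κ k) ^ 3 * B := by
        simp_rw [← Finset.sum_mul, ← Finset.mul_sum, ← Finset.sum_mul]
        ring
    _ ≤ _ := by
        have : 0 ≤ ∑ k ∈ Finset.Icc 1 N, κ k := Finset.sum_nonneg fun k _ => hκ0 k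
        gcongr

end SummationByParts

/-! ### The Dirichlet series of the totient and the zeta constants -/

section ZetaConstants

theorem LSeries_ofReal_natCast (f : ℕ → ℝ) (k : ℕ) (hk : k ≠ 0) :
    LSeries (fun n => (f n : ℂ)) (k : ℂ) = ((∑' n, f n / (n : ℝ) ^ k : ℝ) : ℂ) := by
  rw [LSeries, Complex.ofReal_tsum]
  refine tsum_congr fun n => ?_
  rcases eq_or_ne n 0 with rfl | hn
  · simp [hk]
  · rw [LSeries.term_of_ne_zero hn, Complex.cpow_natCast]; push_cast; rfl

theorem logMul_ofReal (f : ℕ → ℝ) :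
    LSeries.logMul (fun n => (f n : ℂ)) = fun n : ℕ => ((Real.log n * f n : ℝ) : ℂ) := by
  ext n
  simp [LSeries.logMul]

/-- `∑ φ(m) / m⁴`. -/
noncomputable def totientSum : ℝ := ∑' m : ℕ, (m.totient : ℝ) / (m : ℝ) ^ 4

/-- `∑ φ(m) log m / m⁴`. -/
noncomputable def totientLogSum : ℝ := ∑' m : ℕ, Real.log m * (m.totient : ℝ) / (m : ℝ) ^ 4

theorem abscissa_totient_le :
    LSeries.abscissaOfAbsConv (fun n => ((n.totient : ℝ) : ℂ)) ≤ ((2 : ℝ) : EReal) := by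
  have := LSeries.abscissaOfAbsConv_le_of_le_const_mul_rpow
    (f := fun n => ((n.totient : ℝ) : ℂ)) (x := 1) ⟨1, fun n _ => by
      rw [Complex.norm_real, Real.norm_of_nonneg (by positivity), Real.rpow_one, one_mul]
      exact_mod_cast n.totient_le⟩
  refine this.trans (le_of_eq ?_)
  rw [← EReal.coe_one, ← EReal.coe_add, one_add_one_eq_two]

/-- The Dirichlet series form of `∑_{d ∣ n} φ(d) = n`. -/
theorem riemannZeta_mul_LSeries_totient {s : ℂ} (hs : 2 < s.re) :
    riemannZeta s * LSeries (fun n => ((n.totient : ℝ) : ℂ)) s = riemannZeta (s - 1) := by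
  have h1 : LSeriesSummable 1 s := LSeriesSummable_one_iff.mpr (by linarith)
  have h2 : LSeriesSummable (fun n => ((n.totient : ℝ) : ℂ)) s :=
    LSeriesSummable_of_abscissaOfAbsConv_lt_re (abscissa_totient_le.trans_lt (EReal.coe_lt_coe_iff.mpr hs))
  rw [← LSeries_one_eq_riemannZeta (s := s) (by linarith), ← LSeries_convolution' h1 h2,
    ← LSeries_one_eq_riemannZeta (s := s - 1) (by simp; linarith)]
  refine tsum_congr fun n => ?_
  rcases eq_or_ne n 0 with rfl | hn
  · simp
  · rw [LSeries.term_of_ne_zero hn, LSeries.term_of_ne_zero hn, LSeries.convolution_def]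
    have hnC : (n : ℂ) ≠ 0 := by exact_mod_cast hn
    have : ∑ p ∈ n.divisorsAntidiagonal, (1 : ℕ → ℂ) p.1 * ((p.2.totient : ℝ) : ℂ) = n := by
      rw [Nat.sum_divisorsAntidiagonal' (fun a b => (1 : ℕ → ℂ) a * ((b.totient : ℝ) : ℂ))]
      simp only [Pi.one_apply, one_mul, Complex.ofReal_natCast]
      exact_mod_cast Nat.sum_totient n
    simp only [this]
    rw [Complex.cpow_sub _ _ hnC, Complex.cpow_one]
    simp

/-- The Dirichlet series of `ζ` and `ζ'` have real terms at `k`, so the real parts taken in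
`realZeta` and `realZetaDeriv` lose nothing. -/
theorem hasDerivAt_riemannZeta_real (k : ℕ) (hk : 1 < k) :
    riemannZeta k = (realZeta k : ℂ) ∧
    HasDerivAt riemannZeta (realZetaDeriv k : ℂ) (k : ℂ) := by
  have hkre : 1 < (k : ℂ).re := by simpa using hk
  have hval : riemannZeta k = ((∑' n : ℕ, (1 : ℝ) / (n : ℝ) ^ k : ℝ) : ℂ) := by
    rw [zeta_nat_eq_tsum_of_gt_one hk]; push_cast; rfl
  have hd : HasDerivAt riemannZeta (deriv riemannZeta k) (k : ℂ) :=
    (differentiableAt_riemannZeta (fun h => by rw [h] at hkre; simp at hkre)).hasDerivAt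
  have hone : (1 : ℕ → ℂ) = fun n => (((fun _ => 1 : ℕ → ℝ) n : ℝ) : ℂ) := by ext; simp
  have habs : LSeries.abscissaOfAbsConv (1 : ℕ → ℂ) < (k : ℂ).re := by
    rw [LSeries.abscissaOfAbsConv_one]; exact_mod_cast hkre
  have hder : deriv riemannZeta k = ((-∑' n : ℕ, Real.log n * 1 / (n : ℝ) ^ k : ℝ) : ℂ) := by
    have h1 : LSeries 1 =ᶠ[nhds (k : ℂ)] riemannZeta := by
      filter_upwards [(isOpen_lt continuous_const Complex.continuous_re).mem_nhds hkre] with s hs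
      exact LSeries_one_eq_riemannZeta hs
    rw [← h1.deriv_eq, LSeries_deriv habs, hone, logMul_ofReal, LSeries_ofReal_natCast _ _ (by omega)]
    push_cast; rfl
  have e : ((k : ℝ) : ℂ) = (k : ℂ) := by simp
  constructor
  · rw [realZeta, e, hval, Complex.ofReal_re]
  · convert! hd using 1
    rw [realZetaDeriv, e, hder, Complex.ofReal_re]

theorem realZeta_four_pos : 0 < realZeta 4 := by
  rw [realZeta, show ((4 : ℝ) : ℂ) = ((4 : ℕ) : ℂ) by norm_num,
    zeta_nat_eq_tsum_of_gt_one (by norm_num)]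
  have : ∑' n : ℕ, 1 / (n : ℂ) ^ 4 = ((∑' n : ℕ, (1 : ℝ) / (n : ℝ) ^ 4 : ℝ) : ℂ) := by push_cast; rfl
  rw [this, Complex.ofReal_re]
  exact (Real.summable_one_div_nat_pow.mpr (by norm_num)).tsum_pos (fun n => by positivity) 1
    (by norm_num)

theorem realZeta_three_pos : 0 < realZeta 3 := by
  rw [realZeta, show ((3 : ℝ) : ℂ) = ((3 : ℕ) : ℂ) by norm_num,
    zeta_nat_eq_tsum_of_gt_one (by norm_num)]
  have : ∑' n : ℕ, 1 / (n : ℂ) ^ 3 = ((∑' n : ℕ, (1 : ℝ) / (n : ℝ) ^ 3 : ℝ) : ℂ) := by push_cast; rfl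
  rw [this, Complex.ofReal_re]
  exact (Real.summable_one_div_nat_pow.mpr (by norm_num)).tsum_pos (fun n => by positivity) 1
    (by norm_num)

theorem totientSum_eq : totientSum = realZeta 3 / realZeta 4 := by
  rw [eq_div_iff realZeta_four_pos.ne']
  have h := riemannZeta_mul_LSeries_totient (s := ((4 : ℕ) : ℂ)) (by norm_num)
  have e : ((4 : ℕ) : ℂ) - 1 = ((3 : ℕ) : ℂ) := by norm_num
  rw [e, (hasDerivAt_riemannZeta_real 4 (by norm_num)).1,
    (hasDerivAt_riemannZeta_real 3 (by norm_num)).1, LSeries_ofReal_natCast _ _ (by norm_num)] at h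
  rw [← Complex.ofReal_mul, Complex.ofReal_inj] at h
  have h' : realZeta (4 : ℕ) * totientSum = realZeta (3 : ℕ) := h
  push_cast at h'
  linarith

/-- Differentiating `ζ(s) ∑ φ(m) m^{-s} = ζ(s-1)` at `s = 4` brings down `-log m`. -/
theorem totientLogSum_eq : totientLogSum =
    -(totientSum * (realZetaDeriv 3 / realZeta 3 - realZetaDeriv 4 / realZeta 4)) := by
  have h4 : HasDerivAt riemannZeta (realZetaDeriv (4 : ℕ) : ℂ) ((4 : ℕ) : ℂ) :=
    (hasDerivAt_riemannZeta_real 4 (by norm_num)).2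
  have hL := LSeries_hasDerivAt (f := fun n => ((n.totient : ℝ) : ℂ)) (s := ((4 : ℕ) : ℂ))
    (abscissa_totient_le.trans_lt (EReal.coe_lt_coe_iff.mpr (by norm_num)))
  have e : ((4 : ℕ) : ℂ) - 1 = ((3 : ℕ) : ℂ) := by norm_num
  have h3 : HasDerivAt (fun s => riemannZeta (s - 1)) (realZetaDeriv (3 : ℕ) : ℂ) ((4 : ℕ) : ℂ) := by
    have := (hasDerivAt_riemannZeta_real 3 (by norm_num)).2
    rw [← e] at this
    exact this.comp_sub_const _ _
  have hprod := h4.mul hL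
  have hev : (riemannZeta * LSeries fun n => ((n.totient : ℝ) : ℂ)) =ᶠ[nhds ((4 : ℕ) : ℂ)]
      fun s => riemannZeta (s - 1) := by
    filter_upwards [(isOpen_lt continuous_const Complex.continuous_re).mem_nhds
      (show (2 : ℝ) < ((4 : ℕ) : ℂ).re by norm_num)] with s hs
    exact riemannZeta_mul_LSeries_totient hs
  have h := hprod.unique (h3.congr_of_eventuallyEq hev)
  rw [logMul_ofReal, LSeries_ofReal_natCast _ _ (by norm_num),
    LSeries_ofReal_natCast _ _ (by norm_num), (hasDerivAt_riemannZeta_real 4 (by norm_num)).1] at h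
  have h' : realZetaDeriv (4 : ℕ) * totientSum + realZeta (4 : ℕ) * (-totientLogSum)
      = realZetaDeriv (3 : ℕ) := by
    rw [← Complex.ofReal_neg, ← Complex.ofReal_mul, ← Complex.ofReal_mul, ← Complex.ofReal_add,
      Complex.ofReal_inj] at h
    exact h
  push_cast at h'
  rw [totientSum_eq] at h' ⊢
  have p3 := realZeta_three_pos.ne'
  have p4 := realZeta_four_pos.ne'
  field_simp at h' ⊢
  linear_combination -h'

end ZetaConstants

/-! ### Asymptotics of the smoothed harmonic sum -/

section SmoothHarmonic

/-- The terms of the smoothed harmonic sum `∑ (1/e) y² / (y² + e²)`. -/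
noncomputable def smoothHarmonicTerm (y : ℝ) (n : ℕ) : ℝ :=
  1 / ((n : ℝ) + 1) * (y ^ 2 / (y ^ 2 + ((n : ℝ) + 1) ^ 2))

theorem smoothHarmonicTerm_nonneg (y : ℝ) (n : ℕ) : 0 ≤ smoothHarmonicTerm y n := by
  unfold smoothHarmonicTerm; positivity

theorem smoothHarmonicTerm_le (y : ℝ) (n : ℕ) :
    smoothHarmonicTerm y n ≤ y ^ 2 * (1 / ((n : ℝ) + 1) ^ 3) := by
  unfold smoothHarmonicTerm
  calc _ ≤ 1 / ((n : ℝ) + 1) * (y ^ 2 / ((n : ℝ) + 1) ^ 2) := by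
        gcongr; nlinarith [sq_nonneg y]
    _ = _ := by field_simp

theorem sum_range_one_div_cube_le (E M : ℕ) :
    ∑ n ∈ Finset.range M, 1 / (((n + E : ℕ) : ℝ) + 1) ^ 3
      ≤ 2 / ((E : ℝ) + 1) ^ 2 - 2 / ((E : ℝ) + M + 1) ^ 2 := by
  induction M with
  | zero => simp
  | succ M ih =>
    rw [Finset.sum_range_succ]
    have hk : (0 : ℝ) < (E : ℝ) + M + 1 := by positivity
    have hstep : 1 / (((M + E : ℕ) : ℝ) + 1) ^ 3
        ≤ 2 / ((E : ℝ) + M + 1) ^ 2 - 2 / ((E : ℝ) + (M + 1 : ℕ) + 1) ^ 2 := by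
      have e1 : (((M + E : ℕ) : ℝ) + 1) = (E : ℝ) + M + 1 := by push_cast; ring
      have e2 : (E : ℝ) + (M + 1 : ℕ) + 1 = ((E : ℝ) + M + 1) + 1 := by push_cast; ring
      rw [e1, e2]
      have hk1 : (1 : ℝ) ≤ (E : ℝ) + M + 1 := by
        have : (0 : ℝ) ≤ (E : ℝ) + M := by positivity
        linarith
      set k := (E : ℝ) + M + 1
      rw [div_sub_div _ _ (by positivity) (by positivity), div_le_div_iff₀ (by positivity) (by positivity)]
      nlinarith [pow_pos hk 2, pow_pos hk 3, pow_pos hk 4, mul_nonneg (sub_nonneg.mpr hk1) (pow_pos hk 2).le, mul_nonneg (sub_nonneg.mpr hk1) (pow_pos hk 3).le]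
    linarith

theorem summable_smoothHarmonicTerm (y : ℝ) : Summable (smoothHarmonicTerm y) := by
  have h : Summable fun n : ℕ => y ^ 2 * (1 / ((n : ℝ) + 1) ^ 3) := by
    have := (summable_nat_add_iff 1).mpr
      (Real.summable_one_div_nat_pow.mpr (by norm_num : 1 < 3))
    push_cast at this
    exact this.mul_left _
  exact h.of_nonneg_of_le (smoothHarmonicTerm_nonneg y) (smoothHarmonicTerm_le y)

/-- `∑ (1/e) y² / (y² + e²)`. -/
noncomputable def smoothHarmonic (y : ℝ) : ℝ := ∑' n, smoothHarmonicTerm y n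

theorem smoothHarmonic_sub_sum_range (y : ℝ) (E : ℕ) :
    0 ≤ smoothHarmonic y - ∑ n ∈ Finset.range E, smoothHarmonicTerm y n ∧
    smoothHarmonic y - ∑ n ∈ Finset.range E, smoothHarmonicTerm y n
      ≤ 2 * y ^ 2 / ((E : ℝ) + 1) ^ 2 := by
  have h := (summable_smoothHarmonicTerm y).sum_add_tsum_nat_add E
  have e : smoothHarmonic y - ∑ n ∈ Finset.range E, smoothHarmonicTerm y n
      = ∑' n, smoothHarmonicTerm y (n + E) := by
    unfold smoothHarmonic; linarith
  rw [e]
  refine ⟨tsum_nonneg fun n => smoothHarmonicTerm_nonneg y _,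
    Real.tsum_le_of_sum_range_le (fun n => smoothHarmonicTerm_nonneg y _) fun M => ?_⟩
  calc _ ≤ ∑ n ∈ Finset.range M, y ^ 2 * (1 / (((n + E : ℕ) : ℝ) + 1) ^ 3) :=
        Finset.sum_le_sum fun n _ => smoothHarmonicTerm_le y _
    _ = y ^ 2 * ∑ n ∈ Finset.range M, 1 / (((n + E : ℕ) : ℝ) + 1) ^ 3 := by rw [Finset.mul_sum]
    _ ≤ y ^ 2 * (2 / ((E : ℝ) + 1) ^ 2) := by
        gcongr
        have := sum_range_one_div_cube_le E M
        have h2 : 0 ≤ 2 / ((E : ℝ) + M + 1) ^ 2 := by positivity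
        linarith
    _ = _ := by ring

/-- The function `t / (y² + t²)` has primitive `½ log(y² + t²)`; both sides of `1 - 1/r ≤ log r ≤ r
- 1` compare its unit increment with the endpoint value. -/
theorem abs_half_log_sub_le {y : ℝ} (hy : 0 < y) (n : ℕ) :
    |1 / 2 * (Real.log (y ^ 2 + ((n : ℝ) + 1) ^ 2) - Real.log (y ^ 2 + (n : ℝ) ^ 2))
      - ((n : ℝ) + 1) / (y ^ 2 + ((n : ℝ) + 1) ^ 2)| ≤ 2 * (1 / (y ^ 2 + (n : ℝ) ^ 2)) := by
  have hn : (0 : ℝ) ≤ n := Nat.cast_nonneg n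
  have hA : 0 < y ^ 2 + (n : ℝ) ^ 2 := by positivity
  have hB : 0 < y ^ 2 + ((n : ℝ) + 1) ^ 2 := by positivity
  have hBe : ((n : ℝ) + 1) ^ 2 ≤ y ^ 2 + ((n : ℝ) + 1) ^ 2 := by nlinarith [sq_nonneg y]
  have hBA : y ^ 2 + ((n : ℝ) + 1) ^ 2 = y ^ 2 + (n : ℝ) ^ 2 + (2 * n + 1) := by ring
  rw [← Real.log_div hB.ne' hA.ne']
  set A := y ^ 2 + (n : ℝ) ^ 2
  set B := y ^ 2 + ((n : ℝ) + 1) ^ 2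
  have hup := Real.log_le_sub_one_of_pos (div_pos hB hA)
  have hlow := Real.one_sub_inv_le_log_of_pos (div_pos hB hA)
  rw [inv_div] at hlow
  have e1 : B / A - 1 = (2 * n + 1) / A := by rw [hBA]; field_simp; ring
  have e2 : 1 - A / B = (2 * n + 1) / B := by
    have : A = B - (2 * n + 1) := by linarith
    rw [this]; field_simp; ring
  rw [e1] at hup
  rw [e2] at hlow
  rw [abs_le]
  constructor
  · have : ((n : ℝ) + 1) / B - 2 * (1 / A) ≤ 1 / 2 * ((2 * n + 1) / B) := by
      have h1 : 1 / B ≤ 1 / A := one_div_le_one_div_of_le hA (by linarith)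
      have h2 : ((n : ℝ) + 1) / B = 1 / 2 * ((2 * n + 1) / B) + 1 / 2 * (1 / B) := by field_simp; ring
      have h3 : 0 < 1 / A := by positivity
      linarith
    linarith
  · have : 1 / 2 * ((2 * n + 1) / A) ≤ ((n : ℝ) + 1) / B + 2 * (1 / A) := by
      have h0 : ((n : ℝ) + 1) / B + 2 * (1 / A) = (((n : ℝ) + 1) * A + 2 * B) / (A * B) := by
        field_simp
      have h00 : 1 / 2 * ((2 * n + 1) / A) = ((n : ℝ) + 1 / 2) / A := by field_simp
      rw [h0, h00, div_le_div_iff₀ hA (by positivity)]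
      have : ((n : ℝ) + 1 / 2) * B ≤ ((n : ℝ) + 1) * A + 2 * B := by nlinarith
      calc _ = ((n : ℝ) + 1 / 2) * B * A := by ring
        _ ≤ _ := by gcongr
    linarith

/-- Splits the decay between a saving in `y` and a summable power of `n`. With `y = √q / m²` the
saving `y^{-1/2}` equals `m q^{-1/4}`, and `∑ φ(m) m / m⁴` converges; a saving `y⁻¹` would produce
`m²` and a divergent sum. -/
theorem one_div_sq_add_sq_le {y : ℝ} (hy : 1 ≤ y) (n : ℕ) :
    1 / (y ^ 2 + (n : ℝ) ^ 2)
      ≤ y ^ (-(1 / 2) : ℝ) * ((if n = 0 then 1 else 0) + (n : ℝ) ^ (-(3 / 2) : ℝ)) := by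
  have hy0 : 0 < y := by linarith
  rcases Nat.eq_zero_or_pos n with rfl | hn
  · simp only [Nat.cast_zero, if_true]
    rw [Real.zero_rpow (by norm_num), add_zero, mul_one, zero_pow two_ne_zero, add_zero]
    have : 1 / y ^ 2 = y ^ (-2 : ℝ) := by
      rw [Real.rpow_neg hy0.le]; norm_num
    rw [this]
    exact Real.rpow_le_rpow_of_exponent_le hy (by norm_num)
  · have hn0 : (0 : ℝ) < n := by exact_mod_cast hn
    rw [if_neg hn.ne', zero_add, Real.rpow_neg hy0.le, Real.rpow_neg hn0.le, ← mul_inv, one_div]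
    apply inv_anti₀ (by positivity)
    have key (M : ℝ) (hM : 0 < M) (h1 : y ≤ M) (h2 : (n : ℝ) ≤ M) (h3 : M ^ 2 ≤ y ^ 2 + (n : ℝ) ^ 2) :
        y ^ (1 / 2 : ℝ) * (n : ℝ) ^ (3 / 2 : ℝ) ≤ y ^ 2 + (n : ℝ) ^ 2 := by
      calc y ^ (1 / 2 : ℝ) * (n : ℝ) ^ (3 / 2 : ℝ) ≤ M ^ (1 / 2 : ℝ) * M ^ (3 / 2 : ℝ) := by gcongr
        _ = M ^ 2 := by rw [← Real.rpow_add hM]; norm_num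
        _ ≤ _ := h3
    rcases le_total y n with h | h
    · exact key n hn0 h le_rfl (by nlinarith)
    · exact key y hy0 le_rfl h (by nlinarith)

theorem smoothHarmonic_asymp_of_one_le :
    ∃ C : ℝ, 0 ≤ C ∧ ∀ y : ℝ, 1 ≤ y →
      |smoothHarmonic y - (Real.log y + Real.eulerMascheroniConstant)| ≤ C * y ^ (-(1 / 2) : ℝ) := by
  have hsum : Summable fun n : ℕ => ((if n = 0 then 1 else 0) + (n : ℝ) ^ (-(3 / 2) : ℝ)) := by
    refine Summable.add (summable_of_ne_finset_zero (s := {0}) (by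
      intro b hb; rw [Finset.mem_singleton] at hb; simp [hb])) ?_
    exact Real.summable_nat_rpow.mpr (by norm_num)
  have hnn (n : ℕ) : 0 ≤ ((if n = 0 then 1 else 0) + (n : ℝ) ^ (-(3 / 2) : ℝ)) := by
    split_ifs <;> positivity
  set K : ℝ := ∑' n : ℕ, ((if n = 0 then 1 else 0) + (n : ℝ) ^ (-(3 / 2) : ℝ)) with hK
  have hK0 : 0 ≤ K := tsum_nonneg hnn
  refine ⟨2 * K, by positivity, fun y hy => ?_⟩
  have hy0 : 0 < y := by linarith
  -- Since `(1/e) y²/(y² + e²) = 1/e - e/(y² + e²)`, a partial sum is a harmonic number minus a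
  -- nearly telescoping logarithm, and the bound is uniform in `E`.
  have hpartial (E : ℕ) : |∑ n ∈ Finset.range E, smoothHarmonicTerm y n -
      (harmonic E - 1 / 2 * (Real.log (y ^ 2 + (E : ℝ) ^ 2) - Real.log (y ^ 2)))|
      ≤ 2 * K * y ^ (-(1 / 2) : ℝ) := by
    have h1 : ∑ n ∈ Finset.range E, smoothHarmonicTerm y n = harmonic E -
        ∑ n ∈ Finset.range E, ((n : ℝ) + 1) / (y ^ 2 + ((n : ℝ) + 1) ^ 2) := by
      unfold harmonic
      push_cast
      rw [← Finset.sum_sub_distrib]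
      refine Finset.sum_congr rfl fun n _ => ?_
      unfold smoothHarmonicTerm
      field_simp
      ring
    have h2 : 1 / 2 * (Real.log (y ^ 2 + (E : ℝ) ^ 2) - Real.log (y ^ 2))
        = ∑ n ∈ Finset.range E, 1 / 2 * (Real.log (y ^ 2 + ((n : ℝ) + 1) ^ 2)
          - Real.log (y ^ 2 + (n : ℝ) ^ 2)) := by
      rw [← Finset.mul_sum]
      congr 1
      have := Finset.sum_range_sub (fun n : ℕ => Real.log (y ^ 2 + (n : ℝ) ^ 2)) E
      push_cast at this
      rw [this]; simp
    have h3 : ∑ n ∈ Finset.range E, smoothHarmonicTerm y n -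
        (harmonic E - 1 / 2 * (Real.log (y ^ 2 + (E : ℝ) ^ 2) - Real.log (y ^ 2)))
        = ∑ n ∈ Finset.range E, (1 / 2 * (Real.log (y ^ 2 + ((n : ℝ) + 1) ^ 2)
          - Real.log (y ^ 2 + (n : ℝ) ^ 2)) - ((n : ℝ) + 1) / (y ^ 2 + ((n : ℝ) + 1) ^ 2)) := by
      rw [h1, h2, Finset.sum_sub_distrib]; ring
    rw [h3]
    calc _ ≤ ∑ n ∈ Finset.range E, 2 * (y ^ (-(1 / 2) : ℝ) *
          ((if n = 0 then 1 else 0) + (n : ℝ) ^ (-(3 / 2) : ℝ))) := by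
          refine (Finset.abs_sum_le_sum_abs _ _).trans (Finset.sum_le_sum fun n _ => ?_)
          refine (abs_half_log_sub_le hy0 n).trans ?_
          have := one_div_sq_add_sq_le hy n
          linarith
      _ = 2 * (y ^ (-(1 / 2) : ℝ) *
          ∑ n ∈ Finset.range E, ((if n = 0 then 1 else 0) + (n : ℝ) ^ (-(3 / 2) : ℝ))) := by
          rw [← Finset.mul_sum, ← Finset.mul_sum]
      _ ≤ 2 * (y ^ (-(1 / 2) : ℝ) * K) := by
          gcongr
          exact hsum.sum_le_tsum _ fun n _ => hnn n
      _ = _ := by ring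
  have hlim1 := (summable_smoothHarmonicTerm y).hasSum.tendsto_sum_nat
  have hlim2 : Filter.Tendsto (fun E : ℕ => (harmonic E : ℝ) -
      1 / 2 * (Real.log (y ^ 2 + (E : ℝ) ^ 2) - Real.log (y ^ 2))) Filter.atTop
      (nhds (Real.log y + Real.eulerMascheroniConstant)) := by
    have hz : Filter.Tendsto (fun E : ℕ => 1 / 2 * Real.log (1 + (y / (E : ℝ)) ^ 2)) Filter.atTop
        (nhds 0) := by
      have h1 : Filter.Tendsto (fun E : ℕ => y / (E : ℝ)) Filter.atTop (nhds 0) :=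
        tendsto_const_div_atTop_nhds_zero_nat y
      have h2 : Filter.Tendsto (fun E : ℕ => 1 + (y / (E : ℝ)) ^ 2) Filter.atTop (nhds 1) := by
        simpa using (h1.pow 2).const_add 1
      have h3 := (Real.continuousAt_log one_ne_zero).tendsto.comp h2
      rw [Real.log_one] at h3
      have h4 := h3.const_mul (1 / 2)
      rw [mul_zero] at h4
      exact h4
    have h := (Real.tendsto_harmonic_sub_log.sub hz).add_const (Real.log y)
    rw [sub_zero, add_comm] at h
    refine h.congr' ?_
    filter_upwards [Filter.eventually_gt_atTop 0] with E hE
    have hE0 : (0 : ℝ) < E := by exact_mod_cast hE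
    have : y ^ 2 + (E : ℝ) ^ 2 = (E : ℝ) ^ 2 * (1 + (y / E) ^ 2) := by field_simp; ring
    rw [this, Real.log_mul (by positivity) (by positivity), Real.log_pow, Real.log_pow]
    push_cast
    ring
  exact le_of_tendsto ((hlim1.sub hlim2).abs) (Filter.Eventually.of_forall hpartial)

/-- Small `y` is needed because `m²` may exceed `√q`. There the sum, `γ` and `|log y|` are each
`O(y^{-1/2})` trivially. -/
theorem smoothHarmonic_asymp :
    ∃ C : ℝ, 0 ≤ C ∧ ∀ y : ℝ, 0 < y →
      |smoothHarmonic y - (Real.log y + Real.eulerMascheroniConstant)| ≤ C * y ^ (-(1 / 2) : ℝ) := by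
  obtain ⟨C, hC0, hC⟩ := smoothHarmonic_asymp_of_one_le
  refine ⟨C + 5, by positivity, fun y hy => ?_⟩
  have hp : 0 < y ^ (-(1 / 2) : ℝ) := Real.rpow_pos_of_pos hy _
  rcases le_or_gt 1 y with h | h
  · refine (hC y h).trans ?_
    gcongr; linarith
  · have h1 : 1 ≤ y ^ (-(1 / 2) : ℝ) :=
      Real.one_le_rpow_of_pos_of_le_one_of_nonpos hy h.le (by norm_num)
    have hS := smoothHarmonic_sub_sum_range y 0
    simp only [Finset.range_zero, Finset.sum_empty, sub_zero, Nat.cast_zero, zero_add, one_pow,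
      div_one] at hS
    have hS2 : smoothHarmonic y ≤ 2 := by nlinarith [hS.2]
    have hlog0 : Real.log y ≤ 0 := Real.log_nonpos hy.le h.le
    have hlog : -Real.log y ≤ 2 * y ^ (-(1 / 2) : ℝ) := by
      have := Real.log_le_rpow_div (x := y⁻¹) (by positivity) (ε := 1 / 2) (by norm_num)
      rw [Real.log_inv, Real.inv_rpow hy.le, ← Real.rpow_neg hy.le] at this
      linarith
    have hg0 := Real.one_half_lt_eulerMascheroniConstant
    have hg1 := Real.eulerMascheroniConstant_lt_two_thirds
    have hCp : 0 ≤ C * y ^ (-(1 / 2) : ℝ) := by positivity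
    rw [abs_le]
    constructor
    · linarith [hS.1]
    · linarith [hS.1]

theorem sum_smoothHarmonicTerm_asymp :
    ∃ C : ℝ, 0 ≤ C ∧ ∀ (q : ℝ) (m D : ℕ), 0 < q → 0 < m → 0 < D →
      |∑ n ∈ Finset.range (D / m ^ 2), smoothHarmonicTerm (√q / (m : ℝ) ^ 2) n
        - (1 / 2 * Real.log q + Real.eulerMascheroniConstant - 2 * Real.log m)|
      ≤ C * (m * q ^ (-(1 / 4) : ℝ) + q / (D : ℝ) ^ 2) := by
  obtain ⟨C, hC0, hC⟩ := smoothHarmonic_asymp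
  refine ⟨C + 2, by positivity, fun q m D hq hm hD => ?_⟩
  have hmR : (0 : ℝ) < m := by exact_mod_cast hm
  have hDR : (0 : ℝ) < D := by exact_mod_cast hD
  have hsq : 0 < √q := Real.sqrt_pos.mpr hq
  set y := √q / (m : ℝ) ^ 2 with hy
  have hy0 : 0 < y := by positivity
  have h1 := hC y hy0
  have hlogy : Real.log y = 1 / 2 * Real.log q - 2 * Real.log m := by
    rw [hy, Real.log_div hsq.ne' (by positivity), Real.log_sqrt hq.le, Real.log_pow]
    push_cast; ring
  have hyp : y ^ (-(1 / 2) : ℝ) = m * q ^ (-(1 / 4) : ℝ) := by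
    rw [hy, Real.div_rpow hsq.le (by positivity), Real.sqrt_eq_rpow, ← Real.rpow_mul hq.le,
      ← Real.rpow_natCast, ← Real.rpow_mul hmR.le]
    norm_num
    rw [Real.rpow_neg_one]
    field_simp
  rw [hlogy, hyp] at h1
  have h2 := smoothHarmonic_sub_sum_range y (D / m ^ 2)
  have h3 : 2 * y ^ 2 / (((D / m ^ 2 : ℕ) : ℝ) + 1) ^ 2 ≤ 2 * (q / (D : ℝ) ^ 2) := by
    have hlt : (D : ℝ) / (m : ℝ) ^ 2 ≤ ((D / m ^ 2 : ℕ) : ℝ) + 1 := by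
      rw [div_le_iff₀ (by positivity)]
      have : D ≤ (D / m ^ 2 + 1) * m ^ 2 := by
        have := Nat.lt_div_mul_add (a := D) (b := m ^ 2) (by positivity)
        rw [add_mul, one_mul]; exact this.le
      exact_mod_cast this
    have hy2 : y ^ 2 = q / (m : ℝ) ^ 4 := by
      rw [hy, div_pow, Real.sq_sqrt hq.le, ← pow_mul]
    calc _ ≤ 2 * y ^ 2 / ((D : ℝ) / (m : ℝ) ^ 2) ^ 2 := by gcongr
      _ = _ := by rw [hy2]; field_simp
  have hq' : 0 ≤ q / (D : ℝ) ^ 2 := by positivity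
  have hmq : 0 ≤ m * q ^ (-(1 / 4) : ℝ) := by positivity
  have hCq : 0 ≤ C * (q / (D : ℝ) ^ 2) := by positivity
  have e : (C + 2) * (m * q ^ (-(1 / 4) : ℝ) + q / (D : ℝ) ^ 2)
    = C * (m * q ^ (-(1 / 4) : ℝ)) + 2 * (m * q ^ (-(1 / 4) : ℝ)) + C * (q / (D : ℝ) ^ 2)
      + 2 * (q / (D : ℝ) ^ 2) := by ring
  rw [e]
  rw [abs_le] at h1 ⊢
  constructor <;> linarith [h1.1, h1.2, h2.1, h2.2]

end SmoothHarmonic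

/-! ### The weighted singular series -/

/-- Put `d = m² e` with `e = n + 1`: the density contributes `φ(m)/(m⁴ e)` and the weight becomes
`y²/(y² + e²)` with `y = √q/m²`. The series over `m` is finite: terms with `m² > D` are empty, and
`φ(0) = 0`. -/
theorem sum_boxCount_mul_eq (D : ℕ) (q : ℝ) (hq : 0 < q) :
    ∑ d ∈ Finset.Icc 1 D, (boxCount d d d d : ℝ) / (d : ℝ) ^ 3 * (q / (q + (d : ℝ) ^ 2))
      = ∑' m : ℕ, (m.totient : ℝ) / (m : ℝ) ^ 4 *
          ∑ n ∈ Finset.range (D / m ^ 2), smoothHarmonicTerm (√q / (m : ℝ) ^ 2) n := by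
  rw [tsum_eq_sum (s := Finset.Icc 1 D)]
  · calc _ = ∑ d ∈ Finset.Icc 1 D, ∑ m ∈ Finset.Icc 1 D, if m ^ 2 ∣ d then
          (m.totient : ℝ) / ((m : ℝ) ^ 2 * d) * (q / (q + (d : ℝ) ^ 2)) else 0 := by
          refine Finset.sum_congr rfl fun d hd => ?_
          obtain ⟨hd1, hdD⟩ := Finset.mem_Icc.mp hd
          rw [boxCount_self_div_cube d hd1, Finset.sum_mul, ← Finset.sum_filter]
          refine Finset.sum_congr ?_ fun _ _ => rfl
          ext m
          simp only [Finset.mem_filter, Finset.mem_Icc]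
          constructor
          · rintro ⟨⟨h1, h2⟩, h3⟩; exact ⟨⟨h1, h2.trans hdD⟩, h3⟩
          · rintro ⟨⟨h1, h2⟩, h3⟩
            exact ⟨⟨h1, (Nat.le_self_pow two_ne_zero m).trans (Nat.le_of_dvd hd1 h3)⟩, h3⟩
      _ = _ := by
          rw [Finset.sum_comm]
          refine Finset.sum_congr rfl fun m hm => ?_
          have hm0 : 0 < m := (Finset.mem_Icc.mp hm).1
          have hmR : (0 : ℝ) < m := by exact_mod_cast hm0
          rw [← Finset.sum_filter, Finset.mul_sum]
          symm
          refine Finset.sum_nbij' (fun n => m ^ 2 * (n + 1)) (fun d => d / m ^ 2 - 1) ?_ ?_ ?_ ?_ ?_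
          · intro n hn
            have h1 : n + 1 ≤ D / m ^ 2 := Finset.mem_range.mp hn
            simp only [Finset.mem_filter, Finset.mem_Icc, dvd_mul_right, and_true]
            refine ⟨Nat.mul_pos (by positivity) n.succ_pos, ?_⟩
            rw [mul_comm]
            exact (Nat.le_div_iff_mul_le (by positivity)).mp h1
          · intro d hd
            simp only [Finset.mem_filter, Finset.mem_Icc] at hd
            obtain ⟨⟨h1, h2⟩, h3⟩ := hd
            have h4 : 0 < d / m ^ 2 := Nat.div_pos (Nat.le_of_dvd h1 h3) (by positivity)
            have h5 : d / m ^ 2 ≤ D / m ^ 2 := Nat.div_le_div_right h2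
            rw [Finset.mem_range]; omega
          · intro n _
            rw [Nat.mul_div_cancel_left _ (by positivity)]; omega
          · intro d hd
            simp only [Finset.mem_filter, Finset.mem_Icc] at hd
            obtain ⟨⟨h1, h2⟩, h3⟩ := hd
            have h4 : 0 < d / m ^ 2 := Nat.div_pos (Nat.le_of_dvd h1 h3) (by positivity)
            rw [Nat.sub_add_cancel h4, Nat.mul_div_cancel' h3]
          · intro n _
            unfold smoothHarmonicTerm
            push_cast
            rw [div_pow, Real.sq_sqrt hq.le]
            field_simp
  · intro m hm
    rw [Finset.mem_Icc, not_and_or] at hm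
    rcases Nat.eq_zero_or_pos m with rfl | hm0
    · simp
    · have : D < m ^ 2 := lt_of_lt_of_le (by omega) (Nat.le_self_pow two_ne_zero m)
      rw [Nat.div_eq_of_lt this]; simp

theorem summable_totient_div_cube : Summable fun m : ℕ => (m.totient : ℝ) / (m : ℝ) ^ 4 * m := by
  refine (Real.summable_one_div_nat_pow.mpr (by norm_num : 1 < 2)).of_nonneg_of_le
    (fun m => by positivity) fun m => ?_
  rcases Nat.eq_zero_or_pos m with rfl | hm
  · simp
  · have hmR : (0 : ℝ) < m := by exact_mod_cast hm
    have : (m.totient : ℝ) ≤ m := by exact_mod_cast m.totient_le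
    calc (m.totient : ℝ) / (m : ℝ) ^ 4 * m ≤ m / (m : ℝ) ^ 4 * m := by gcongr
      _ = _ := by field_simp

theorem summable_totient_div : Summable fun m : ℕ => (m.totient : ℝ) / (m : ℝ) ^ 4 := by
  refine summable_totient_div_cube.of_nonneg_of_le (fun m => by positivity) fun m => ?_
  rcases Nat.eq_zero_or_pos m with rfl | hm
  · simp
  · have hmR : (1 : ℝ) ≤ m := by exact_mod_cast hm
    exact le_mul_of_one_le_right (by positivity) hmR

theorem summable_totient_log : Summable fun m : ℕ => (m.totient : ℝ) / (m : ℝ) ^ 4 * Real.log m := by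
  refine summable_totient_div_cube.of_nonneg_of_le
    (fun m => mul_nonneg (by positivity) (Real.log_natCast_nonneg m)) fun m => ?_
  gcongr
  exact Real.log_le_self (by positivity)

/-- The singular series weighted by `q / (q + d²)`. -/
theorem sum_boxCount_mul_asymp :
    ∃ C : ℝ, 0 ≤ C ∧ ∀ (q : ℝ) (D : ℕ), 0 < q → 0 < D →
      |∑ d ∈ Finset.Icc 1 D, (boxCount d d d d : ℝ) / (d : ℝ) ^ 3 * (q / (q + (d : ℝ) ^ 2))
        - (totientSum * (1 / 2 * Real.log q + Real.eulerMascheroniConstant) - 2 * totientLogSum)|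
      ≤ C * (q ^ (-(1 / 4) : ℝ) + q / (D : ℝ) ^ 2) := by
  obtain ⟨C, hC0, hC⟩ := sum_smoothHarmonicTerm_asymp
  set K := ∑' m : ℕ, (m.totient : ℝ) / (m : ℝ) ^ 4 * m with hK
  have hK0 : 0 ≤ K := tsum_nonneg fun m => by positivity
  refine ⟨C * K, by positivity, fun q D hq hD => ?_⟩
  set T : ℕ → ℝ := fun m => (m.totient : ℝ) / (m : ℝ) ^ 4 with hT
  set P : ℕ → ℝ := fun m =>
    ∑ n ∈ Finset.range (D / m ^ 2), smoothHarmonicTerm (√q / (m : ℝ) ^ 2) n with hP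
  set L := 1 / 2 * Real.log q + Real.eulerMascheroniConstant with hL
  have hT0 (m : ℕ) : 0 ≤ T m := by simp only [hT]; positivity
  have hmain : totientSum * L - 2 * totientLogSum = ∑' m : ℕ, T m * (L - 2 * Real.log m) := by
    have h1 : totientLogSum = ∑' m : ℕ, T m * Real.log m :=
      tsum_congr fun m => by simp only [hT]; ring
    rw [h1, totientSum, ← tsum_mul_right, ← tsum_mul_left,
      ← (summable_totient_div.mul_right L).tsum_sub (summable_totient_log.mul_left 2)]
    exact tsum_congr fun m => by simp only [hT]; ring
  have hsumM : Summable fun m : ℕ => T m * (L - 2 * Real.log m) := by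
    refine ((summable_totient_div.mul_right L).sub (summable_totient_log.mul_left 2)).congr
      fun m => ?_
    simp only [hT]; ring
  set b := q ^ (-(1 / 4) : ℝ) + q / (D : ℝ) ^ 2 with hb
  have hterm (m : ℕ) : |T m * P m - T m * (L - 2 * Real.log m)| ≤ C * b * (T m * m) := by
    rcases Nat.eq_zero_or_pos m with rfl | hm
    · simp [hT]
    · have hm1 : (1 : ℝ) ≤ m := by exact_mod_cast hm
      rw [← mul_sub, abs_mul, abs_of_nonneg (hT0 m)]
      calc _ ≤ T m * (C * (m * q ^ (-(1 / 4) : ℝ) + q / (D : ℝ) ^ 2)) := by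
            have := hC q m D hq hm hD
            gcongr
        _ ≤ T m * (C * (m * q ^ (-(1 / 4) : ℝ) + m * (q / (D : ℝ) ^ 2))) := by
            have : q / (D : ℝ) ^ 2 ≤ m * (q / (D : ℝ) ^ 2) :=
              le_mul_of_one_le_left (by positivity) hm1
            gcongr
        _ = _ := by rw [hb]; ring
  have hsumB : Summable fun m : ℕ => C * b * (T m * m) := summable_totient_div_cube.mul_left _
  have hsumD : Summable fun m : ℕ => T m * P m - T m * (L - 2 * Real.log m) :=
    Summable.of_norm_bounded hsumB hterm
  have hsumP : Summable fun m : ℕ => T m * P m := by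
    simpa using hsumD.add hsumM
  rw [sum_boxCount_mul_eq D q hq, hmain, ← hsumP.tsum_sub hsumM]
  rw [← Real.norm_eq_abs]
  calc _ ≤ ∑' m : ℕ, C * b * (T m * m) := tsum_of_norm_bounded hsumB.hasSum hterm
    _ = C * K * b := by rw [tsum_mul_left]; ring

/-! ### Integrability of the logarithm and the Riemann sum -/

section LogIntegral

/-- The unit cube without its lower faces. -/
def openUnitCube : Set (Fin 3 → ℝ) := Set.pi Set.univ fun _ => Set.Ioc 0 1

theorem openUnitCube_ae_eq : openUnitCube =ᵐ[volume] Set.Icc (0 : Fin 3 → ℝ) 1 :=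
  Measure.univ_pi_Ioc_ae_eq_Icc

/-- An integrable majorant of `|log (t₀t₁ + t₁t₂ + t₀t₂)|`. -/
noncomputable def logMajorant (t : Fin 3 → ℝ) : ℝ :=
  (t 0) ^ (-(1 / 2) : ℝ) * (t 1) ^ (-(1 / 2) : ℝ)

theorem integrableOn_logMajorant : IntegrableOn logMajorant openUnitCube := by
  have h1 : Integrable (fun s : ℝ => s ^ (-(1 / 2) : ℝ)) (volume.restrict (Set.Ioc (0 : ℝ) 1)) :=
    (intervalIntegrable_iff_integrableOn_Ioc_of_le zero_le_one).mp
      (intervalIntegral.intervalIntegrable_rpow' (by norm_num))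
  have h2 : Integrable (fun _ : ℝ => (1 : ℝ)) (volume.restrict (Set.Ioc (0 : ℝ) 1)) :=
    integrable_const 1
  have h := Integrable.fintype_prod (ι := Fin 3) (E := ℝ)
    (f := ![fun s : ℝ => s ^ (-(1 / 2) : ℝ), fun s : ℝ => s ^ (-(1 / 2) : ℝ), fun _ => (1 : ℝ)])
    (μ := fun _ => volume.restrict (Set.Ioc (0 : ℝ) 1)) (by
      intro i; fin_cases i
      · exact h1
      · exact h1
      · exact h2)
  rw [← Measure.restrict_pi_pi] at h
  refine (h.congr (Filter.Eventually.of_forall fun t => ?_))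
  simp [Fin.prod_univ_three, logMajorant]

theorem measurable_logSymForm : Measurable logSymForm := by
  unfold logSymForm symForm
  fun_prop

/-- On the cube `t₀t₁ ≤ Q ≤ 3`, and `-log s ≤ 2 s^{-1/2}` turns the lower bound into an integrable
product. -/
theorem abs_logSymForm_le {t : Fin 3 → ℝ} (ht : t ∈ openUnitCube) :
    |logSymForm t| ≤ 2 * logMajorant t := by
  have h (i : Fin 3) : 0 < t i ∧ t i ≤ 1 := ht i (Set.mem_univ i)
  obtain ⟨h0, h0'⟩ := h 0
  obtain ⟨h1, h1'⟩ := h 1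
  obtain ⟨h2, h2'⟩ := h 2
  have hM : logMajorant t = (t 0 * t 1) ^ (-(1 / 2) : ℝ) := by
    rw [logMajorant, Real.mul_rpow h0.le h1.le]
  have hp : 0 < t 0 * t 1 := by positivity
  have hp1 : t 0 * t 1 ≤ 1 := mul_le_one₀ h0' h1.le h1'
  have hM1 : 1 ≤ logMajorant t := by
    rw [hM]; exact Real.one_le_rpow_of_pos_of_le_one_of_nonpos hp hp1 (by norm_num)
  have hQ : t 0 * t 1 ≤ symForm (t 0) (t 1) (t 2) := by
    unfold symForm; nlinarith [mul_pos h1 h2, mul_pos h0 h2]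
  have hQ3 : symForm (t 0) (t 1) (t 2) ≤ 3 := by
    unfold symForm
    have := mul_le_one₀ h1' h2.le h2'
    have := mul_le_one₀ h0' h2.le h2'
    linarith
  have hQ0 : 0 < symForm (t 0) (t 1) (t 2) := hp.trans_le hQ
  rw [abs_le]
  constructor
  · have a1 : Real.log (t 0 * t 1) ≤ logSymForm t := Real.log_le_log hp hQ
    have a2 := Real.log_le_rpow_div (x := (t 0 * t 1)⁻¹) (by positivity) (ε := 1 / 2) (by norm_num)
    rw [Real.log_inv, Real.inv_rpow hp.le, ← Real.rpow_neg hp.le, ← hM] at a2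
    linarith
  · have a1 : logSymForm t ≤ symForm (t 0) (t 1) (t 2) - 1 := Real.log_le_sub_one_of_pos hQ0
    linarith

theorem integrableOn_logSymForm_cube : IntegrableOn logSymForm openUnitCube := by
  refine Integrable.mono' (integrableOn_logMajorant.const_mul 2)
    measurable_logSymForm.aestronglyMeasurable ?_
  refine (ae_restrict_iff' (MeasurableSet.univ_pi fun _ => measurableSet_Ioc)).mpr
    (Filter.Eventually.of_forall fun t ht => ?_)
  exact abs_logSymForm_le ht

theorem integrableOn_logSymForm : IntegrableOn logSymForm (Set.Icc (0 : Fin 3 → ℝ) 1) :=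
  integrableOn_logSymForm_cube.congr_set_ae openUnitCube_ae_eq.symm

/-- The cube of side `1 / N` with upper corner `k / N`. -/
def gridCube (N : ℕ) (k : Fin 3 → ℕ) : Set (Fin 3 → ℝ) :=
  Set.pi Set.univ fun i => Set.Ioc (((k i : ℝ) - 1) / N) ((k i : ℝ) / N)

theorem measurableSet_gridCube (N : ℕ) (k : Fin 3 → ℕ) : MeasurableSet (gridCube N k) :=
  MeasurableSet.univ_pi fun _ => measurableSet_Ioc

theorem volume_real_gridCube (N : ℕ) (hN : 0 < N) (k : Fin 3 → ℕ) :
    volume.real (gridCube N k) = 1 / (N : ℝ) ^ 3 := by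
  have hNR : (0 : ℝ) < N := by exact_mod_cast hN
  rw [Measure.real, gridCube, Real.volume_pi_Ioc_toReal (fun i => by dsimp only; gcongr; linarith)]
  simp only [Fin.prod_univ_three]
  field_simp
  ring

theorem mem_gridCube_iff (N : ℕ) (hN : 0 < N) (k : Fin 3 → ℕ) (hk : ∀ i, 1 ≤ k i) (t : Fin 3 → ℝ) :
    t ∈ gridCube N k ↔ ∀ i, ⌈N * t i⌉₊ = k i := by
  have hNR : (0 : ℝ) < N := by exact_mod_cast hN
  simp only [gridCube, Set.mem_pi, Set.mem_univ, true_implies, Set.mem_Ioc]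
  refine forall_congr' fun i => ?_
  rw [Nat.ceil_eq_iff (by have := hk i; omega), div_lt_iff₀ hNR, le_div_iff₀ hNR,
    Nat.cast_sub (hk i), Nat.cast_one, mul_comm (t i)]

theorem openUnitCube_eq_biUnion (N : ℕ) (hN : 0 < N) :
    openUnitCube = ⋃ k ∈ Fintype.piFinset fun _ : Fin 3 => Finset.Icc 1 N, gridCube N k := by
  have hNR : (0 : ℝ) < N := by exact_mod_cast hN
  ext t
  simp only [Set.mem_iUnion, Fintype.mem_piFinset, Finset.mem_Icc, exists_prop]
  constructor
  · intro ht
    have h (i : Fin 3) : 0 < t i ∧ t i ≤ 1 := ht i (Set.mem_univ i)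
    have h1 (i : Fin 3) : 1 ≤ ⌈N * t i⌉₊ := Nat.ceil_pos.mpr (mul_pos hNR (h i).1)
    refine ⟨fun i => ⌈N * t i⌉₊, fun i => ⟨h1 i, ?_⟩, (mem_gridCube_iff N hN _ h1 t).mpr fun _ => rfl⟩
    rw [Nat.ceil_le]
    exact mul_le_of_le_one_right hNR.le (h i).2
  · rintro ⟨k, hk, ht⟩ i -
    have hti := ht i (Set.mem_univ i)
    have h1 : (1 : ℝ) ≤ k i := by exact_mod_cast (hk i).1
    have h2 : (k i : ℝ) ≤ N := by exact_mod_cast (hk i).2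
    refine ⟨lt_of_le_of_lt (div_nonneg (by linarith) hNR.le) hti.1, hti.2.trans ?_⟩
    rw [div_le_one hNR]; exact h2

/-- By homogeneity the middle quantity is `log Q` at the upper corner `k/N`, where `Q` is largest on
the cube and exceeds `Q(t)` by at most `9/N`. -/
theorem gridCube_log_bounds (N : ℕ) (hN : 0 < N) (k : Fin 3 → ℕ)
    (hk : k ∈ Fintype.piFinset fun _ : Fin 3 => Finset.Icc 1 N) (t : Fin 3 → ℝ)
    (ht : t ∈ gridCube N k) :
    logSymForm t ≤ Real.log (symForm (k 0) (k 1) (k 2) : ℕ) - 2 * Real.log N ∧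
    Real.log (symForm (k 0) (k 1) (k 2) : ℕ) - 2 * Real.log N
      ≤ logSymForm t + 6 / √N * logMajorant t := by
  have hNR : (0 : ℝ) < N := by exact_mod_cast hN
  have hN1 : (1 : ℝ) ≤ N := by exact_mod_cast hN
  have htB : t ∈ openUnitCube := by
    rw [openUnitCube_eq_biUnion N hN]
    exact Set.mem_biUnion hk ht
  have hpos (i : Fin 3) : 0 < t i ∧ t i ≤ 1 := htB i (Set.mem_univ i)
  have hup (i : Fin 3) : t i ≤ (k i : ℝ) / N := (ht i (Set.mem_univ i)).2
  have hlow (i : Fin 3) : (k i : ℝ) / N ≤ t i + 1 / N := by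
    have := (ht i (Set.mem_univ i)).1
    rw [sub_div] at this
    linarith
  obtain ⟨h0, h0'⟩ := hpos 0
  obtain ⟨h1, h1'⟩ := hpos 1
  obtain ⟨h2, h2'⟩ := hpos 2
  have hQ0 := symForm_pos h0 h1 h2
  have hk0 (i : Fin 3) : 0 < (k i : ℝ) / N := (hpos i).1.trans_le (hup i)
  have hscale : Real.log (symForm (k 0) (k 1) (k 2) : ℕ) - 2 * Real.log N
      = Real.log (symForm ((k 0 : ℝ) / N) ((k 1 : ℝ) / N) ((k 2 : ℝ) / N)) := by
    have hkp (i : Fin 3) : (0 : ℝ) < k i := by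
      have := mul_pos (hk0 i) hNR
      rwa [div_mul_cancel₀ _ hNR.ne'] at this
    have e : symForm ((k 0 : ℝ) / N) ((k 1 : ℝ) / N) ((k 2 : ℝ) / N)
        = symForm (k 0 : ℝ) (k 1) (k 2) / (N : ℝ) ^ 2 := by
      unfold symForm; field_simp
    have e2 : ((symForm (k 0) (k 1) (k 2) : ℕ) : ℝ) = symForm (k 0 : ℝ) (k 1) (k 2) := by
      simp [symForm]
    rw [e, e2, Real.log_div (symForm_pos (hkp 0) (hkp 1) (hkp 2)).ne' (by positivity), Real.log_pow]
    push_cast; ring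
  rw [hscale]
  constructor
  · refine Real.log_le_log hQ0 ?_
    unfold symForm
    gcongr
    all_goals exact hup _
  · have hle : symForm ((k 0 : ℝ) / N) ((k 1 : ℝ) / N) ((k 2 : ℝ) / N)
        ≤ symForm (t 0) (t 1) (t 2) + 9 / N := by
      calc _ ≤ symForm (t 0 + 1 / N) (t 1 + 1 / N) (t 2 + 1 / N) := by
            unfold symForm
            gcongr
            all_goals exact hlow _
        _ = symForm (t 0) (t 1) (t 2) + (2 * (t 0 + t 1 + t 2) + 3 * (1 / N)) * (1 / N) := by
            unfold symForm; ring
        _ ≤ symForm (t 0) (t 1) (t 2) + 9 * (1 / N) := by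
            have : 1 / (N : ℝ) ≤ 1 := by rw [div_le_one hNR]; exact hN1
            gcongr
            linarith
        _ = _ := by ring
    have hM : logMajorant t = 1 / √(t 0 * t 1) := by
      rw [logMajorant, ← Real.mul_rpow h0.le h1.le, Real.rpow_neg (by positivity),
        ← Real.sqrt_eq_rpow, one_div]
    set Q := symForm (t 0) (t 1) (t 2) with hQ
    have hQp : t 0 * t 1 ≤ Q := by rw [hQ]; unfold symForm; nlinarith [mul_pos h1 h2, mul_pos h0 h2]
    have hu : 0 ≤ 9 / (N * Q) := by positivity
    -- The bound `log(1 + u) ≤ u` would lead, through `Q ≥ t₀t₁`, to the non-integrable `1/(t₀t₁)`;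
    -- the square root keeps the error integrable and costs only `N^{-1/2}`.
    have hlog1 : Real.log (1 + 9 / (N * Q)) ≤ 2 * √(9 / (N * Q)) := by
      have e : 1 + 9 / (N * Q) ≤ (1 + √(9 / (N * Q))) ^ 2 := by
        have := Real.sq_sqrt hu
        nlinarith [Real.sqrt_nonneg (9 / (N * Q))]
      have h3 := Real.log_le_log (by positivity) e
      rw [Real.log_pow] at h3
      have h4 := Real.log_le_sub_one_of_pos (show 0 < 1 + √(9 / (N * Q)) by positivity)
      push_cast at h3
      linarith
    have hsq : √(9 / (N * Q)) ≤ 3 / √N * (1 / √(t 0 * t 1)) := by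
      have e : 3 / √(N : ℝ) * (1 / √(t 0 * t 1)) = √(9 / (N * (t 0 * t 1))) := by
        rw [Real.sqrt_div (by norm_num), Real.sqrt_mul hNR.le,
          show (9 : ℝ) = 3 ^ 2 by norm_num, Real.sqrt_sq (by norm_num)]
        field_simp
      rw [e]
      gcongr
    have hadd : Real.log (Q + 9 / N) = Real.log Q + Real.log (1 + 9 / (N * Q)) := by
      rw [← Real.log_mul hQ0.ne' (by positivity)]
      congr 1; field_simp
    have hfin := Real.log_le_log (symForm_pos (hk0 0) (hk0 1) (hk0 2)) hle
    rw [hadd] at hfin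
    have : logSymForm t = Real.log Q := rfl
    rw [this, hM]
    have e6 : 6 / √(N : ℝ) * (1 / √(t 0 * t 1)) = 2 * (3 / √N * (1 / √(t 0 * t 1))) := by ring
    rw [e6]
    linarith

theorem sum_piFinset_fin_three (s : Finset ℕ) (f : ℕ → ℕ → ℕ → ℝ) :
    ∑ k ∈ Fintype.piFinset (fun _ : Fin 3 => s), f (k 0) (k 1) (k 2)
      = ∑ x ∈ s, ∑ y ∈ s, ∑ z ∈ s, f x y z := by
  rw [← Finset.sum_product', ← Finset.sum_product']
  refine Finset.sum_nbij' (fun k => ((k 0, k 1), k 2)) (fun p => ![p.1.1, p.1.2, p.2]) ?_ ?_ ?_ ?_ ?_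
  · intro k hk; simp only [Fintype.mem_piFinset] at hk; simp [hk]
  · rintro ⟨⟨x, y⟩, z⟩ hp
    simp only [Finset.mem_product] at hp
    simp only [Fintype.mem_piFinset]
    intro i; fin_cases i <;> simp [hp]
  · intro k _; ext i; fin_cases i <;> rfl
  · rintro ⟨⟨x, y⟩, z⟩ _; rfl
  · intro k _; rfl

/-- The sum of `log (xy + yz + xz)` over a box as a Riemann sum. -/
theorem sum_log_symForm_asymp :
    ∃ C : ℝ, 0 ≤ C ∧ ∀ N : ℕ, 0 < N →
      |∑ x ∈ Finset.Icc 1 N, ∑ y ∈ Finset.Icc 1 N, ∑ z ∈ Finset.Icc 1 N,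
          Real.log (symForm x y z : ℕ)
        - (2 * (N : ℝ) ^ 3 * Real.log N
          + (N : ℝ) ^ 3 * ∫ t in Set.Icc (0 : Fin 3 → ℝ) 1, logSymForm t)|
      ≤ C * ((N : ℝ) ^ 3 / √N) := by
  set J := ∫ t in openUnitCube, logMajorant t with hJ
  have hJ0 : 0 ≤ J := by
    refine setIntegral_nonneg (MeasurableSet.univ_pi fun _ => measurableSet_Ioc) fun t ht => ?_
    have h (i : Fin 3) : 0 < t i ∧ t i ≤ 1 := ht i (Set.mem_univ i)
    exact mul_nonneg (Real.rpow_nonneg (h 0).1.le _) (Real.rpow_nonneg (h 1).1.le _)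
  refine ⟨6 * J, by positivity, fun N hN => ?_⟩
  have hNR : (0 : ℝ) < N := by exact_mod_cast hN
  set S := Fintype.piFinset fun _ : Fin 3 => Finset.Icc 1 N with hS
  have hsub (k : Fin 3 → ℕ) (hk : k ∈ S) : gridCube N k ⊆ openUnitCube := by
    rw [openUnitCube_eq_biUnion N hN]; exact Set.subset_biUnion_of_mem (u := gridCube N) hk
  have hdisj : (S : Set (Fin 3 → ℕ)).PairwiseDisjoint (gridCube N) := by
    intro k hk l hl hkl
    rw [Function.onFun, Set.disjoint_left]
    intro t ht ht'
    have hk1 (i : Fin 3) : 1 ≤ k i := (Finset.mem_Icc.mp (Fintype.mem_piFinset.mp hk i)).1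
    have hl1 (i : Fin 3) : 1 ≤ l i := (Finset.mem_Icc.mp (Fintype.mem_piFinset.mp hl i)).1
    rw [mem_gridCube_iff N hN k hk1] at ht
    rw [mem_gridCube_iff N hN l hl1] at ht'
    exact hkl (funext fun i => (ht i).symm.trans (ht' i))
  have hI : ∫ t in Set.Icc (0 : Fin 3 → ℝ) 1, logSymForm t
      = ∑ k ∈ S, ∫ t in gridCube N k, logSymForm t := by
    rw [← setIntegral_congr_set openUnitCube_ae_eq, openUnitCube_eq_biUnion N hN]
    exact integral_biUnion_finset S (fun k _ => measurableSet_gridCube N k) hdisj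
      fun k hk => integrableOn_logSymForm_cube.mono_set (hsub k hk)
  have hJ' : J = ∑ k ∈ S, ∫ t in gridCube N k, logMajorant t := by
    rw [hJ, openUnitCube_eq_biUnion N hN]
    exact integral_biUnion_finset S (fun k _ => measurableSet_gridCube N k) hdisj
      fun k hk => integrableOn_logMajorant.mono_set (hsub k hk)
  set ℓ : (Fin 3 → ℕ) → ℝ := fun k =>
    Real.log (symForm (k 0) (k 1) (k 2) : ℕ) - 2 * Real.log N with hℓ
  have hconst (k : Fin 3 → ℕ) : ∫ _ in gridCube N k, ℓ k = 1 / (N : ℝ) ^ 3 * ℓ k := by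
    rw [setIntegral_const, volume_real_gridCube N hN, smul_eq_mul]
  have hfin (k : Fin 3 → ℕ) : volume (gridCube N k) ≠ ⊤ := by
    intro h
    have := volume_real_gridCube N hN k
    rw [Measure.real, h] at this
    have hp : (0 : ℝ) < 1 / (N : ℝ) ^ 3 := by positivity
    rw [← this] at hp
    simp at hp
  have hlow : ∑ k ∈ S, ∫ t in gridCube N k, logSymForm t ≤ 1 / (N : ℝ) ^ 3 * ∑ k ∈ S, ℓ k := by
    rw [Finset.mul_sum]
    refine Finset.sum_le_sum fun k hk => ?_
    rw [← hconst]
    exact setIntegral_mono_on (integrableOn_logSymForm_cube.mono_set (hsub k hk))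
      (integrableOn_const (hfin k)) (measurableSet_gridCube N k)
      fun t ht => (gridCube_log_bounds N hN k hk t ht).1
  have hup : 1 / (N : ℝ) ^ 3 * ∑ k ∈ S, ℓ k
      ≤ (∑ k ∈ S, ∫ t in gridCube N k, logSymForm t) + 6 / √N * J := by
    rw [hJ', Finset.mul_sum, Finset.mul_sum, ← Finset.sum_add_distrib]
    refine Finset.sum_le_sum fun k hk => ?_
    have i1 := integrableOn_logSymForm_cube.mono_set (hsub k hk)
    have i2 := (integrableOn_logMajorant.mono_set (hsub k hk)).const_mul (6 / √(N : ℝ))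
    rw [← hconst, ← integral_const_mul, ← integral_add i1 i2]
    exact setIntegral_mono_on (integrableOn_const (hfin k)) (i1.add i2)
      (measurableSet_gridCube N k) fun t ht => (gridCube_log_bounds N hN k hk t ht).2
  have hcard : ∑ k ∈ S, ℓ k = ∑ x ∈ Finset.Icc 1 N, ∑ y ∈ Finset.Icc 1 N, ∑ z ∈ Finset.Icc 1 N,
      Real.log (symForm x y z : ℕ) - 2 * (N : ℝ) ^ 3 * Real.log N := by
    simp only [hℓ]
    rw [Finset.sum_sub_distrib, sum_piFinset_fin_three (Finset.Icc 1 N)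
      (fun x y z => Real.log (symForm x y z : ℕ)), Finset.sum_const, hS, Fintype.card_piFinset]
    simp
    ring
  rw [← hI] at hlow hup
  rw [hcard] at hlow hup
  set A := ∑ x ∈ Finset.Icc 1 N, ∑ y ∈ Finset.Icc 1 N, ∑ z ∈ Finset.Icc 1 N,
      Real.log (symForm x y z : ℕ)
  set I := ∫ t in Set.Icc (0 : Fin 3 → ℝ) 1, logSymForm t
  have hN3 : (0 : ℝ) < (N : ℝ) ^ 3 := by positivity
  rw [one_div, inv_mul_eq_div, le_div_iff₀ hN3] at hlow
  rw [one_div, inv_mul_eq_div, div_le_iff₀ hN3] at hup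
  have e : (I + 6 / √(N : ℝ) * J) * (N : ℝ) ^ 3 = I * (N : ℝ) ^ 3 + 6 * J * ((N : ℝ) ^ 3 / √N) := by
    ring
  rw [e] at hup
  have : 0 ≤ 6 * J * ((N : ℝ) ^ 3 / √N) := by positivity
  rw [abs_le]
  constructor <;> linarith

end LogIntegral

/-! ### Assembly and choice of the truncation parameter -/

section Assembly

/-- The integer points of `[1, N]³`. -/
def intBox (N : ℕ) : Finset (ℕ × ℕ × ℕ) :=
  Finset.Icc 1 N ×ˢ Finset.Icc 1 N ×ˢ Finset.Icc 1 N

/-- The value of the form at a point of `ℕ³`. -/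
def symValue (p : ℕ × ℕ × ℕ) : ℕ := symForm p.1 p.2.1 p.2.2

theorem sum_intBox {M : Type*} [AddCommMonoid M] (N : ℕ) (f : ℕ → ℕ → ℕ → M) :
    ∑ p ∈ intBox N, f p.1 p.2.1 p.2.2
      = ∑ x ∈ Finset.Icc 1 N, ∑ y ∈ Finset.Icc 1 N, ∑ z ∈ Finset.Icc 1 N, f x y z := by
  unfold intBox
  rw [Finset.sum_product]
  exact Finset.sum_congr rfl fun x _ => Finset.sum_product _ _ _

theorem card_intBox (N : ℕ) : (intBox N).card = N ^ 3 := by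
  simp [intBox]; ring

theorem symValue_bounds {N : ℕ} {p : ℕ × ℕ × ℕ} (hp : p ∈ intBox N) :
    0 < symValue p ∧ symValue p ≤ 3 * N ^ 2 ∧ p.1 * p.2.1 ≤ symValue p ∧
      0 < p.1 ∧ 0 < p.2.1 ∧ 0 < p.2.2 := by
  simp only [intBox, Finset.mem_product, Finset.mem_Icc] at hp
  obtain ⟨⟨h1, h1'⟩, ⟨h2, h2'⟩, h3, h3'⟩ := hp
  have e : p.1 * p.2.1 ≤ symValue p := by unfold symValue symForm; rw [add_assoc]; exact Nat.le_add_right _ _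
  refine ⟨(Nat.mul_pos h1 h2).trans_le e, ?_, e, h1, h2, h3⟩
  unfold symValue symForm
  calc _ ≤ N * N + N * N + N * N := by gcongr
    _ = _ := by ring

theorem sum_one_div_sqrt_le (N : ℕ) : ∑ n ∈ Finset.Icc 1 N, 1 / √(n : ℝ) ≤ 2 * √N := by
  induction N with
  | zero => simp
  | succ n ih =>
    rw [Finset.sum_Icc_succ_top (by omega)]
    have h0 : (0 : ℝ) ≤ n := Nat.cast_nonneg n
    have h1 := Real.sq_sqrt h0
    have h2 := Real.sq_sqrt (show (0 : ℝ) ≤ ((n + 1 : ℕ) : ℝ) by positivity)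
    have h3 : 0 < √((n + 1 : ℕ) : ℝ) := Real.sqrt_pos.mpr (by positivity)
    have h4 := Real.sqrt_nonneg (n : ℝ)
    have : 1 / √((n + 1 : ℕ) : ℝ) ≤ 2 * √((n + 1 : ℕ) : ℝ) - 2 * √n := by
      rw [div_le_iff₀ h3]
      push_cast at *
      nlinarith [sq_nonneg (√((n : ℝ) + 1) - √n)]
    linarith

theorem sum_error_terms_le (N D : ℕ) :
    ∑ d ∈ Finset.Icc 1 D, ((N : ℝ) ^ 2 / √d + N * √d + √d ^ 3)
      ≤ 2 * (N : ℝ) ^ 2 * √D + N * D * √D + D * √D ^ 3 := by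
  rw [Finset.sum_add_distrib, Finset.sum_add_distrib]
  have hle (d : ℕ) (hd : d ∈ Finset.Icc 1 D) : √(d : ℝ) ≤ √D :=
    Real.sqrt_le_sqrt (by exact_mod_cast (Finset.mem_Icc.mp hd).2)
  gcongr ?_ + ?_ + ?_
  · calc _ = (N : ℝ) ^ 2 * ∑ d ∈ Finset.Icc 1 D, 1 / √(d : ℝ) := by
          rw [Finset.mul_sum]; exact Finset.sum_congr rfl fun _ _ => by ring
      _ ≤ (N : ℝ) ^ 2 * (2 * √D) := by gcongr; exact sum_one_div_sqrt_le D
      _ = _ := by ring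
  · calc _ ≤ ∑ _d ∈ Finset.Icc 1 D, N * √(D : ℝ) :=
          Finset.sum_le_sum fun d hd => by have := hle d hd; gcongr
      _ = _ := by rw [Finset.sum_const, Nat.card_Icc]; simp; ring
  · calc _ ≤ ∑ _d ∈ Finset.Icc 1 D, √(D : ℝ) ^ 3 :=
          Finset.sum_le_sum fun d hd => by have := hle d hd; gcongr
      _ = _ := by rw [Finset.sum_const, Nat.card_Icc]; simp

/-- The density of the solutions of `xy + yz + xz ≡ 0` modulo `d`. -/
noncomputable def solDensity (d : ℕ) : ℝ := (boxCount d d d d : ℝ) / (d : ℝ) ^ 3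

/-- Summation by parts applied to the indicator of `d ∣ Q` minus its density, with weight parameter
`d²`. -/
theorem abs_sum_dvd_weight_sub_le (d N : ℕ) (hd : 0 < d) (hN : 0 < N) :
    |∑ p ∈ intBox N, (if d ∣ symValue p then (symValue p : ℝ) / (symValue p + (d : ℝ) ^ 2) else 0)
      - ∑ p ∈ intBox N, solDensity d * ((symValue p : ℝ) / (symValue p + (d : ℝ) ^ 2))|
      ≤ 10 * (2 + Real.log N) ^ 3 * (6 * d.divisors.card * (1 + Real.log d) ^ 3 *
        ((N : ℝ) ^ 2 / √d + N * √d + √d ^ 3)) := by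
  have hdR : (0 : ℝ) < (d : ℝ) ^ 2 := by positivity
  have h := abs_sum_symWeight_mul_le hdR N hN
    (fun x y z => ((if d ∣ symForm x y z then 1 else 0 : ℕ) : ℝ) - solDensity d)
    (6 * d.divisors.card * (1 + Real.log d) ^ 3 * ((N : ℝ) ^ 2 / √d + N * √d + √d ^ 3))
    (fun a b c ha hb hc => by
      refine le_trans (le_of_eq ?_) (abs_boxCount_sub_le d N a b c hd ha hb hc)
      congr 1
      simp only [Finset.sum_sub_distrib, Finset.sum_const, Nat.card_Icc, boxCount, solDensity]
      push_cast
      simp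
      ring)
  refine le_trans (le_of_eq ?_) h
  congr 1
  rw [← Finset.sum_sub_distrib, ← sum_intBox N (fun x y z => symWeight ((d : ℝ) ^ 2) x y z *
    (((if d ∣ symForm x y z then 1 else 0 : ℕ) : ℝ) - solDensity d))]
  refine Finset.sum_congr rfl fun p _ => ?_
  have e : ((symValue p : ℕ) : ℝ) = symForm (p.1 : ℝ) p.2.1 p.2.2 := by simp [symValue, symForm]
  rw [symWeight, ← e]
  unfold symValue
  split_ifs
  · push_cast; ring
  · push_cast; ring

/-- By `Q ≥ xy` and the arithmetic-geometric mean inequality, each term is at most the mean of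
`x^{-1/2}` and `y^{-1/2}`. -/
theorem sum_rpow_symValue_le (N : ℕ) :
    ∑ p ∈ intBox N, (symValue p : ℝ) ^ (-(1 / 4) : ℝ) ≤ 2 * (N : ℝ) ^ 2 * √N := by
  have hpt (p : ℕ × ℕ × ℕ) (hp : p ∈ intBox N) : (symValue p : ℝ) ^ (-(1 / 4) : ℝ)
      ≤ 1 / 2 * (1 / √(p.1 : ℝ) + 1 / √(p.2.1 : ℝ)) := by
    obtain ⟨h0, -, h1, hx, hy, -⟩ := symValue_bounds hp
    have hxR : (0 : ℝ) < p.1 := by exact_mod_cast hx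
    have hyR : (0 : ℝ) < p.2.1 := by exact_mod_cast hy
    have h1R : (p.1 : ℝ) * p.2.1 ≤ symValue p := by exact_mod_cast h1
    have e (t : ℝ) (ht : 0 < t) : 1 / √t = (t ^ (-(1 / 4) : ℝ)) ^ 2 := by
      rw [← Real.rpow_natCast, ← Real.rpow_mul ht.le, Real.sqrt_eq_rpow, one_div,
        ← Real.rpow_neg ht.le]
      norm_num
    calc (symValue p : ℝ) ^ (-(1 / 4) : ℝ) ≤ ((p.1 : ℝ) * p.2.1) ^ (-(1 / 4) : ℝ) :=
          Real.rpow_le_rpow_of_nonpos (by positivity) h1R (by norm_num)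
      _ = (p.1 : ℝ) ^ (-(1 / 4) : ℝ) * (p.2.1 : ℝ) ^ (-(1 / 4) : ℝ) := Real.mul_rpow hxR.le hyR.le
      _ ≤ _ := by
          rw [e _ hxR, e _ hyR]
          nlinarith [sq_nonneg ((p.1 : ℝ) ^ (-(1 / 4) : ℝ) - (p.2.1 : ℝ) ^ (-(1 / 4) : ℝ))]
  refine (Finset.sum_le_sum hpt).trans ?_
  rw [sum_intBox N (fun x y _ => 1 / 2 * (1 / √(x : ℝ) + 1 / √(y : ℝ)))]
  simp only [Finset.sum_const, Nat.card_Icc, Nat.add_sub_cancel, nsmul_eq_mul, ← Finset.mul_sum,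
    Finset.sum_add_distrib]
  have := sum_one_div_sqrt_le N
  calc _ = (N : ℝ) ^ 2 * ∑ n ∈ Finset.Icc 1 N, 1 / √(n : ℝ) := by ring
    _ ≤ (N : ℝ) ^ 2 * (2 * √N) := by gcongr
    _ = _ := by ring

/-- Reduction of the divisor sum to the singular series and two error terms. -/
theorem abs_sum_card_divisors_sub_le (N D : ℕ) (hN : 0 < N) (hD : 0 < D) :
    |∑ p ∈ intBox N, ((symValue p).divisors.card : ℝ)
      - 2 * ∑ p ∈ intBox N, ∑ d ∈ Finset.Icc 1 D,
          solDensity d * ((symValue p : ℝ) / (symValue p + (d : ℝ) ^ 2))|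
      ≤ ∑ p ∈ intBox N, 2 * (symValue p).divisors.card * symValue p / (D : ℝ) ^ 2
        + 2 * ∑ d ∈ Finset.Icc 1 D, 10 * (2 + Real.log N) ^ 3 *
          (6 * d.divisors.card * (1 + Real.log d) ^ 3 * ((N : ℝ) ^ 2 / √d + N * √d + √d ^ 3)) := by
  set A := ∑ p ∈ intBox N, ((symValue p).divisors.card : ℝ) with hA
  set B := ∑ p ∈ intBox N, ∑ d ∈ Finset.Icc 1 D,
    (if d ∣ symValue p then (symValue p : ℝ) / (symValue p + (d : ℝ) ^ 2) else 0) with hB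
  set E := ∑ p ∈ intBox N, ∑ d ∈ Finset.Icc 1 D,
          solDensity d * ((symValue p : ℝ) / (symValue p + (d : ℝ) ^ 2)) with hE
  have h1 : |A - 2 * B| ≤ ∑ p ∈ intBox N, 2 * (symValue p).divisors.card * symValue p / (D : ℝ) ^ 2 := by
    rw [hA, hB, Finset.mul_sum, ← Finset.sum_sub_distrib]
    exact (Finset.abs_sum_le_sum_abs _ _).trans
      (Finset.sum_le_sum fun p _ => abs_card_divisors_sub_le _ D hD)
  have h2 : |B - E| ≤ ∑ d ∈ Finset.Icc 1 D, 10 * (2 + Real.log N) ^ 3 *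
          (6 * d.divisors.card * (1 + Real.log d) ^ 3 * ((N : ℝ) ^ 2 / √d + N * √d + √d ^ 3)) := by
    rw [hB, hE, Finset.sum_comm, Finset.sum_comm (s := intBox N), ← Finset.sum_sub_distrib]
    exact (Finset.abs_sum_le_sum_abs _ _).trans
      (Finset.sum_le_sum fun d hd => abs_sum_dvd_weight_sub_le d N (Finset.mem_Icc.mp hd).1 hN)
  calc |A - 2 * E| = |(A - 2 * B) + 2 * (B - E)| := by ring_nf
    _ ≤ |A - 2 * B| + |2 * (B - E)| := abs_add_le _ _
    _ = |A - 2 * B| + 2 * |B - E| := by rw [abs_mul, abs_two]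
    _ ≤ _ := by gcongr

/-- The main term, with errors depending on the truncation parameter. -/
theorem sum_singular_series_asymp :
    ∃ C : ℝ, 0 ≤ C ∧ ∀ N D : ℕ, 0 < N → 0 < D →
      |2 * ∑ p ∈ intBox N, ∑ d ∈ Finset.Icc 1 D,
          solDensity d * ((symValue p : ℝ) / (symValue p + (d : ℝ) ^ 2))
        - (cSymMain * (N : ℝ) ^ 3 * Real.log N + cSymSecond * (N : ℝ) ^ 3)|
      ≤ C * ((N : ℝ) ^ 2 * √N + (N : ℝ) ^ 5 / (D : ℝ) ^ 2) := by
  obtain ⟨C₁, hC₁, h₁⟩ := sum_boxCount_mul_asymp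
  obtain ⟨C₂, hC₂, h₂⟩ := sum_log_symForm_asymp
  refine ⟨6 * C₁ + |totientSum| * C₂, by positivity, fun N D hN hD => ?_⟩
  have hNR : (0 : ℝ) < N := by exact_mod_cast hN
  set I := ∫ t in Set.Icc (0 : Fin 3 → ℝ) 1, logSymForm t with hI
  set F : ℕ × ℕ × ℕ → ℝ := fun p => ∑ d ∈ Finset.Icc 1 D,
    solDensity d * ((symValue p : ℝ) / (symValue p + (d : ℝ) ^ 2)) with hF
  set G : ℕ × ℕ × ℕ → ℝ := fun p =>
    totientSum * (1 / 2 * Real.log (symValue p) + Real.eulerMascheroniConstant) - 2 * totientLogSum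
    with hG
  have hFG : |∑ p ∈ intBox N, F p - ∑ p ∈ intBox N, G p|
      ≤ 3 * C₁ * ((N : ℝ) ^ 2 * √N + (N : ℝ) ^ 5 / (D : ℝ) ^ 2) := by
    rw [← Finset.sum_sub_distrib]
    calc _ ≤ ∑ p ∈ intBox N, C₁ * ((symValue p : ℝ) ^ (-(1 / 4) : ℝ) + 3 * (N : ℝ) ^ 2 / (D : ℝ) ^ 2) := by
          refine (Finset.abs_sum_le_sum_abs _ _).trans (Finset.sum_le_sum fun p hp => ?_)
          obtain ⟨h0, h3, -⟩ := symValue_bounds hp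
          refine (h₁ (symValue p) D (by exact_mod_cast h0) hD).trans ?_
          have : (symValue p : ℝ) ≤ 3 * (N : ℝ) ^ 2 := by exact_mod_cast h3
          gcongr
      _ = C₁ * (∑ p ∈ intBox N, (symValue p : ℝ) ^ (-(1 / 4) : ℝ)
            + (N : ℝ) ^ 3 * (3 * (N : ℝ) ^ 2 / (D : ℝ) ^ 2)) := by
          rw [← Finset.mul_sum, Finset.sum_add_distrib, Finset.sum_const, card_intBox, nsmul_eq_mul]
          push_cast; rfl
      _ ≤ C₁ * (3 * (N : ℝ) ^ 2 * √N + (N : ℝ) ^ 3 * (3 * (N : ℝ) ^ 2 / (D : ℝ) ^ 2)) := by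
          have := sum_rpow_symValue_le N
          have h0 : 0 ≤ (N : ℝ) ^ 2 * √N := by positivity
          gcongr
          linarith
      _ = _ := by ring
  have hGsum : 2 * ∑ p ∈ intBox N, G p = totientSum * ∑ p ∈ intBox N, Real.log (symValue p)
      + (N : ℝ) ^ 3 * (2 * totientSum * Real.eulerMascheroniConstant - 4 * totientLogSum) := by
    simp only [hG]
    rw [Finset.sum_sub_distrib, ← Finset.mul_sum, Finset.sum_add_distrib, ← Finset.mul_sum,
      Finset.sum_const, Finset.sum_const, card_intBox, nsmul_eq_mul, nsmul_eq_mul]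
    push_cast; ring
  have hconst : cSymMain * (N : ℝ) ^ 3 * Real.log N + cSymSecond * (N : ℝ) ^ 3
      = totientSum * (2 * (N : ℝ) ^ 3 * Real.log N + (N : ℝ) ^ 3 * I)
      + (N : ℝ) ^ 3 * (2 * totientSum * Real.eulerMascheroniConstant - 4 * totientLogSum) := by
    have hm : cSymMain = 2 * totientSum := by rw [cSymMain, totientSum_eq]; ring
    have hs : cSymSecond = 4 * totientSum * (Real.eulerMascheroniConstant / 2 + 1 / 4 * I
        + realZetaDeriv 3 / realZeta 3 - realZetaDeriv 4 / realZeta 4) := by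
      rw [cSymSecond, totientSum_eq, hI]; ring
    rw [hm, hs, totientLogSum_eq]; ring
  have hlog := h₂ N hN
  rw [← sum_intBox N (fun x y z => Real.log (symForm x y z : ℕ))] at hlog
  have hNs : (N : ℝ) ^ 3 / √N = (N : ℝ) ^ 2 * √N := by
    rw [div_eq_iff (Real.sqrt_pos.mpr hNR).ne', mul_assoc, Real.mul_self_sqrt hNR.le]; ring
  rw [hNs] at hlog
  rw [hconst]
  set b := (N : ℝ) ^ 2 * √N + (N : ℝ) ^ 5 / (D : ℝ) ^ 2 with hb
  have hb1 : (N : ℝ) ^ 2 * √N ≤ b := by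
    have : 0 ≤ (N : ℝ) ^ 5 / (D : ℝ) ^ 2 := by positivity
    linarith
  set Λ := ∑ p ∈ intBox N, Real.log (symValue p) with hΛ
  have hlog' : |Λ - (2 * (N : ℝ) ^ 3 * Real.log N + (N : ℝ) ^ 3 * I)| ≤ C₂ * b :=
    hlog.trans (by gcongr)
  calc _ = |2 * (∑ p ∈ intBox N, F p - ∑ p ∈ intBox N, G p)
        + totientSum * (Λ - (2 * (N : ℝ) ^ 3 * Real.log N + (N : ℝ) ^ 3 * I))| := by
        congr 1; linear_combination hGsum
    _ ≤ 2 * |∑ p ∈ intBox N, F p - ∑ p ∈ intBox N, G p|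
        + |totientSum| * |Λ - (2 * (N : ℝ) ^ 3 * Real.log N + (N : ℝ) ^ 3 * I)| := by
        refine (abs_add_le _ _).trans (le_of_eq ?_)
        rw [abs_mul, abs_mul, abs_two]
    _ ≤ 2 * (3 * C₁ * b) + |totientSum| * (C₂ * b) := by gcongr
    _ = _ := by ring

/-- The asymptotic formula at integers. -/
theorem sum_card_divisors_asymp (ε : ℝ) (hε : 0 < ε) :
    ∃ C : ℝ, 0 ≤ C ∧ ∀ N : ℕ, 0 < N →
      |∑ p ∈ intBox N, ((symValue p).divisors.card : ℝ)
        - (cSymMain * (N : ℝ) ^ 3 * Real.log N + cSymSecond * (N : ℝ) ^ 3)|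
      ≤ C * (N : ℝ) ^ (3 - 1 / 5 + ε : ℝ) := by
  -- The equidistribution error collects seven factors `D^η`: three from `log N`, three from `log
  -- d`, one from `τ(d)`. Together they cost `N^{7.7η}`, below `N^ε`.
  set η := ε / 14 with hη
  have hη0 : 0 < η := by positivity
  obtain ⟨Cτ, hCτ, hτ⟩ := card_divisors_le_rpow η hη0
  obtain ⟨Cs, hCs, hs⟩ := sum_singular_series_asymp
  have hCτ0 : 0 ≤ Cτ := by linarith
  set K := 2 + 1 / η with hK
  have hK0 : 0 ≤ K := by positivity
  refine ⟨6 * Cτ * 3 ^ η + 2 * (60 * K ^ 6 * Cτ * 2 ^ (7 * η)) * 24 + 2 * Cs, by positivity,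
    fun N hN => ?_⟩
  have hNR : (0 : ℝ) < N := by exact_mod_cast hN
  have hN1 : (1 : ℝ) ≤ N := by exact_mod_cast hN
  -- The exponent `11/10` makes `N⁵/D²` at most `N^{3-1/5}`, while `D^{5/2}` is of order `N^{11/4}`,
  -- with room to spare.
  set D := ⌈(N : ℝ) ^ (11 / 10 : ℝ)⌉₊ with hDdef
  have hpow1 : 1 ≤ (N : ℝ) ^ (11 / 10 : ℝ) := Real.one_le_rpow hN1 (by norm_num)
  have hDlow : (N : ℝ) ^ (11 / 10 : ℝ) ≤ D := Nat.le_ceil _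
  have hDup : (D : ℝ) ≤ 2 * (N : ℝ) ^ (11 / 10 : ℝ) := by
    have := Nat.ceil_lt_add_one (show 0 ≤ (N : ℝ) ^ (11 / 10 : ℝ) by positivity)
    linarith
  have hD1 : (1 : ℝ) ≤ D := hpow1.trans hDlow
  have hD : 0 < D := by exact_mod_cast (zero_lt_one.trans_le hD1)
  have hND : (N : ℝ) ≤ D := by
    refine le_trans ?_ hDlow
    nth_rewrite 1 [← Real.rpow_one (N : ℝ)]
    exact Real.rpow_le_rpow_of_exponent_le hN1 (by norm_num)
  set P := (N : ℝ) ^ (3 - 1 / 5 + ε : ℝ) with hP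
  have hD2 : (N : ℝ) ^ (11 / 5 : ℝ) ≤ (D : ℝ) ^ 2 := by
    calc (N : ℝ) ^ (11 / 5 : ℝ) = ((N : ℝ) ^ (11 / 10 : ℝ)) ^ 2 := by
          rw [← Real.rpow_natCast, ← Real.rpow_mul hNR.le]; norm_num
      _ ≤ _ := by gcongr
  have hN5D : (N : ℝ) ^ 5 / (D : ℝ) ^ 2 ≤ (N : ℝ) ^ (3 - 1 / 5 : ℝ) := by
    rw [div_le_iff₀ (by positivity)]
    calc (N : ℝ) ^ 5 = (N : ℝ) ^ (3 - 1 / 5 : ℝ) * (N : ℝ) ^ (11 / 5 : ℝ) := by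
          rw [← Real.rpow_add hNR, ← Real.rpow_natCast]; norm_num
      _ ≤ _ := by gcongr
  have hle (a : ℝ) (ha : a ≤ 3 - 1 / 5 + ε) : (N : ℝ) ^ a ≤ P :=
    Real.rpow_le_rpow_of_exponent_le hN1 ha
  -- the truncated tail
  have e1 : ∑ p ∈ intBox N, 2 * ((symValue p).divisors.card : ℝ) * symValue p / (D : ℝ) ^ 2
      ≤ 6 * Cτ * 3 ^ η * P := by
    calc _ ≤ ∑ _p ∈ intBox N, 2 * (Cτ * (3 * (N : ℝ) ^ 2) ^ η) * (3 * (N : ℝ) ^ 2) / (D : ℝ) ^ 2 := by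
          refine Finset.sum_le_sum fun p hp => ?_
          obtain ⟨h0, h3, -⟩ := symValue_bounds hp
          have h3R : (symValue p : ℝ) ≤ 3 * (N : ℝ) ^ 2 := by exact_mod_cast h3
          have : ((symValue p).divisors.card : ℝ) ≤ Cτ * (3 * (N : ℝ) ^ 2) ^ η :=
            (hτ _ h0.ne').trans (by gcongr)
          gcongr
      _ = 6 * Cτ * 3 ^ η * (((N : ℝ) ^ 2) ^ η * ((N : ℝ) ^ 5 / (D : ℝ) ^ 2)) := by
          rw [Finset.sum_const, card_intBox, nsmul_eq_mul, Real.mul_rpow (by norm_num) (by positivity)]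
          push_cast; ring
      _ ≤ 6 * Cτ * 3 ^ η * (((N : ℝ) ^ 2) ^ η * (N : ℝ) ^ (3 - 1 / 5 : ℝ)) := by gcongr
      _ = 6 * Cτ * 3 ^ η * (N : ℝ) ^ (2 * η + (3 - 1 / 5) : ℝ) := by
          rw [← Real.rpow_natCast, ← Real.rpow_mul hNR.le, ← Real.rpow_add hNR]
          push_cast; rfl
      _ ≤ _ := by
          gcongr
          exact hle _ (by rw [hη]; linarith)
  -- the equidistribution error
  have hlogle (n : ℕ) (hn : 0 < n) (hnD : (n : ℝ) ≤ D) : 2 + Real.log n ≤ K * (D : ℝ) ^ η := by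
    have hn0 : (0 : ℝ) < n := by exact_mod_cast hn
    have h1 := Real.log_le_rpow_div hn0.le hη0
    have h2 : (n : ℝ) ^ η ≤ (D : ℝ) ^ η := by gcongr
    have h3 : 1 ≤ (D : ℝ) ^ η := Real.one_le_rpow hD1 hη0.le
    calc 2 + Real.log n ≤ 2 + (n : ℝ) ^ η / η := by gcongr
      _ ≤ 2 * (D : ℝ) ^ η + (D : ℝ) ^ η / η := by gcongr; linarith
      _ = _ := by rw [hK]; ring
  have hD7 : ((D : ℝ) ^ η) ^ 7 ≤ 2 ^ (7 * η) * (N : ℝ) ^ (77 / 10 * η : ℝ) := by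
    calc ((D : ℝ) ^ η) ^ 7 = (D : ℝ) ^ (7 * η) := by
          rw [← Real.rpow_natCast, ← Real.rpow_mul (by positivity)]; push_cast; rw [mul_comm]
      _ ≤ (2 * (N : ℝ) ^ (11 / 10 : ℝ)) ^ (7 * η) := by gcongr
      _ = _ := by
          rw [Real.mul_rpow (by norm_num) (by positivity), ← Real.rpow_mul hNR.le]
          congr 2; ring
  have hsqrtD : √(D : ℝ) ≤ 2 * (N : ℝ) ^ (11 / 20 : ℝ) := by
    rw [Real.sqrt_le_left (by positivity)]
    refine hDup.trans ?_
    have : (2 * (N : ℝ) ^ (11 / 20 : ℝ)) ^ 2 = 4 * (N : ℝ) ^ (11 / 10 : ℝ) := by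
      rw [mul_pow, ← Real.rpow_natCast ((N : ℝ) ^ (11 / 20 : ℝ)), ← Real.rpow_mul hNR.le]; norm_num
    rw [this]; linarith
  have e2 : ∑ d ∈ Finset.Icc 1 D, 10 * (2 + Real.log N) ^ 3 *
          (6 * (d.divisors.card : ℝ) * (1 + Real.log d) ^ 3 *
            ((N : ℝ) ^ 2 / √d + N * √d + √d ^ 3))
      ≤ 60 * K ^ 6 * Cτ * 2 ^ (7 * η) * 24 * P := by
    have hlogN : 0 ≤ Real.log N := Real.log_natCast_nonneg N
    calc _ ≤ ∑ d ∈ Finset.Icc 1 D, 10 * (K * (D : ℝ) ^ η) ^ 3 *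
          (6 * (Cτ * (D : ℝ) ^ η) * (K * (D : ℝ) ^ η) ^ 3 *
            ((N : ℝ) ^ 2 / √d + N * √d + √d ^ 3)) := by
          refine Finset.sum_le_sum fun d hd => ?_
          obtain ⟨hd1, hdD⟩ := Finset.mem_Icc.mp hd
          have hdDR : (d : ℝ) ≤ D := by exact_mod_cast hdD
          have hlogd : 0 ≤ Real.log d := Real.log_natCast_nonneg d
          have a1 := hlogle N hN hND
          have a2 : 1 + Real.log d ≤ K * (D : ℝ) ^ η := by linarith [hlogle d hd1 hdDR]
          have a3 : (d.divisors.card : ℝ) ≤ Cτ * (D : ℝ) ^ η :=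
            (hτ d (by omega)).trans (by gcongr)
          gcongr
      _ = 60 * K ^ 6 * Cτ * ((D : ℝ) ^ η) ^ 7 *
          ∑ d ∈ Finset.Icc 1 D, ((N : ℝ) ^ 2 / √d + N * √d + √d ^ 3) := by
          rw [Finset.mul_sum]
          exact Finset.sum_congr rfl fun d _ => by ring
      _ ≤ 60 * K ^ 6 * Cτ * (2 ^ (7 * η) * (N : ℝ) ^ (77 / 10 * η : ℝ)) *
          (2 * (N : ℝ) ^ 2 * √D + N * D * √D + D * √D ^ 3) := by
          gcongr
          exact sum_error_terms_le N D
      _ ≤ 60 * K ^ 6 * Cτ * (2 ^ (7 * η) * (N : ℝ) ^ (77 / 10 * η : ℝ)) *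
          (2 * (N : ℝ) ^ 2 * (2 * (N : ℝ) ^ (11 / 20 : ℝ))
            + N * (2 * (N : ℝ) ^ (11 / 10 : ℝ)) * (2 * (N : ℝ) ^ (11 / 20 : ℝ))
            + (2 * (N : ℝ) ^ (11 / 10 : ℝ)) * (2 * (N : ℝ) ^ (11 / 20 : ℝ)) ^ 3) := by gcongr
      _ ≤ 60 * K ^ 6 * Cτ * (2 ^ (7 * η) * (N : ℝ) ^ (77 / 10 * η : ℝ)) *
          (24 * (N : ℝ) ^ (11 / 4 : ℝ)) := by
          have b1 : (N : ℝ) ^ 2 * (N : ℝ) ^ (11 / 20 : ℝ) ≤ (N : ℝ) ^ (11 / 4 : ℝ) := by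
            rw [← Real.rpow_natCast, ← Real.rpow_add hNR]
            exact Real.rpow_le_rpow_of_exponent_le hN1 (by norm_num)
          have b2 : (N : ℝ) * (N : ℝ) ^ (11 / 10 : ℝ) * (N : ℝ) ^ (11 / 20 : ℝ)
              ≤ (N : ℝ) ^ (11 / 4 : ℝ) := by
            nth_rewrite 1 [← Real.rpow_one (N : ℝ)]
            rw [← Real.rpow_add hNR, ← Real.rpow_add hNR]
            exact Real.rpow_le_rpow_of_exponent_le hN1 (by norm_num)
          have b3 : (N : ℝ) ^ (11 / 10 : ℝ) * ((N : ℝ) ^ (11 / 20 : ℝ)) ^ 3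
              ≤ (N : ℝ) ^ (11 / 4 : ℝ) := by
            rw [← Real.rpow_natCast, ← Real.rpow_mul hNR.le, ← Real.rpow_add hNR]
            exact Real.rpow_le_rpow_of_exponent_le hN1 (by norm_num)
          gcongr
          calc _ = 4 * ((N : ℝ) ^ 2 * (N : ℝ) ^ (11 / 20 : ℝ))
                + 4 * ((N : ℝ) * (N : ℝ) ^ (11 / 10 : ℝ) * (N : ℝ) ^ (11 / 20 : ℝ))
                + 16 * ((N : ℝ) ^ (11 / 10 : ℝ) * ((N : ℝ) ^ (11 / 20 : ℝ)) ^ 3) := by ring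
            _ ≤ _ := by linarith
      _ = 60 * K ^ 6 * Cτ * 2 ^ (7 * η) * 24 * (N : ℝ) ^ (77 / 10 * η + 11 / 4 : ℝ) := by
          rw [Real.rpow_add hNR]; ring
      _ ≤ _ := by
          gcongr
          exact hle _ (by rw [hη]; linarith)
  have e3 : Cs * ((N : ℝ) ^ 2 * √N + (N : ℝ) ^ 5 / (D : ℝ) ^ 2) ≤ 2 * Cs * P := by
    have c1 : (N : ℝ) ^ 2 * √N ≤ P := by
      rw [Real.sqrt_eq_rpow, ← Real.rpow_natCast, ← Real.rpow_add hNR]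
      exact hle _ (by push_cast; linarith)
    have c2 : (N : ℝ) ^ 5 / (D : ℝ) ^ 2 ≤ P := hN5D.trans (hle _ (by linarith))
    calc _ ≤ Cs * (P + P) := by gcongr
      _ = _ := by ring
  have t1 := abs_sum_card_divisors_sub_le N D hN hD
  have t2 := hs N D hN hD
  calc _ ≤ _ + _ := abs_sub_le _ _ _
    _ ≤ _ := add_le_add t1 t2
    _ ≤ (6 * Cτ * 3 ^ η * P + 2 * (60 * K ^ 6 * Cτ * 2 ^ (7 * η) * 24 * P)) + 2 * Cs * P := by
        gcongr
    _ = _ := by ring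

theorem symDivisorSum_eq (X : ℝ) :
    (symDivisorSum X : ℝ) = ∑ p ∈ intBox ⌊X⌋₊, ((symValue p).divisors.card : ℝ) := by
  unfold symDivisorSum symValue
  rw [← sum_intBox ⌊X⌋₊ (fun x y z => (symForm x y z).divisors.card)]
  push_cast
  rfl

/-- The main term changes little when `X` is replaced by its integer part. -/
theorem main_term_floor_le (a b X : ℝ) (hX : 3 ≤ X) :
    |(a * (⌊X⌋₊ : ℝ) ^ 3 * Real.log ⌊X⌋₊ + b * (⌊X⌋₊ : ℝ) ^ 3)
      - (a * X ^ 3 * Real.log X + b * X ^ 3)| ≤ (8 * |a| + 3 * |b|) * X ^ (5 / 2 : ℝ) := by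
  have hX0 : 0 < X := by linarith
  have h1 : (⌊X⌋₊ : ℝ) ≤ X := Nat.floor_le hX0.le
  have h2 : X < ⌊X⌋₊ + 1 := Nat.lt_floor_add_one X
  set n : ℝ := (⌊X⌋₊ : ℝ) with hn
  have hn2 : 2 ≤ n := by linarith
  have hn0 : 0 < n := by linarith
  have hlogn : 0 ≤ Real.log n := Real.log_nonneg (by linarith)
  have hlogle : Real.log n ≤ Real.log X := Real.log_le_log hn0 h1
  have hcube : X ^ 3 - n ^ 3 ≤ 3 * X ^ 2 := by
    have e : X ^ 3 - n ^ 3 = (X - n) * (X ^ 2 + X * n + n ^ 2) := by ring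
    rw [e]
    calc (X - n) * (X ^ 2 + X * n + n ^ 2) ≤ 1 * (X ^ 2 + X * X + X ^ 2) := by
          gcongr
          linarith
      _ = _ := by ring
  have hcube0 : 0 ≤ X ^ 3 - n ^ 3 := sub_nonneg.mpr (by gcongr)
  have hlogdiff : X * (Real.log X - Real.log n) ≤ 2 := by
    rw [← Real.log_div hX0.ne' hn0.ne']
    have := Real.log_le_sub_one_of_pos (div_pos hX0 hn0)
    calc X * Real.log (X / n) ≤ X * (X / n - 1) := by gcongr
      _ = X * (X - n) / n := by field_simp
      -- Uses `X - n < 1` and `X < n + 1 ≤ 2n`.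
      _ ≤ 2 := by rw [div_le_iff₀ hn0]; nlinarith
  have hlogX : Real.log X ≤ 2 * X ^ (1 / 2 : ℝ) := by
    have := Real.log_le_rpow_div hX0.le (ε := 1 / 2) (by norm_num)
    linarith
  have hone : 1 ≤ X ^ (1 / 2 : ℝ) := Real.one_le_rpow (by linarith) (by norm_num)
  have hpow : X ^ 2 * X ^ (1 / 2 : ℝ) = X ^ (5 / 2 : ℝ) := by
    rw [← Real.rpow_natCast, ← Real.rpow_add hX0]; norm_num
  have hA : |n ^ 3 * Real.log n - X ^ 3 * Real.log X| ≤ 8 * X ^ (5 / 2 : ℝ) := by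
    have hmono : n ^ 3 * Real.log n ≤ X ^ 3 * Real.log X := by gcongr
    rw [abs_sub_comm, abs_of_nonneg (by linarith), ← hpow]
    calc X ^ 3 * Real.log X - n ^ 3 * Real.log n
        = X ^ 2 * (X * (Real.log X - Real.log n)) + (X ^ 3 - n ^ 3) * Real.log n := by ring
      _ ≤ X ^ 2 * 2 + 3 * X ^ 2 * (2 * X ^ (1 / 2 : ℝ)) := by
          gcongr
          exact hlogle.trans hlogX
      _ ≤ X ^ 2 * (2 * X ^ (1 / 2 : ℝ)) + 3 * X ^ 2 * (2 * X ^ (1 / 2 : ℝ)) := by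
          gcongr; linarith
      _ = _ := by ring
  have hB : |n ^ 3 - X ^ 3| ≤ 3 * X ^ (5 / 2 : ℝ) := by
    rw [abs_sub_comm, abs_of_nonneg hcube0, ← hpow]
    have : 0 ≤ X ^ 2 := by positivity
    nlinarith
  calc _ = |a * (n ^ 3 * Real.log n - X ^ 3 * Real.log X) + b * (n ^ 3 - X ^ 3)| := by
        congr 1; ring
    _ ≤ |a| * |n ^ 3 * Real.log n - X ^ 3 * Real.log X| + |b| * |n ^ 3 - X ^ 3| := by
        refine (abs_add_le _ _).trans (le_of_eq ?_); rw [abs_mul, abs_mul]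
    _ ≤ |a| * (8 * X ^ (5 / 2 : ℝ)) + |b| * (3 * X ^ (5 / 2 : ℝ)) := by gcongr
    _ = _ := by ring

end Assembly

theorem mainTheorem6 :
    IntegrableOn logSymForm (Set.Icc (0 : Fin 3 → ℝ) 1) ∧
    ∀ ε : ℝ, 0 < ε → ∃ C : ℝ, ∀ X : ℝ, 3 ≤ X →
      |(symDivisorSum X : ℝ) - (cSymMain * X ^ 3 * Real.log X + cSymSecond * X ^ 3)|
        ≤ C * X ^ (3 - 1 / 5 + ε : ℝ) := by
  refine ⟨integrableOn_logSymForm, fun ε hε => ?_⟩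
  obtain ⟨C, hC, h⟩ := sum_card_divisors_asymp ε hε
  refine ⟨C + (8 * |cSymMain| + 3 * |cSymSecond|), fun X hX => ?_⟩
  have hX0 : 0 < X := by linarith
  have hN : 0 < ⌊X⌋₊ := Nat.floor_pos.mpr (by linarith)
  have h1 := h ⌊X⌋₊ hN
  rw [← symDivisorSum_eq] at h1
  have h2 := main_term_floor_le cSymMain cSymSecond X hX
  have h3 : (⌊X⌋₊ : ℝ) ^ (3 - 1 / 5 + ε : ℝ) ≤ X ^ (3 - 1 / 5 + ε : ℝ) :=
    Real.rpow_le_rpow (Nat.cast_nonneg _) (Nat.floor_le hX0.le) (by linarith)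
  have h4 : X ^ (5 / 2 : ℝ) ≤ X ^ (3 - 1 / 5 + ε : ℝ) :=
    Real.rpow_le_rpow_of_exponent_le (by linarith) (by linarith)
  calc _ ≤ _ + _ := abs_sub_le _ _ _
    _ ≤ C * (⌊X⌋₊ : ℝ) ^ (3 - 1 / 5 + ε : ℝ)
        + (8 * |cSymMain| + 3 * |cSymSecond|) * X ^ (5 / 2 : ℝ) := add_le_add h1 h2
    _ ≤ C * X ^ (3 - 1 / 5 + ε : ℝ)
        + (8 * |cSymMain| + 3 * |cSymSecond|) * X ^ (3 - 1 / 5 + ε : ℝ) := by gcongr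
    _ = _ := by ring
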